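/- **Definitions.** The model of computation is the real RAM: unit-cost operations $+,-,\times,\div$ and comparisons on real numbers, natural-number indices (with addition, subtraction, comparison and conversion to reals) for indirect addressing, integer constants, no rounding operation. *3SUM* is the problem: given a set $S$ of $n$ integers, are there $a,b,c\in S$ (not necessarily distinct) with $a+b+c=0$? A problem $Q$ is *3SUM-hard* if for some $\delta>0$ there is a fixed real-RAM program that solves every instance of 3SUM of size $n$ using $O(1)$ calls to an arbitrary solver of $Q$, each on an instance of $Q$ of size $O(n)$, and $O(n^{2-\delta})$ additional time. A *rectilinear domain* $P$ is the closed region bounded by a simple polygon (the outer polygon) minus the interiors of finitely many simple polygons (the holes), where the closed regions bounded by the holes are pairwise disjoint and lie in the interior of the outer polygon, and where all edges are axis-parallel. An instance consists of such a $P$, given by the cyclic vertex lists of its polygons, and two points $s,t\in P$; its size is the number of vertices of $P$. The *link distance* $\mathrm{OPT}$ is the minimum number of links (segments, of arbitrary orientations) of a polygonal path from $s$ to $t$ in $P$. **Statement.** 1. For every constant $\varepsilon>0$, obtaining a $(2-\varepsilon)$-approximation to the link distance in a rectilinear domain, i.e. computing a real number $d$ with $\mathrm{OPT}\le d\le(2-\varepsilon)\,\mathrm{OPT}$,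 is 3SUM-hard. 2. For every constant $c\ge 0$, obtaining an additive $c$-approximation, i.e. computing a real number $d$ with $\mathrm{OPT}\le d\le \mathrm{OPT}+c$, is 3SUM-hard. 3. For every constant integer $k\ge1$, given an instance in which $\mathrm{OPT}\in\{2+k,\,2+2k\}$, deciding whether $\mathrm{OPT}=2+k$ is 3SUM-hard. -/

import Mathlib

/-! ## A real RAM with unit-cost operations and oracle calls

Programs are structured programs over finitely many registers (natural-number registers for
indices and real registers for data) and finitely many arrays ("banks") of natural numbers and of
reals with indirect addressing.  Real operations are `+, -, *, /` and comparison; there is no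
rounding and no conversion from reals to naturals.  Every constant is an integer. -/

namespace RealRAM

/-- A memory configuration: registers and arrays. -/
structure State where
  nreg : ℕ → ℕ
  rreg : ℕ → ℝ
  /-- `nmem b i` is the cell with address `i` of the `b`-th array of naturals. -/
  nmem : ℕ → ℕ → ℕ
  /-- `rmem b i` is the cell with address `i` of the `b`-th array of reals. -/
  rmem : ℕ → ℕ → ℝ

/-- Index expressions: constants, registers, array reads, addition, truncated subtraction. -/
inductive NExpr where
  | const (k : ℕ)
  | reg (i : ℕ)
  | mem (bank : ℕ) (addr : NExpr)
  | add (a b : NExpr)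
  | sub (a b : NExpr)

/-- Real expressions. -/
inductive RExpr where
  | const (z : ℤ)
  | reg (i : ℕ)
  | mem (bank : ℕ) (addr : NExpr)
  | ofNat (a : NExpr)
  | add (a b : RExpr)
  | sub (a b : RExpr)
  | mul (a b : RExpr)
  | div (a b : RExpr)

/-- Tests. -/
inductive BExpr where
  | nle (a b : NExpr)
  | rle (a b : RExpr)
  | not (b : BExpr)
  | and (a b : BExpr)

def NExpr.eval (σ : State) : NExpr → ℕ
  | .const k => k
  | .reg i => σ.nreg i
  | .mem b a => σ.nmem b (a.eval σ)
  | .add a b => a.eval σ + b.eval σ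
  | .sub a b => a.eval σ - b.eval σ

noncomputable def RExpr.eval (σ : State) : RExpr → ℝ
  | .const z => (z : ℝ)
  | .reg i => σ.rreg i
  | .mem b a => σ.rmem b (a.eval σ)
  | .ofNat a => (a.eval σ : ℝ)
  | .add a b => a.eval σ + b.eval σ
  | .sub a b => a.eval σ - b.eval σ
  | .mul a b => a.eval σ * b.eval σ
  | .div a b => a.eval σ / b.eval σ

def BExpr.eval (σ : State) : BExpr → Prop
  | .nle a b => a.eval σ ≤ b.eval σ
  | .rle a b => a.eval σ ≤ b.eval σ
  | .not b => ¬ b.eval σ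
  | .and a b => a.eval σ ∧ b.eval σ

/-- Programs. `call r nb n rb m` asks the oracle about the instance written in the first `n` cells
of the `nb`-th array of naturals and the first `m` cells of the `rb`-th array of reals, and puts
the answer into real register `r`. -/
inductive Prog where
  | skip
  | nset (i : ℕ) (e : NExpr)
  | rset (i : ℕ) (e : RExpr)
  | nstore (bank : ℕ) (addr : NExpr) (e : NExpr)
  | rstore (bank : ℕ) (addr : NExpr) (e : RExpr)
  | seq (c d : Prog)
  | ite (b : BExpr) (c d : Prog)
  | loop (b : BExpr) (c : Prog)
  | call (r : ℕ) (nb : ℕ) (n : NExpr) (rb : ℕ) (m : NExpr)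

/-- The format of inputs and of oracle queries: a finite list of naturals and one of reals. -/
abbrev Word := List ℕ × List ℝ

/-- The query that is written in the memory. -/
def State.query (σ : State) (nb n rb m : ℕ) : Word :=
  ((List.range n).map (σ.nmem nb), (List.range m).map (σ.rmem rb))

/-- `Exec O c σ σ' t qs`: with oracle `O`, program `c` started in `σ` halts in `σ'` after `t`
steps, and `qs` is the list of the queries it made.  Each assignment, each test of a conditional
or a loop and each oracle call takes one step (the expressions in a fixed program have bounded
size, so this is the unit-cost measure up to a constant factor). -/
inductive Exec (O : Word → ℝ) : Prog → State → State → ℕ → List Word → Prop where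
  | skip (σ : State) : Exec O .skip σ σ 1 []
  | nset (σ : State) (i : ℕ) (e : NExpr) :
      Exec O (.nset i e) σ { σ with nreg := Function.update σ.nreg i (e.eval σ) } 1 []
  | rset (σ : State) (i : ℕ) (e : RExpr) :
      Exec O (.rset i e) σ { σ with rreg := Function.update σ.rreg i (e.eval σ) } 1 []
  | nstore (σ : State) (b : ℕ) (a : NExpr) (e : NExpr) :
      Exec O (.nstore b a e) σ
        { σ with nmem := Function.update σ.nmem b
                  (Function.update (σ.nmem b) (a.eval σ) (e.eval σ)) } 1 []
  | rstore (σ : State) (b : ℕ) (a : NExpr) (e : RExpr) :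
      Exec O (.rstore b a e) σ
        { σ with rmem := Function.update σ.rmem b
                  (Function.update (σ.rmem b) (a.eval σ) (e.eval σ)) } 1 []
  | seq {c d : Prog} {σ σ₁ σ₂ : State} {t₁ t₂ : ℕ} {q₁ q₂ : List Word} :
      Exec O c σ σ₁ t₁ q₁ → Exec O d σ₁ σ₂ t₂ q₂ →
      Exec O (.seq c d) σ σ₂ (t₁ + t₂) (q₁ ++ q₂)
  | iteTrue {b : BExpr} {c d : Prog} {σ σ₁ : State} {t : ℕ} {q : List Word} :
      b.eval σ → Exec O c σ σ₁ t q → Exec O (.ite b c d) σ σ₁ (1 + t) q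
  | iteFalse {b : BExpr} {c d : Prog} {σ σ₁ : State} {t : ℕ} {q : List Word} :
      ¬ b.eval σ → Exec O d σ σ₁ t q → Exec O (.ite b c d) σ σ₁ (1 + t) q
  | loopTrue {b : BExpr} {c : Prog} {σ σ₁ σ₂ : State} {t₁ t₂ : ℕ} {q₁ q₂ : List Word} :
      b.eval σ → Exec O c σ σ₁ t₁ q₁ → Exec O (.loop b c) σ₁ σ₂ t₂ q₂ →
      Exec O (.loop b c) σ σ₂ (1 + t₁ + t₂) (q₁ ++ q₂)
  | loopFalse {b : BExpr} {c : Prog} {σ : State} :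
      ¬ b.eval σ → Exec O (.loop b c) σ σ 1 []
  | call (σ : State) (r nb : ℕ) (n : NExpr) (rb : ℕ) (m : NExpr) :
      Exec O (.call r nb n rb m) σ
        { σ with rreg := Function.update σ.rreg r
                  (O (σ.query nb (n.eval σ) rb (m.eval σ))) } 1
        [σ.query nb (n.eval σ) rb (m.eval σ)]

/-- The initial memory on input `w`: the two lists are in the arrays number `0`, their lengths in
the registers `0` and `1` for naturals, and everything else is zero. -/
def init (w : Word) : State where
  nreg := fun i => if i = 0 then w.1.length else if i = 1 then w.2.length else 0
  rreg := fun _ => 0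
  nmem := fun b i => if b = 0 then w.1.getD i 0 else 0
  rmem := fun b i => if b = 0 then w.2.getD i 0 else 0

end RealRAM

/-! ## Problems, reductions, 3SUM-hardness -/

/-- A computational problem: instances, how they are written into memory, their size, and which
real outputs are acceptable (a decision problem answers `1` for yes and `0` for no). -/
structure Problem where
  Inst : Type
  encode : Inst → RealRAM.Word
  size : Inst → ℕ
  Answer : Inst → ℝ → Prop

/-- `O` answers every instance of `Q` acceptably (it is arbitrary on words that encode none). -/
def Problem.SolvedBy (Q : Problem) (O : RealRAM.Word → ℝ) : Prop :=
  ∀ x : Q.Inst, Q.Answer x (O (Q.encode x))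

/-- `P` reduces to `Q` within time `O(n ^ a)`: one fixed program solves every instance of `P` of
size `n` with `O(1)` calls to an arbitrary solver of `Q`, each on an instance of `Q` of size
`O(n)`, and `O(n ^ a)` additional time. The output is left in real register `0`. -/
def ReducesIn (a : ℝ) (P Q : Problem) : Prop :=
  ∃ (prog : RealRAM.Prog) (C : ℕ), ∀ O : RealRAM.Word → ℝ, Q.SolvedBy O → ∀ x : P.Inst,
    ∃ (σ : RealRAM.State) (t : ℕ) (qs : List RealRAM.Word),
      RealRAM.Exec O prog (RealRAM.init (P.encode x)) σ t qs ∧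
      (t : ℝ) ≤ C * ((P.size x : ℝ) + 1) ^ a ∧
      qs.length ≤ C ∧
      (∀ q ∈ qs, ∃ y : Q.Inst, Q.encode y = q ∧ Q.size y ≤ C * (P.size x + 1)) ∧
      P.Answer x (σ.rreg 0)

open Classical in
/-- 3SUM: given a set of `n` integers (listed in any order), are there elements `a, b, c` of the
set, not necessarily distinct, with `a + b + c = 0`? -/
noncomputable def threeSum : Problem where
  Inst := {l : List ℤ // l.Nodup}
  encode l := ([], l.1.map (fun z : ℤ => (z : ℝ)))
  size l := l.1.length
  Answer l r := r = if ∃ a ∈ l.1, ∃ b ∈ l.1, ∃ c ∈ l.1, a + b + c = 0 then 1 else 0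

/-- 3SUM-hardness: 3SUM reduces to `Q` in truly subquadratic time. -/
def ThreeSumHard (Q : Problem) : Prop :=
  ∃ δ : ℝ, 0 < δ ∧ ReducesIn (2 - δ) threeSum Q

/-! ## Polygonal domains and the link distance -/

/-- A polygon, given by its vertices in cyclic order. -/
abbrev Polygon2 := List (ℝ × ℝ)

namespace Polygon2

/-- The `i`-th vertex, cyclically. -/
def vertex (l : Polygon2) (i : ℕ) : ℝ × ℝ := l.getD (i % l.length) 0

/-- The `i`-th edge. -/
def edge (l : Polygon2) (i : ℕ) : Set (ℝ × ℝ) := segment ℝ (l.vertex i) (l.vertex (i + 1))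

def boundary (l : Polygon2) : Set (ℝ × ℝ) := {p | ∃ i < l.length, p ∈ l.edge i}

/-- Simple polygon: distinct vertices, and two edges meet only if they are consecutive, and then
only in their common vertex. -/
def IsSimple (l : Polygon2) : Prop :=
  3 ≤ l.length ∧ l.Nodup ∧
  ∀ i j : ℕ, i < j → j < l.length → ∀ p ∈ l.edge i ∩ l.edge j,
    (j = i + 1 ∧ p = l.vertex j) ∨ (i = 0 ∧ j + 1 = l.length ∧ p = l.vertex 0)

/-- Every edge is horizontal or vertical. -/
def IsRectilinear (l : Polygon2) : Prop :=
  ∀ i < l.length, (l.vertex i).1 = (l.vertex (i + 1)).1 ∨ (l.vertex i).2 = (l.vertex (i + 1)).2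

/-- The upward vertical ray from `p` crosses the edge from `a` to `b` (half-open convention at the
endpoints of the edge). -/
def Crosses (p a b : ℝ × ℝ) : Prop :=
  ((a.1 ≤ p.1 ∧ p.1 < b.1) ∨ (b.1 ≤ p.1 ∧ p.1 < a.1)) ∧
  p.2 < a.2 + (p.1 - a.1) / (b.1 - a.1) * (b.2 - a.2)

open Classical in
/-- The open region enclosed by a simple polygon, by the even-odd rule. -/
def inside (l : Polygon2) : Set (ℝ × ℝ) :=
  {p | p ∉ l.boundary ∧
    Odd ((Finset.range l.length).filter
      (fun i => Crosses p (l.vertex i) (l.vertex (i + 1)))).card}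

/-- The closed region bounded by a simple polygon. -/
def region (l : Polygon2) : Set (ℝ × ℝ) := l.boundary ∪ l.inside

end Polygon2

/-- There is a polygonal path with `m` links (straight segments) from `s` to `t` inside `D`. -/
def HasLinkPath (D : Set (ℝ × ℝ)) (s t : ℝ × ℝ) (m : ℕ) : Prop :=
  ∃ p : ℕ → ℝ × ℝ, p 0 = s ∧ p m = t ∧ ∀ i < m, segment ℝ (p i) (p (i + 1)) ⊆ D

/-- The link distance: the smallest number of links of a path (of unrestricted orientations) from
`s` to `t` in `D`, and `⊤` if there is no path. -/
noncomputable def linkDist (D : Set (ℝ × ℝ)) (s t : ℝ × ℝ) : ℕ∞ :=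
  ⨅ (m : ℕ) (_ : HasLinkPath D s t m), (m : ℕ∞)

/-- A polygonal domain with holes that is rectilinear, with two points of it. -/
structure RectilinearInstance where
  outer : Polygon2
  holes : List Polygon2
  s : ℝ × ℝ
  t : ℝ × ℝ
  simple : ∀ l ∈ outer :: holes, l.IsSimple
  rectilinear : ∀ l ∈ outer :: holes, l.IsRectilinear
  holes_inside : ∀ l ∈ holes, l.region ⊆ outer.inside
  holes_disjoint : holes.Pairwise (fun l l' => Disjoint l.region l'.region)
  s_mem : s ∈ outer.region \ {p | ∃ l ∈ holes, p ∈ l.inside}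
  t_mem : t ∈ outer.region \ {p | ∃ l ∈ holes, p ∈ l.inside}

namespace RectilinearInstance

/-- The (closed) domain: the outer polygon without the interiors of the holes. -/
def domain (I : RectilinearInstance) : Set (ℝ × ℝ) :=
  I.outer.region \ {p | ∃ l ∈ I.holes, p ∈ l.inside}

/-- The link distance between the two given points. -/
noncomputable def dist (I : RectilinearInstance) : ℕ∞ := linkDist I.domain I.s I.t

/-- The number of vertices. -/
def size (I : RectilinearInstance) : ℕ := ((I.outer :: I.holes).map List.length).sum

/-- The numbers of vertices of the polygons (outer polygon first), and the coordinates of `s`, of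
`t`, and of all the vertices in order. -/
def encode (I : RectilinearInstance) : RealRAM.Word :=
  ((I.outer :: I.holes).map List.length,
    (I.s :: I.t :: (I.outer :: I.holes).flatten).flatMap (fun p => [p.1, p.2]))

end RectilinearInstance

/-- Compute a value `d` with `OPT ≤ d ≤ α * OPT`, where `OPT` is the link distance in a rectilinear
domain. -/
def linkMulApprox (α : ℝ) : Problem where
  Inst := RectilinearInstance
  encode := RectilinearInstance.encode
  size := RectilinearInstance.size
  Answer I d := ∀ m : ℕ, I.dist = m → (m : ℝ) ≤ d ∧ d ≤ α * m

/-- Compute a value `d` with `OPT ≤ d ≤ OPT + c`. -/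
def linkAddApprox (c : ℝ) : Problem where
  Inst := RectilinearInstance
  encode := RectilinearInstance.encode
  size := RectilinearInstance.size
  Answer I d := ∀ m : ℕ, I.dist = m → (m : ℝ) ≤ d ∧ d ≤ m + c

open Classical in
/-- Given a rectilinear domain in which the link distance is `2 + k` or `2 + 2 * k`, decide whether
it is `2 + k`. -/
noncomputable def linkGap (k : ℕ) : Problem where
  Inst := {I : RectilinearInstance // I.dist = (2 + k : ℕ) ∨ I.dist = (2 + 2 * k : ℕ)}
  encode I := I.1.encode
  size I := I.1.size
  Answer I d := d = if I.1.dist = (2 + k : ℕ) then 1 else 0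

/-!
All three problems separate link distance `2 + k` from link distance `2 + 2 * k` for some `k ≥ 1`
(for an approximation, `k` is chosen so large that the guarantee keeps the two apart), so it is
enough to turn a list of integers into a rectilinear domain whose link distance is `2 + k` if three
of the integers sum to zero, and `2 + 2 * k` otherwise (`threeSumHard_of_gap`).

**The domain** (`Maze`) is a box with nested rings of boxes in it, three rings for each of `k`
copies of the list. A ring consists of two vertical arms and two thin horizontal walls, and one of
the walls has a slit for every integer. The outer two rings of a copy encode an integer `x` by a
slit at the offset `16 * h * x` from the axis of the copy, the middle one encodes `y` by a slit at
the offset `-(8 * h * y)`. The three walls are equally spaced, so a single link crosses a copy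
through the slits of `x`, `y` and `z` only if `x + y + z = 0` (`Maze.link_within_copy`): slits have
half-width `2 * h` while a nonzero sum of integers moves the slits `16 * h` out of line.

Holes must be disjoint, so walls and arms cannot touch, and narrow vertical *leaks* remain at the
ends of the walls. They are harmless: a link through a leak is almost vertical because the wall is
`h` times as thick as the leak is wide, and the leaks of a ring face neither the openings of the
ring inside it (`Maze.slit_exit`) nor the terminals (`Maze.link_from_s`, `Maze.link_to_t`). The
slits of consecutive copies are so far apart horizontally that no link crosses the last ring of a
copy and the first ring of the next (`Maze.link_between_copies`). They are alternately in the upper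
and in the lower walls, and the axes of the copies have the slopes `1` and `-1`, so that a path can
zigzag. One link is spent before the first copy and one after the last, and each copy costs one
link if some three integers sum to zero, and two otherwise. Conversely, the unit of length `q` is
so large that the line through collinear slits stays close to the axis, and the lines in
consecutive copies meet near the point where the axes meet (`Maze.exists_bend`); two links are
always enough for a copy (`Maze.hasLinkPath_two_mul`).

**The program** must list the slits of a wall from left to right, so it has to sort. It does so by
selection with the minima of `√n` blocks of length `√n`, which takes time `O(n ^ (3 / 2))`
(`RealRAM.runs_sortProg`) and thus gives `δ = 1 / 2`. Everything else takes linear time. Programs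
are verified in a small calculus of total correctness with time bounds (`RealRAM.Runs`).
-/

/-! ### Axis-parallel boxes as polygons -/

/-- An axis-parallel box `[x0, x1] × [y0, y1]`, given by its four bounds. -/
structure Box where
  x0 : ℝ
  x1 : ℝ
  y0 : ℝ
  y1 : ℝ

namespace Box

/-- The boundary of the box as a polygon, counterclockwise from the lower left corner. -/
def poly (b : Box) : Polygon2 := [(b.x0, b.y0), (b.x1, b.y0), (b.x1, b.y1), (b.x0, b.y1)]

/-- The box has positive width and height. -/
def Proper (b : Box) : Prop := b.x0 < b.x1 ∧ b.y0 < b.y1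

/-- The closed box, as a set of points. -/
def closedSet (b : Box) : Set (ℝ × ℝ) :=
  {p | (b.x0 ≤ p.1 ∧ p.1 ≤ b.x1) ∧ (b.y0 ≤ p.2 ∧ p.2 ≤ b.y1)}

/-- The open box, as a set of points. -/
def openSet (b : Box) : Set (ℝ × ℝ) :=
  {p | (b.x0 < p.1 ∧ p.1 < b.x1) ∧ (b.y0 < p.2 ∧ p.2 < b.y1)}

lemma mem_closedSet {b : Box} {p : ℝ × ℝ} : p ∈ b.closedSet ↔
    (b.x0 ≤ p.1 ∧ p.1 ≤ b.x1) ∧ (b.y0 ≤ p.2 ∧ p.2 ≤ b.y1) := Iff.rfl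

lemma mem_openSet {b : Box} {p : ℝ × ℝ} : p ∈ b.openSet ↔
    (b.x0 < p.1 ∧ p.1 < b.x1) ∧ (b.y0 < p.2 ∧ p.2 < b.y1) := Iff.rfl

end Box

lemma mem_segment_horizontal {a b y : ℝ} (h : a ≤ b) {p : ℝ × ℝ} :
    p ∈ segment ℝ (a, y) (b, y) ↔ (a ≤ p.1 ∧ p.1 ≤ b) ∧ p.2 = y := by
  rw [← Prod.image_mk_segment_left, segment_eq_Icc h]
  constructor
  · rintro ⟨x, hx, rfl⟩; exact ⟨hx, rfl⟩
  · rintro ⟨hx, hy⟩; exact ⟨p.1, hx, by ext <;> simp [hy]⟩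

lemma mem_segment_vertical {a b x : ℝ} (h : a ≤ b) {p : ℝ × ℝ} :
    p ∈ segment ℝ (x, a) (x, b) ↔ p.1 = x ∧ (a ≤ p.2 ∧ p.2 ≤ b) := by
  rw [← Prod.image_mk_segment_right, segment_eq_Icc h]
  constructor
  · rintro ⟨y, hy, rfl⟩; exact ⟨rfl, hy⟩
  · rintro ⟨hx, hy⟩; exact ⟨p.2, hy, by ext <;> simp [hx]⟩

namespace Box

variable {b : Box}

lemma poly_length (b : Box) : b.poly.length = 4 := rfl

lemma vertex_four (b : Box) : b.poly.vertex 4 = (b.x0, b.y0) := by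
  simp [Polygon2.vertex, poly]

lemma mem_edge_zero (hb : b.Proper) {p : ℝ × ℝ} :
    p ∈ b.poly.edge 0 ↔ (b.x0 ≤ p.1 ∧ p.1 ≤ b.x1) ∧ p.2 = b.y0 :=
  mem_segment_horizontal hb.1.le

lemma mem_edge_one (hb : b.Proper) {p : ℝ × ℝ} :
    p ∈ b.poly.edge 1 ↔ p.1 = b.x1 ∧ (b.y0 ≤ p.2 ∧ p.2 ≤ b.y1) :=
  mem_segment_vertical hb.2.le

lemma mem_edge_two (hb : b.Proper) {p : ℝ × ℝ} :
    p ∈ b.poly.edge 2 ↔ (b.x0 ≤ p.1 ∧ p.1 ≤ b.x1) ∧ p.2 = b.y1 := by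
  have : b.poly.edge 2 = segment ℝ (b.x0, b.y1) (b.x1, b.y1) := segment_symm ℝ _ _
  rw [this]; exact mem_segment_horizontal hb.1.le

lemma mem_edge_three (hb : b.Proper) {p : ℝ × ℝ} :
    p ∈ b.poly.edge 3 ↔ p.1 = b.x0 ∧ (b.y0 ≤ p.2 ∧ p.2 ≤ b.y1) := by
  have : b.poly.edge 3 = segment ℝ (b.x0, b.y0) (b.x0, b.y1) := by
    rw [Polygon2.edge, vertex_four]; exact segment_symm ℝ _ _
  rw [this]; exact mem_segment_vertical hb.2.le

lemma isSimple_poly (hb : b.Proper) : b.poly.IsSimple := by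
  obtain ⟨hx, hy⟩ := hb
  refine ⟨by simp [poly_length], ?_, ?_⟩
  · simp [poly, hx.ne, hx.ne', hy.ne]
  · intro i j hij hj p hp
    rw [poly_length] at hj ⊢
    obtain ⟨h1, h2⟩ := hp
    have v0 : b.poly.vertex 0 = (b.x0, b.y0) := rfl
    have v1 : b.poly.vertex 1 = (b.x1, b.y0) := rfl
    have v2 : b.poly.vertex 2 = (b.x1, b.y1) := rfl
    have v3 : b.poly.vertex 3 = (b.x0, b.y1) := rfl
    interval_cases j <;> interval_cases i <;>
      simp only [mem_edge_zero ⟨hx, hy⟩, mem_edge_one ⟨hx, hy⟩, mem_edge_two ⟨hx, hy⟩,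
        mem_edge_three ⟨hx, hy⟩] at h1 h2
    · exact Or.inl ⟨rfl, by rw [v1]; exact Prod.ext h2.1 h1.2⟩
    · exact absurd (h1.2.symm.trans h2.2) hy.ne
    · exact Or.inl ⟨rfl, by rw [v2]; exact Prod.ext h1.1 h2.2⟩
    · exact Or.inr ⟨rfl, rfl, by rw [v0]; exact Prod.ext h2.1 h1.2⟩
    · exact absurd (h2.1.symm.trans h1.1) hx.ne
    · exact Or.inl ⟨rfl, by rw [v3]; exact Prod.ext h2.1 h1.2⟩

lemma isRectilinear_poly (b : Box) : b.poly.IsRectilinear := by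
  intro i hi
  rw [poly_length] at hi
  interval_cases i
  · exact Or.inr rfl
  · exact Or.inl rfl
  · exact Or.inr rfl
  · exact Or.inl (by rw [vertex_four]; rfl)

lemma mem_boundary (hb : b.Proper) {p : ℝ × ℝ} :
    p ∈ b.poly.boundary ↔ p ∈ b.closedSet ∧ p ∉ b.openSet := by
  have h : p ∈ b.poly.boundary ↔
      p ∈ b.poly.edge 0 ∨ p ∈ b.poly.edge 1 ∨ p ∈ b.poly.edge 2 ∨ p ∈ b.poly.edge 3 := by
    constructor
    · rintro ⟨i, hi, hp⟩
      rw [poly_length] at hi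
      interval_cases i <;> simp [hp]
    · rintro (h | h | h | h)
      exacts [⟨0, by simp [poly_length], h⟩, ⟨1, by simp [poly_length], h⟩,
        ⟨2, by simp [poly_length], h⟩, ⟨3, by simp [poly_length], h⟩]
  rw [h, mem_edge_zero hb, mem_edge_one hb, mem_edge_two hb, mem_edge_three hb, mem_closedSet,
    mem_openSet]
  obtain ⟨hx, hy⟩ := hb
  constructor
  · rintro (⟨⟨h1, h2⟩, h3⟩ | ⟨h3, h1, h2⟩ | ⟨⟨h1, h2⟩, h3⟩ | ⟨h3, h1, h2⟩) <;>
      refine ⟨⟨⟨by linarith, by linarith⟩, by linarith, by linarith⟩, fun h => ?_⟩ <;>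
      obtain ⟨⟨_, _⟩, _, _⟩ := h <;> linarith
  · rintro ⟨⟨⟨h1, h2⟩, h3, h4⟩, h5⟩
    rcases h1.eq_or_lt with e1 | e1
    · simp [← e1, h3, h4]
    rcases h2.eq_or_lt with e2 | e2
    · simp [e2, h3, h4]
    rcases h3.eq_or_lt with e3 | e3
    · simp [← e3, h1, h2]
    rcases h4.eq_or_lt with e4 | e4
    · simp [e4, h1, h2]
    exact absurd ⟨⟨e1, e2⟩, e3, e4⟩ h5

open Classical in
lemma inside_poly (hb : b.Proper) : b.poly.inside = b.openSet := by
  -- Only the two horizontal edges can be crossed, so the parity is odd between them.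
  have key : ∀ p : ℝ × ℝ, ((Finset.range b.poly.length).filter
      (fun i => Polygon2.Crosses p (b.poly.vertex i) (b.poly.vertex (i + 1)))).card =
      if b.x0 ≤ p.1 ∧ p.1 < b.x1 then
        (if p.2 < b.y0 then 1 else 0) + (if p.2 < b.y1 then 1 else 0) else 0 := by
    intro p
    obtain ⟨hx, hy⟩ := hb
    have v0 : b.poly.vertex 0 = (b.x0, b.y0) := rfl
    have v1 : b.poly.vertex 1 = (b.x1, b.y0) := rfl
    have v2 : b.poly.vertex 2 = (b.x1, b.y1) := rfl
    have v3 : b.poly.vertex 3 = (b.x0, b.y1) := rfl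
    have vert : ∀ x y y' : ℝ, ¬ Polygon2.Crosses p (x, y) (x, y') := by
      rintro x y y' ⟨⟨h1, h2⟩ | ⟨h1, h2⟩, _⟩ <;> exact absurd h2 (not_lt.2 h1)
    have h0 : Polygon2.Crosses p (b.x0, b.y0) (b.x1, b.y0) ↔
        (b.x0 ≤ p.1 ∧ p.1 < b.x1) ∧ p.2 < b.y0 := by
      simp only [Polygon2.Crosses, sub_self, mul_zero, add_zero]
      constructor
      · rintro ⟨h | h, h'⟩
        · exact ⟨h, h'⟩
        · linarith [h.1, h.2]
      · rintro ⟨h, h'⟩; exact ⟨Or.inl h, h'⟩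
    have h2 : Polygon2.Crosses p (b.x1, b.y1) (b.x0, b.y1) ↔
        (b.x0 ≤ p.1 ∧ p.1 < b.x1) ∧ p.2 < b.y1 := by
      simp only [Polygon2.Crosses, sub_self, mul_zero, add_zero]
      constructor
      · rintro ⟨h | h, h'⟩
        · linarith [h.1, h.2]
        · exact ⟨h, h'⟩
      · rintro ⟨h, h'⟩; exact ⟨Or.inr h, h'⟩
    rw [poly_length, Finset.card_filter, Finset.sum_range_succ, Finset.sum_range_succ,
      Finset.sum_range_succ, Finset.sum_range_succ, Finset.sum_range_zero]
    simp only [Nat.reduceAdd, v0, v1, v2, v3, vertex_four, vert, h0, h2, if_false, zero_add,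
      add_zero]
    by_cases hp : b.x0 ≤ p.1 ∧ p.1 < b.x1 <;> simp [hp]
  ext p
  simp only [Polygon2.inside, Set.mem_ofPred_eq]
  rw [mem_boundary hb, key p, mem_closedSet, mem_openSet]
  obtain ⟨hx, hy⟩ := hb
  constructor
  · rintro ⟨h1, h2⟩
    by_contra h3
    apply h1
    refine ⟨?_, h3⟩
    split_ifs at h2 with a e c c
    · exact absurd h2 (by decide)
    · linarith
    · exact ⟨⟨a.1, a.2.le⟩, by linarith, c.le⟩
    · simp at h2
    · simp at h2
  · rintro h
    refine ⟨fun h' => h'.2 h, ?_⟩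
    obtain ⟨⟨h1, h2⟩, h3, h4⟩ := h
    rw [if_pos ⟨h1.le, h2⟩, if_neg (not_lt.2 h3.le), if_pos h4]
    simp

lemma openSet_subset_closedSet (b : Box) : b.openSet ⊆ b.closedSet :=
  fun _ h => ⟨⟨h.1.1.le, h.1.2.le⟩, h.2.1.le, h.2.2.le⟩

lemma region_poly (hb : b.Proper) : b.poly.region = b.closedSet := by
  ext p
  rw [Polygon2.region, Set.mem_union, mem_boundary hb, inside_poly hb]
  constructor
  · rintro (h | h)
    · exact h.1
    · exact openSet_subset_closedSet b h
  · intro h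
    by_cases h' : p ∈ b.openSet
    · exact Or.inr h'
    · exact Or.inl ⟨h, h'⟩

/-- The coordinates of the vertices, in the order in which an instance lists them. -/
def coords (b : Box) : List ℝ := [b.x0, b.y0, b.x1, b.y0, b.x1, b.y1, b.x0, b.y1]

lemma flatMap_poly (b : Box) : b.poly.flatMap (fun p => [p.1, p.2]) = b.coords := rfl

end Box

/-- The points of the closed box `o` that lie in none of the open boxes of `hs`. -/
def boxDomain (o : Box) (hs : List Box) : Set (ℝ × ℝ) :=
  {p | p ∈ o.closedSet ∧ ∀ b ∈ hs, p ∉ b.openSet}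

lemma boxDomain_eq {o : Box} {hs : List Box} (ho : o.Proper) (hh : ∀ b ∈ hs, b.Proper) :
    o.poly.region \ {p | ∃ l ∈ hs.map Box.poly, p ∈ l.inside} = boxDomain o hs := by
  ext p
  simp only [Set.mem_sdiff, Set.mem_ofPred_eq, List.mem_map, exists_exists_and_eq_and, boxDomain,
    Box.region_poly ho, not_exists, not_and]
  refine and_congr_right fun _ => forall₂_congr fun b hb => ?_
  rw [Box.inside_poly (hh b hb)]

/-- A rectilinear instance all of whose polygons are boxes. -/
def boxInstance (o : Box) (hs : List Box) (s t : ℝ × ℝ) (ho : o.Proper)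
    (hh : ∀ b ∈ hs, b.Proper) (hin : ∀ b ∈ hs, b.closedSet ⊆ o.openSet)
    (hdisj : hs.Pairwise fun b b' => Disjoint b.closedSet b'.closedSet)
    (hs' : s ∈ boxDomain o hs) (ht' : t ∈ boxDomain o hs) : RectilinearInstance where
  outer := o.poly
  holes := hs.map Box.poly
  s := s
  t := t
  simple := by
    simp only [List.mem_cons, List.mem_map]
    rintro l (rfl | ⟨b, hb, rfl⟩)
    exacts [Box.isSimple_poly ho, Box.isSimple_poly (hh b hb)]
  rectilinear := by
    simp only [List.mem_cons, List.mem_map]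
    rintro l (rfl | ⟨b, hb, rfl⟩) <;> exact Box.isRectilinear_poly _
  holes_inside := by
    simp only [List.mem_map]
    rintro l ⟨b, hb, rfl⟩
    rw [Box.region_poly (hh b hb), Box.inside_poly ho]
    exact hin b hb
  holes_disjoint := by
    rw [List.pairwise_map]
    refine hdisj.imp_of_mem fun {b b'} hb hb' h => ?_
    rwa [Box.region_poly (hh b hb), Box.region_poly (hh b' hb')]
  s_mem := by rw [boxDomain_eq ho hh]; exact hs'
  t_mem := by rw [boxDomain_eq ho hh]; exact ht'

section boxInstance

variable {o : Box} {hs : List Box} {s t : ℝ × ℝ} {ho : o.Proper}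
    {hh : ∀ b ∈ hs, b.Proper} {hin : ∀ b ∈ hs, b.closedSet ⊆ o.openSet}
    {hdisj : hs.Pairwise fun b b' => Disjoint b.closedSet b'.closedSet}
    {hs' : s ∈ boxDomain o hs} {ht' : t ∈ boxDomain o hs}

lemma boxInstance_dist : (boxInstance o hs s t ho hh hin hdisj hs' ht').dist =
    linkDist (boxDomain o hs) s t := by
  rw [← boxDomain_eq ho hh]; rfl

lemma boxInstance_size : (boxInstance o hs s t ho hh hin hdisj hs' ht').size =
    4 * (hs.length + 1) := by
  have : ((o.poly :: hs.map Box.poly).map List.length) = List.replicate (hs.length + 1) 4 := by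
    rw [List.eq_replicate_iff]
    simp only [List.length_map, List.length_cons, List.mem_map, List.mem_cons, true_and]
    rintro _ ⟨_, rfl | ⟨b, _, rfl⟩, rfl⟩ <;> rfl
  show ((o.poly :: hs.map Box.poly).map List.length).sum = _
  rw [this, List.sum_replicate, smul_eq_mul, mul_comm]

lemma boxInstance_encode : (boxInstance o hs s t ho hh hin hdisj hs' ht').encode =
    ((o :: hs).map (fun _ => 4), [s.1, s.2, t.1, t.2] ++ (o :: hs).flatMap Box.coords) := by
  show ((o.poly :: hs.map Box.poly).map List.length,
    (s :: t :: (o.poly :: hs.map Box.poly).flatten).flatMap (fun p => [p.1, p.2])) = _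
  have h1 : (o.poly :: hs.map Box.poly) = (o :: hs).map Box.poly := rfl
  rw [h1]
  generalize o :: hs = l
  refine Prod.ext ?_ ?_
  · simp only [List.map_map]; rfl
  · simp only [List.flatMap_cons, List.cons_append, List.nil_append, List.cons.injEq, true_and]
    induction l with
    | nil => rfl
    | cons b l ih =>
      simp only [List.map_cons, List.flatten_cons, List.flatMap_append, List.flatMap_cons,
        Box.flatMap_poly]
      rw [ih]

end boxInstance

/-! ### Walls with slits -/

/-- The solid intervals of a wall that reaches from `cur` to `right` and has a slit of half-width
`η` around each of the points of `zs` (listed from left to right). -/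
def solidIntervals (η : ℝ) : ℝ → List ℝ → ℝ → List (ℝ × ℝ)
  | cur, [], right => [(cur, right)]
  | cur, z :: zs, right => (cur, z - η) :: solidIntervals η (z + η) zs right

section solidIntervals

variable {η right : ℝ}

lemma length_solidIntervals (zs : List ℝ) (cur : ℝ) :
    (solidIntervals η cur zs right).length = zs.length + 1 := by
  induction zs generalizing cur with
  | nil => rfl
  | cons z zs ih => simp [solidIntervals, ih]

lemma solidIntervals_nondegenerate {zs : List ℝ} {cur : ℝ} (hcr : cur < right)
    (hzs : zs.Pairwise fun x y => x + 2 * η < y)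
    (hz : ∀ z ∈ zs, cur < z - η ∧ z + η < right) :
    ∀ I ∈ solidIntervals η cur zs right, I.1 < I.2 := by
  induction zs generalizing cur with
  | nil => simpa [solidIntervals] using hcr
  | cons z zs ih =>
    rw [List.pairwise_cons] at hzs
    intro I hI
    rcases List.mem_cons.1 hI with rfl | hI
    · exact (hz z (by simp)).1
    · exact ih (hz z (by simp)).2 hzs.2
        (fun y hy => ⟨by linarith [hzs.1 y hy], (hz y (by simp [hy])).2⟩) I hI

lemma solidIntervals_bounds (hη : 0 ≤ η) {zs : List ℝ} {cur : ℝ}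
    (hI : ∀ I ∈ solidIntervals η cur zs right, I.1 < I.2) :
    cur < right ∧ ∀ I ∈ solidIntervals η cur zs right, cur ≤ I.1 ∧ I.2 ≤ right := by
  induction zs generalizing cur with
  | nil => simpa [solidIntervals] using hI
  | cons z zs ih =>
    have h1 : cur < z - η := hI (cur, z - η) List.mem_cons_self
    obtain ⟨h2, h3⟩ := ih fun I h => hI I (List.mem_cons_of_mem _ h)
    refine ⟨by linarith, fun I h => ?_⟩
    rcases List.mem_cons.1 h with rfl | h
    · exact ⟨le_rfl, by simp only; linarith⟩
    · exact ⟨by linarith [(h3 I h).1], (h3 I h).2⟩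

lemma pairwise_solidIntervals (hη : 0 < η) {zs : List ℝ} {cur : ℝ}
    (hI : ∀ I ∈ solidIntervals η cur zs right, I.1 < I.2) :
    (solidIntervals η cur zs right).Pairwise fun I J => I.2 < J.1 := by
  induction zs generalizing cur with
  | nil => exact List.pairwise_singleton _ _
  | cons z zs ih =>
    have h := fun I h => hI I (List.mem_cons_of_mem _ h)
    refine List.pairwise_cons.2 ⟨fun I hI' => ?_, ih h⟩
    have := ((solidIntervals_bounds hη.le h).2 I hI').1
    simp only; linarith

lemma notMem_solidIntervals_of_slit (hη : 0 ≤ η) {zs : List ℝ} {cur : ℝ}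
    (hI : ∀ I ∈ solidIntervals η cur zs right, I.1 < I.2) {z x : ℝ} (hz : z ∈ zs)
    (hx : |x - z| ≤ η) : ∀ I ∈ solidIntervals η cur zs right, ¬ (I.1 < x ∧ x < I.2) := by
  rw [abs_le] at hx
  induction zs generalizing cur with
  | nil => simp at hz
  | cons y zs ih =>
    have h := fun I h => hI I (List.mem_cons_of_mem _ h)
    intro I hI'
    rcases List.mem_cons.1 hz with rfl | hz <;> rcases List.mem_cons.1 hI' with rfl | hI'
    · rintro ⟨_, h2⟩; simp only at h2; linarith
    · rintro ⟨h2, _⟩; linarith [((solidIntervals_bounds hη h).2 I hI').1]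
    · rintro ⟨_, h2⟩
      have key : ∀ (zs : List ℝ) (cur : ℝ),
          (∀ I ∈ solidIntervals η cur zs right, I.1 < I.2) → ∀ z ∈ zs, cur < z - η := by
        intro zs
        induction zs with
        | nil => simp
        | cons w ws ihw =>
          intro cur hw z hz
          have h1 : cur < w - η := hw (cur, w - η) List.mem_cons_self
          rcases List.mem_cons.1 hz with rfl | hz
          · exact h1
          · linarith [ihw (w + η) (fun I h => hw I (List.mem_cons_of_mem _ h)) z hz]
      have := key zs (y + η) h z hz
      simp only at h2; linarith
    · exact ih h hz I hI'

/-- A connected set that meets no solid interval of a wall lies on one side of the wall or in a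
single slit. -/
lemma subset_slit_of_avoids {S : Set ℝ} (hS : S.OrdConnected) {zs : List ℝ} {cur : ℝ}
    (hI : ∀ I ∈ solidIntervals η cur zs right, I.1 < I.2)
    (hav : ∀ I ∈ solidIntervals η cur zs right, ∀ x ∈ S, ¬ (I.1 < x ∧ x < I.2)) :
    S ⊆ Set.Iic cur ∨ S ⊆ Set.Ici right ∨ ∃ z ∈ zs, S ⊆ Set.Icc (z - η) (z + η) := by
  have split : ∀ c d : ℝ, c < d → (∀ x ∈ S, ¬ (c < x ∧ x < d)) →
      S ⊆ Set.Iic c ∨ S ⊆ Set.Ici d := by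
    intro c d hcd h
    by_contra! hne
    obtain ⟨⟨x, hx, hx'⟩, y, hy, hy'⟩ :=
      And.intro (Set.not_subset.1 hne.1) (Set.not_subset.1 hne.2)
    simp only [Set.mem_Iic, Set.mem_Ici, not_le] at hx' hy'
    have h1 : d ≤ x := not_lt.1 fun h' => h x hx ⟨hx', h'⟩
    have h2 : y ≤ c := not_lt.1 fun h' => h y hy ⟨h', hy'⟩
    exact h ((c + d) / 2) (hS.out hy hx ⟨by linarith, by linarith⟩) ⟨by linarith, by linarith⟩
  induction zs generalizing cur with
  | nil =>
    rcases split cur right (hI _ List.mem_cons_self) (hav _ List.mem_cons_self) with h | h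
    exacts [Or.inl h, Or.inr (Or.inl h)]
  | cons z zs ih =>
    rcases split cur (z - η) (hI _ List.mem_cons_self) (hav _ List.mem_cons_self) with h | h
    · exact Or.inl h
    · rcases ih (fun I h => hI I (List.mem_cons_of_mem _ h))
        (fun I h => hav I (List.mem_cons_of_mem _ h)) with h' | h' | ⟨y, hy, h'⟩
      · exact Or.inr (Or.inr ⟨z, by simp, fun x hx => ⟨h hx, h' hx⟩⟩)
      · exact Or.inr (Or.inl h')
      · exact Or.inr (Or.inr ⟨y, by simp [hy], h'⟩)

end solidIntervals

/-- The boxes of a horizontal wall `solidIntervals η cur zs right` at heights from `y0` to `y1`. -/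
def wallBoxes (η y0 y1 cur : ℝ) (zs : List ℝ) (right : ℝ) : List Box :=
  (solidIntervals η cur zs right).map fun I => ⟨I.1, I.2, y0, y1⟩

/-! ### Rings -/

/-- A ring of obstacles around the box `[l, R] × [-H, H]`. The lists `top` and `bot` hold the
centers of the slits in its top wall and in its bottom wall. -/
structure BoxRing where
  l : ℝ
  R : ℝ
  H : ℝ
  top : List ℝ
  bot : List ℝ

namespace BoxRing

/-- The obstacles of a ring: two vertical arms of width `1` and two horizontal walls of thickness
`h`, whose slits have half-width `2 * h`. Obstacles must be disjoint, so each wall stops at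
distance `1` from the arms; the four vertical channels of width `1` that arise are the *leaks*. -/
def holes (h : ℝ) (ρ : BoxRing) : List Box :=
  ⟨ρ.l - 1, ρ.l, -ρ.H, ρ.H⟩ :: ⟨ρ.R, ρ.R + 1, -ρ.H, ρ.H⟩ ::
    (wallBoxes (2 * h) (ρ.H - h) ρ.H (ρ.l + 1) ρ.top (ρ.R - 1) ++
      wallBoxes (2 * h) (-ρ.H) (-ρ.H + h) (ρ.l + 1) ρ.bot (ρ.R - 1))

/-- The open box that the ring occupies and surrounds. -/
def openBox (ρ : BoxRing) : Set (ℝ × ℝ) :=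
  {p | (ρ.l - 1 < p.1 ∧ p.1 < ρ.R + 1) ∧ (-ρ.H < p.2 ∧ p.2 < ρ.H)}

/-- The obstacles of the ring are proper boxes. -/
structure Good (h : ℝ) (ρ : BoxRing) : Prop where
  pos : 0 < h
  height : h < ρ.H
  top_ok : ∀ I ∈ solidIntervals (2 * h) (ρ.l + 1) ρ.top (ρ.R - 1), I.1 < I.2
  bot_ok : ∀ I ∈ solidIntervals (2 * h) (ρ.l + 1) ρ.bot (ρ.R - 1), I.1 < I.2

/-- The point lies in no open obstacle of the ring. -/
structure Avoids (h : ℝ) (ρ : BoxRing) (x y : ℝ) : Prop where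
  left : ¬ ((ρ.l - 1 < x ∧ x < ρ.l) ∧ (-ρ.H < y ∧ y < ρ.H))
  right : ¬ ((ρ.R < x ∧ x < ρ.R + 1) ∧ (-ρ.H < y ∧ y < ρ.H))
  top : ρ.H - h < y → y < ρ.H →
    ∀ I ∈ solidIntervals (2 * h) (ρ.l + 1) ρ.top (ρ.R - 1), ¬ (I.1 < x ∧ x < I.2)
  bot : -ρ.H < y → y < -ρ.H + h →
    ∀ I ∈ solidIntervals (2 * h) (ρ.l + 1) ρ.bot (ρ.R - 1), ¬ (I.1 < x ∧ x < I.2)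

lemma avoids_iff {h : ℝ} {ρ : BoxRing} {x y : ℝ} :
    ρ.Avoids h x y ↔ ∀ b ∈ ρ.holes h, (x, y) ∉ b.openSet := by
  simp only [holes, List.mem_cons, List.mem_append, wallBoxes, List.mem_map]
  constructor
  · rintro ⟨h1, h2, h3, h4⟩ b (rfl | rfl | ⟨I, hI, rfl⟩ | ⟨I, hI, rfl⟩) hb
    · exact h1 hb
    · exact h2 hb
    · exact h3 hb.2.1 hb.2.2 I hI hb.1
    · exact h4 hb.2.1 hb.2.2 I hI hb.1
  · intro H
    refine ⟨fun h => H _ (Or.inl rfl) h, fun h => H _ (Or.inr (Or.inl rfl)) h,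
      fun ha hb I hI h => H _ (Or.inr (Or.inr (Or.inl ⟨I, hI, rfl⟩))) ⟨h, ha, hb⟩,
      fun ha hb I hI h => H _ (Or.inr (Or.inr (Or.inr ⟨I, hI, rfl⟩))) ⟨h, ha, hb⟩⟩

/-- The ring mirrored in the horizontal axis. -/
def flip (ρ : BoxRing) : BoxRing := ⟨ρ.l, ρ.R, ρ.H, ρ.bot, ρ.top⟩

lemma Good.flip {h : ℝ} {ρ : BoxRing} (g : ρ.Good h) : ρ.flip.Good h :=
  ⟨g.pos, g.height, g.bot_ok, g.top_ok⟩

lemma Avoids.flip {h : ℝ} {ρ : BoxRing} {x y : ℝ} (a : ρ.Avoids h x y) :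
    ρ.flip.Avoids h x (-y) where
  left := fun ⟨h1, h2⟩ => a.left ⟨h1, by simp only [BoxRing.flip] at h2; constructor <;> linarith⟩
  right := fun ⟨h1, h2⟩ => a.right ⟨h1, by simp only [BoxRing.flip] at h2; constructor <;> linarith⟩
  top h1 h2 := a.bot (by simp only [BoxRing.flip] at h2; linarith)
    (by simp only [BoxRing.flip] at h1; linarith)
  bot h1 h2 := a.top (by simp only [BoxRing.flip] at h2; linarith)
    (by simp only [BoxRing.flip] at h1; linarith)

lemma Good.l_lt_R {h : ℝ} {ρ : BoxRing} (g : ρ.Good h) : ρ.l + 1 < ρ.R - 1 :=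
  (solidIntervals_bounds (by linarith [g.pos]) g.top_ok).1

/-- `[c, d]` is an opening on the upper (`e = 1`) or lower (`e = -1`) side of the ring: one of the
two leaks or a slit. -/
def Gap (h : ℝ) (ρ : BoxRing) (e c d : ℝ) : Prop :=
  (c = ρ.l ∧ d = ρ.l + 1) ∨ (c = ρ.R - 1 ∧ d = ρ.R) ∨
    ∃ z, (e = 1 ∧ z ∈ ρ.top ∨ e = -1 ∧ z ∈ ρ.bot) ∧ c = z - 2 * h ∧ d = z + 2 * h

lemma le_of_forall_lt_affine {A B d τ₁ τ₂ : ℝ} (h12 : τ₁ < τ₂)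
    (h : ∀ τ, τ₁ < τ → τ < τ₂ → A + τ * B ≤ d) : A + τ₁ * B ≤ d ∧ A + τ₂ * B ≤ d := by
  have hcl : IsClosed {τ : ℝ | A + τ * B ≤ d} := isClosed_le (by fun_prop) (by fun_prop)
  have hsub : Set.Icc τ₁ τ₂ ⊆ {τ : ℝ | A + τ * B ≤ d} := by
    rw [← closure_Ioo h12.ne]
    exact hcl.closure_subset_iff.2 fun τ hτ => h τ hτ.1 hτ.2
  exact ⟨hsub ⟨le_rfl, h12.le⟩, hsub ⟨h12.le, le_rfl⟩⟩

/-- A segment that leaves the box of a ring through its upper side does so in an opening; if it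
starts below the wall, then it passes through the whole height of this opening, which bounds its
slope. -/
lemma exit_up {h : ℝ} {ρ : BoxRing} (g : ρ.Good h) {a b u v τ₂ : ℝ} (h0 : 0 < τ₂)
    (hav : ∀ τ, 0 ≤ τ → τ < τ₂ → ρ.Avoids h (a + τ * u) (b + τ * v))
    (hin : ∀ τ, 0 ≤ τ → τ < τ₂ → (a + τ * u, b + τ * v) ∈ ρ.openBox)
    (hy : b + τ₂ * v = ρ.H) :
    0 < v ∧ ∃ c d, ρ.Gap h 1 c d ∧ (c ≤ a + τ₂ * u ∧ a + τ₂ * u ≤ d) ∧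
      (b ≤ ρ.H - h → |u| * h ≤ (d - c) * v ∧ (b = ρ.H - h → c ≤ a ∧ a ≤ d)) := by
  have hh := g.pos
  have hHh := g.height
  have hb : b < ρ.H := by have := (hin 0 le_rfl h0).2.2; simpa using this
  have hv : 0 < v := by
    by_contra! hv
    nlinarith
  refine ⟨hv, ?_⟩
  -- the segment is in the wall between the times `τ₁` and `τ₂`
  set τ₁ : ℝ := max 0 ((ρ.H - h - b) / v) with hτ₁
  have h1 : 0 ≤ τ₁ := le_max_left _ _
  have h12 : τ₁ < τ₂ := by
    refine max_lt h0 ?_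
    rw [div_lt_iff₀ hv]; linarith
  have hlow : ∀ τ, τ₁ < τ → ρ.H - h < b + τ * v := by
    intro τ hτ
    have := (le_max_right 0 ((ρ.H - h - b) / v)).trans_lt hτ
    rw [div_lt_iff₀ hv] at this; linarith
  have hhigh : ∀ τ, τ < τ₂ → b + τ * v < ρ.H := by
    intro τ hτ; nlinarith
  set S : Set ℝ := (fun τ => a + τ * u) '' Set.Ioo τ₁ τ₂ with hS
  have hSc : S.OrdConnected := by
    refine IsPreconnected.ordConnected ?_
    exact isPreconnected_Ioo.image _ (by fun_prop)
  have hwall : S ⊆ Set.Iic (ρ.l + 1) ∨ S ⊆ Set.Ici (ρ.R - 1) ∨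
      ∃ z ∈ ρ.top, S ⊆ Set.Icc (z - 2 * h) (z + 2 * h) := by
    refine subset_slit_of_avoids hSc g.top_ok ?_
    rintro I hI _ ⟨τ, hτ, rfl⟩
    exact (hav τ (h1.trans hτ.1.le) hτ.2).top (hlow τ hτ.1) (hhigh τ hτ.2) I hI
  have harm : ∀ τ ∈ Set.Ioo τ₁ τ₂, ρ.l ≤ a + τ * u ∧ a + τ * u ≤ ρ.R := by
    intro τ hτ
    have h3 := hin τ (h1.trans hτ.1.le) hτ.2
    have h4 := hav τ (h1.trans hτ.1.le) hτ.2
    constructor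
    · by_contra! h5; exact h4.left ⟨⟨h3.1.1, h5⟩, h3.2⟩
    · by_contra! h5; exact h4.right ⟨⟨h5, h3.1.2⟩, h3.2⟩
  obtain ⟨c, d, hgap, hcd⟩ : ∃ c d, ρ.Gap h 1 c d ∧
      ∀ τ, τ₁ < τ → τ < τ₂ → c ≤ a + τ * u ∧ a + τ * u ≤ d := by
    rcases hwall with h' | h' | ⟨z, hz, h'⟩
    · exact ⟨ρ.l, ρ.l + 1, Or.inl ⟨rfl, rfl⟩, fun τ ha hb =>
        ⟨(harm τ ⟨ha, hb⟩).1, h' ⟨τ, ⟨ha, hb⟩, rfl⟩⟩⟩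
    · exact ⟨ρ.R - 1, ρ.R, Or.inr (Or.inl ⟨rfl, rfl⟩), fun τ ha hb =>
        ⟨h' ⟨τ, ⟨ha, hb⟩, rfl⟩, (harm τ ⟨ha, hb⟩).2⟩⟩
    · exact ⟨z - 2 * h, z + 2 * h, Or.inr (Or.inr ⟨z, Or.inl ⟨rfl, hz⟩, rfl, rfl⟩),
        fun τ ha hb => h' ⟨τ, ⟨ha, hb⟩, rfl⟩⟩
  have hd := le_of_forall_lt_affine h12 fun τ ha hb => (hcd τ ha hb).2
  have hc := le_of_forall_lt_affine (A := -a) (B := -u) (d := -c) h12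
    fun τ ha hb => by linarith [(hcd τ ha hb).1]
  refine ⟨c, d, hgap, ⟨by linarith [hc.2], hd.2⟩, fun hbl => ⟨?_, fun hbe => ?_⟩⟩
  · have h5 : τ₁ = (ρ.H - h - b) / v := max_eq_right (div_nonneg (by linarith) hv.le)
    have h6 : b + τ₁ * v = ρ.H - h := by rw [h5]; field_simp; ring
    have h7 : (τ₂ - τ₁) * v = h := by linarith
    have h8 : (τ₂ - τ₁) * |u| ≤ d - c := by
      rw [← abs_of_pos (sub_pos.2 h12), ← abs_mul, abs_le]
      constructor <;> nlinarith [hc.1, hc.2, hd.1, hd.2]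
    calc |u| * h = ((τ₂ - τ₁) * |u|) * v := by rw [← h7]; ring
      _ ≤ (d - c) * v := by gcongr
  · have h5 : τ₁ = 0 := by rw [hτ₁, hbe]; simp
    rw [h5] at hc hd
    constructor
    · linarith [hc.1]
    · linarith [hd.1]

/-- A segment from the box of a ring to a point outside of it leaves the box through an opening of
its upper (`e = 1`) or lower (`e = -1`) side. -/
lemma exists_exit {h : ℝ} {ρ : BoxRing} (g : ρ.Good h) {a b u v : ℝ}
    (hav : ∀ τ, 0 ≤ τ → τ ≤ 1 → ρ.Avoids h (a + τ * u) (b + τ * v))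
    (hp : (a, b) ∈ ρ.openBox) (hq : (a + u, b + v) ∉ ρ.openBox) :
    ∃ τ e c d, (0 < τ ∧ τ ≤ 1) ∧ (e = 1 ∨ e = -1) ∧ ρ.Gap h e c d ∧ 0 < e * v ∧
      b + τ * v = e * ρ.H ∧ (c ≤ a + τ * u ∧ a + τ * u ≤ d) ∧
      (e * b ≤ ρ.H - h → |u| * h ≤ (d - c) * (e * v) ∧ (e * b = ρ.H - h → c ≤ a ∧ a ≤ d)) := by
  set f : ℝ → ℝ × ℝ := fun τ => (a + τ * u, b + τ * v) with hf
  have hfc : Continuous f := by fun_prop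
  have hopen : IsOpen ρ.openBox := by
    have : ρ.openBox = Set.Ioo (ρ.l - 1) (ρ.R + 1) ×ˢ Set.Ioo (-ρ.H) ρ.H := rfl
    rw [this]; exact isOpen_Ioo.prod isOpen_Ioo
  have hcl : IsCompact (Set.Icc (0 : ℝ) 1 ∩ f ⁻¹' ρ.openBoxᶜ) :=
    isCompact_Icc.inter_right (hopen.isClosed_compl.preimage hfc)
  obtain ⟨τ, ⟨⟨hτ0, hτ1⟩, hτ⟩, hmin⟩ := hcl.exists_isLeast
    ⟨1, ⟨zero_le_one, le_rfl⟩, by simpa [hf] using hq⟩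
  have hin : ∀ σ, 0 ≤ σ → σ < τ → f σ ∈ ρ.openBox := by
    intro σ h0 h1
    by_contra hn
    exact absurd (hmin ⟨⟨h0, h1.le.trans hτ1⟩, hn⟩) (not_le.2 h1)
  have hτpos : 0 < τ := by
    rcases hτ0.eq_or_lt with h0 | h0
    · refine absurd ?_ hτ; rw [← h0]; simpa [hf] using hp
    · exact h0
  have hx1 := (le_of_forall_lt_affine (A := a) (B := u) (d := ρ.R + 1) hτpos
    fun σ h1 h2 => (hin σ h1.le h2).1.2.le).2
  have hx2 := (le_of_forall_lt_affine (A := -a) (B := -u) (d := -(ρ.l - 1)) hτpos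
    fun σ h1 h2 => by have := (hin σ h1.le h2).1.1; simp only [hf] at this; linarith).2
  have hy1 := (le_of_forall_lt_affine (A := b) (B := v) (d := ρ.H) hτpos
    fun σ h1 h2 => (hin σ h1.le h2).2.2.le).2
  have hy2 := (le_of_forall_lt_affine (A := -b) (B := -v) (d := ρ.H) hτpos
    fun σ h1 h2 => by have := (hin σ h1.le h2).2.1; simp only [hf] at this; linarith).2
  have hlR := g.l_lt_R
  have hpx := hp.1
  simp only at hpx
  -- the segment cannot leave through an arm
  have hxR : a + τ * u < ρ.R + 1 := by
    refine lt_of_le_of_ne hx1 fun heq => ?_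
    have hu : 0 < u := by nlinarith
    have hlt : max 0 ((ρ.R - a) / u) < τ :=
      max_lt hτpos (by rw [div_lt_iff₀ hu]; linarith)
    obtain ⟨σ, h1, h2⟩ := exists_between hlt
    have h3 := (le_max_right 0 ((ρ.R - a) / u)).trans_lt h1
    have h4 := ((le_max_left 0 ((ρ.R - a) / u)).trans_lt h1).le
    rw [div_lt_iff₀ hu] at h3
    exact (hav σ h4 (h2.le.trans hτ1)).right
      ⟨⟨by linarith, (hin σ h4 h2).1.2⟩, (hin σ h4 h2).2⟩
  have hxl : ρ.l - 1 < a + τ * u := by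
    refine lt_of_le_of_ne (by linarith) fun heq => ?_
    have hu : 0 < -u := by nlinarith
    have hlt : max 0 ((a - ρ.l) / (-u)) < τ :=
      max_lt hτpos (by rw [div_lt_iff₀ hu]; linarith)
    obtain ⟨σ, h1, h2⟩ := exists_between hlt
    have h3 := (le_max_right 0 ((a - ρ.l) / (-u))).trans_lt h1
    have h4 := ((le_max_left 0 ((a - ρ.l) / (-u))).trans_lt h1).le
    rw [div_lt_iff₀ hu] at h3
    exact (hav σ h4 (h2.le.trans hτ1)).left
      ⟨⟨(hin σ h4 h2).1.1, by linarith⟩, (hin σ h4 h2).2⟩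
  have hside : b + τ * v = ρ.H ∨ b + τ * v = -ρ.H := by
    by_contra! hne
    exact hτ ⟨⟨hxl, hxR⟩, lt_of_le_of_ne (by simp only [hf]; linarith) (Ne.symm hne.2),
      lt_of_le_of_ne hy1 hne.1⟩
  rcases hside with hs | hs
  · obtain ⟨hv, c, d, h1, h2, h3⟩ := exit_up g hτpos
      (fun σ h0 h1 => hav σ h0 (h1.le.trans hτ1)) hin hs
    exact ⟨τ, 1, c, d, ⟨hτpos, hτ1⟩, Or.inl rfl, h1, by linarith, by linarith, h2,
      by simpa only [one_mul] using h3⟩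
  · have hav' : ∀ σ, 0 ≤ σ → σ < τ → ρ.flip.Avoids h (a + σ * u) (-b + σ * -v) := by
      intro σ h0 h1
      have h2 := (hav σ h0 (h1.le.trans hτ1)).flip
      rwa [show -b + σ * -v = -(b + σ * v) by ring]
    have hin' : ∀ σ, 0 ≤ σ → σ < τ → (a + σ * u, -b + σ * -v) ∈ ρ.flip.openBox := by
      intro σ h0 h1
      obtain ⟨h2, h3, h4⟩ := hin σ h0 h1
      simp only [hf] at h3 h4
      exact ⟨h2, by simp only [flip]; linarith, by simp only [flip]; linarith⟩
    obtain ⟨hv, c, d, h1, h2, h3⟩ := exit_up g.flip hτpos hav' hin'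
      (by simp only [flip]; linarith)
    refine ⟨τ, -1, c, d, ⟨hτpos, hτ1⟩, Or.inr rfl, ?_, by linarith, by linarith, h2,
      by simpa only [neg_one_mul, flip] using h3⟩
    rcases h1 with h1 | h1 | ⟨z, h1, h4⟩
    · exact Or.inl h1
    · exact Or.inr (Or.inl h1)
    · refine Or.inr (Or.inr ⟨z, ?_, h4⟩)
      rcases h1 with ⟨_, h1⟩ | ⟨h1, _⟩
      · exact Or.inr ⟨rfl, h1⟩
      · norm_num at h1

lemma avoids_of_outside {h : ℝ} {ρ : BoxRing} (g : ρ.Good h) {x y : ℝ}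
    (H : x ≤ ρ.l - 1 ∨ ρ.R + 1 ≤ x ∨ ρ.H ≤ |y|) : ρ.Avoids h x y := by
  have hlR := g.l_lt_R
  have hh := g.pos
  have hHh := g.height
  have b1 := (solidIntervals_bounds (by linarith) g.top_ok).2
  have b2 := (solidIntervals_bounds (by linarith) g.bot_ok).2
  have key : (ρ.l - 1 < x ∧ x < ρ.R + 1) ∧ (-ρ.H < y ∧ y < ρ.H) → False := by
    rintro ⟨⟨h1, h2⟩, h3⟩
    rcases H with h | h | h
    · linarith
    · linarith
    · linarith [abs_lt.2 h3]
  constructor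
  · rintro ⟨h1, h2⟩; exact key ⟨⟨h1.1, by linarith⟩, h2⟩
  · rintro ⟨h1, h2⟩; exact key ⟨⟨by linarith, h1.2⟩, h2⟩
  · rintro h1 h2 I hI ⟨h3, h4⟩
    have := b1 I hI
    exact key ⟨⟨by linarith, by linarith⟩, by linarith, h2⟩
  · rintro h1 h2 I hI ⟨h3, h4⟩
    have := b2 I hI
    exact key ⟨⟨by linarith, by linarith⟩, h1, by linarith⟩

lemma avoids_of_hollow {h : ℝ} {ρ : BoxRing} {x y : ℝ} (hx : ρ.l ≤ x ∧ x ≤ ρ.R)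
    (hy : |y| ≤ ρ.H - h) : ρ.Avoids h x y := by
  rw [abs_le] at hy
  constructor
  · rintro ⟨h1, h2⟩; linarith
  · rintro ⟨h1, h2⟩; linarith
  · intro h1; linarith
  · intro _ h1; linarith

lemma avoids_of_slit_top {h : ℝ} {ρ : BoxRing} (g : ρ.Good h) {x y z : ℝ} (hx : ρ.l ≤ x ∧ x ≤ ρ.R)
    (hy : 0 ≤ y) (hz : z ∈ ρ.top) (hxz : |x - z| ≤ 2 * h) : ρ.Avoids h x y := by
  have hHh := g.height
  constructor
  · rintro ⟨h1, h2⟩; linarith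
  · rintro ⟨h1, h2⟩; linarith
  · intro _ _
    exact notMem_solidIntervals_of_slit (by linarith [g.pos]) g.top_ok hz hxz
  · intro _ h1; linarith

lemma avoids_of_slit_bot {h : ℝ} {ρ : BoxRing} (g : ρ.Good h) {x y z : ℝ} (hx : ρ.l ≤ x ∧ x ≤ ρ.R)
    (hy : y ≤ 0) (hz : z ∈ ρ.bot) (hxz : |x - z| ≤ 2 * h) : ρ.Avoids h x y := by
  have := (avoids_of_slit_top g.flip (y := -y) hx (by linarith) hz hxz).flip
  rwa [neg_neg] at this

/-! ### Disjointness of the obstacles -/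

lemma Good.proper {h : ℝ} {ρ : BoxRing} (g : ρ.Good h) : ∀ b ∈ ρ.holes h, b.Proper := by
  have hh := g.pos
  have hHh := g.height
  simp only [holes, List.mem_cons, List.mem_append, wallBoxes, List.mem_map]
  rintro b (rfl | rfl | ⟨I, hI, rfl⟩ | ⟨I, hI, rfl⟩)
  · exact ⟨by simp, by simp only; linarith⟩
  · exact ⟨by simp, by simp only; linarith⟩
  · exact ⟨g.top_ok I hI, by simp only; linarith⟩
  · exact ⟨g.bot_ok I hI, by simp only; linarith⟩

/-- Every obstacle lies in the closed box of the ring and on one side of its hollow. -/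
lemma Good.position {h : ℝ} {ρ : BoxRing} (g : ρ.Good h) : ∀ b ∈ ρ.holes h,
    (ρ.l - 1 ≤ b.x0 ∧ b.x1 ≤ ρ.R + 1 ∧ -ρ.H ≤ b.y0 ∧ b.y1 ≤ ρ.H) ∧
    (b.x1 ≤ ρ.l ∨ ρ.R ≤ b.x0 ∨ b.y1 ≤ -ρ.H + h ∨ ρ.H - h ≤ b.y0) := by
  have hh := g.pos
  have hHh := g.height
  have hlR := g.l_lt_R
  have b1 := (solidIntervals_bounds (by linarith) g.top_ok).2
  have b2 := (solidIntervals_bounds (by linarith) g.bot_ok).2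
  simp only [holes, List.mem_cons, List.mem_append, wallBoxes, List.mem_map]
  rintro b (rfl | rfl | ⟨I, hI, rfl⟩ | ⟨I, hI, rfl⟩)
  · exact ⟨⟨le_rfl, by simp only; linarith, le_rfl, le_rfl⟩, Or.inl le_rfl⟩
  · exact ⟨⟨by simp only; linarith, le_rfl, le_rfl, le_rfl⟩, Or.inr (Or.inl le_rfl)⟩
  · have := b1 I hI
    exact ⟨⟨by simp only; linarith, by simp only; linarith, by simp only; linarith, le_rfl⟩,
      Or.inr (Or.inr (Or.inr le_rfl))⟩
  · have := b2 I hI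
    exact ⟨⟨by simp only; linarith, by simp only; linarith, le_rfl, by simp only; linarith⟩,
      Or.inr (Or.inr (Or.inl le_rfl))⟩

lemma Good.pairwise_disjoint {h : ℝ} {ρ : BoxRing} (g : ρ.Good h) :
    (ρ.holes h).Pairwise fun b b' => Disjoint b.closedSet b'.closedSet := by
  have hh := g.pos
  have hHh := g.height
  have hlR := g.l_lt_R
  have b1 := (solidIntervals_bounds (by linarith) g.top_ok).2
  have b2 := (solidIntervals_bounds (by linarith) g.bot_ok).2
  have sepx : ∀ b b' : Box, b.x1 < b'.x0 → Disjoint b.closedSet b'.closedSet := fun b b' hlt =>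
    Set.disjoint_left.2 fun p hp hp' => by linarith [hp.1.2, hp'.1.1]
  have sepy : ∀ b b' : Box, b.y1 < b'.y0 → Disjoint b.closedSet b'.closedSet := fun b b' hlt =>
    Set.disjoint_left.2 fun p hp hp' => by linarith [hp.2.2, hp'.2.1]
  have hwall : ∀ b ∈ wallBoxes (2 * h) (ρ.H - h) ρ.H (ρ.l + 1) ρ.top (ρ.R - 1) ++
      wallBoxes (2 * h) (-ρ.H) (-ρ.H + h) (ρ.l + 1) ρ.bot (ρ.R - 1),
      ρ.l + 1 ≤ b.x0 ∧ b.x1 ≤ ρ.R - 1 := by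
    simp only [List.mem_append, wallBoxes, List.mem_map]
    rintro b (⟨I, hI, rfl⟩ | ⟨I, hI, rfl⟩)
    exacts [b1 I hI, b2 I hI]
  rw [holes, List.pairwise_cons, List.pairwise_cons, List.pairwise_append]
  refine ⟨?_, ?_, ?_, ?_, ?_⟩
  · intro b hb
    rcases List.mem_cons.1 hb with rfl | hb
    · exact sepx _ _ (by simp only; linarith)
    · exact sepx _ _ (by simp only; linarith [(hwall b hb).1])
  · intro b hb
    exact (sepx _ _ (by simp only; linarith [(hwall b hb).2])).symm
  · exact List.pairwise_map.2 ((pairwise_solidIntervals (by linarith) g.top_ok).imp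
      fun hlt => sepx _ _ hlt)
  · exact List.pairwise_map.2 ((pairwise_solidIntervals (by linarith) g.bot_ok).imp
      fun hlt => sepx _ _ hlt)
  · simp only [wallBoxes, List.mem_map]
    rintro _ ⟨I, hI, rfl⟩ _ ⟨J, hJ, rfl⟩
    exact (sepy _ _ (by simp only; linarith)).symm

/-- The obstacles of a ring are disjoint from those of a ring that surrounds it. -/
lemma Good.disjoint_of_nested {h : ℝ} {ρ ρ' : BoxRing} (g : ρ.Good h) (g' : ρ'.Good h)
    (hl : ρ'.l < ρ.l - 1) (hR : ρ.R + 1 < ρ'.R) (hH : ρ.H < ρ'.H - h) :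
    ∀ b ∈ ρ.holes h, ∀ b' ∈ ρ'.holes h, Disjoint b.closedSet b'.closedSet := by
  intro b hb b' hb'
  obtain ⟨⟨h1, h2, h3, h4⟩, _⟩ := g.position b hb
  obtain ⟨_, h5⟩ := g'.position b' hb'
  refine Set.disjoint_left.2 fun p hp hp' => ?_
  obtain ⟨⟨a1, a2⟩, a3, a4⟩ := hp
  obtain ⟨⟨c1, c2⟩, c3, c4⟩ := hp'
  rcases h5 with h5 | h5 | h5 | h5 <;> linarith

end BoxRing

/-! ### The maze -/

/-- The data of a maze of nested rings: `k` copies of a group of three rings, the wall thickness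
`h`, the unit of length `q`, and the positions of the slits relative to the axis of a copy, in the
lists `A` (first and third ring of each group) and `B` (second ring).

The slits of a ring, its leaks, and the slits of the rings of another copy are apart horizontally by
multiples of `q`, against which the offsets of the slits, bounded by `M`, are negligible even after
multiplication by the number of rings. The thickness `h` is such that a link through a leak, of
width `1`, moves horizontally by less than `q` between any two rings, which are at most
`4 * (3 * k + 1) * q` apart. -/
structure Maze where
  k : ℕ
  h : ℝ
  q : ℝ
  M : ℝ
  A : List ℝ
  B : List ℝ
  one_le_k : 1 ≤ k
  h_eq : h = 16 * (3 * k + 1)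
  h_le : h ≤ M
  le_q : 400 * k * M ≤ q
  pairwise_A : A.Pairwise fun x y => x + 2 * (2 * h) < y
  pairwise_B : B.Pairwise fun x y => x + 2 * (2 * h) < y
  abs_A : ∀ x ∈ A, |x| ≤ M
  abs_B : ∀ x ∈ B, |x| ≤ M

namespace Maze

variable (m : Maze)

/-- The abscissa of the axis of copy `j` at the height of its ring number `i`. -/
def axis (j i : ℕ) : ℝ := m.q * (12 * j ^ 2 + 28 * j + 6 + 4 * i)

/-- The slit positions in the ring number `i` of a copy, relative to the axis. -/
def vals (i : ℕ) : List ℝ := if i = 1 then m.B else m.A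

/-- The slit positions in the ring number `i` of copy `j`. -/
def slits (j i : ℕ) : List ℝ := (m.vals i).map (m.axis j i + ·)

/-- The ring number `i` of copy `j`. Its slits are in the top wall if `j` is even and in the bottom
wall if `j` is odd, so that a path has to turn between consecutive copies. -/
def ring (j i : ℕ) : BoxRing where
  l := -(4 * m.q * (3 * j + 1 + i))
  R := m.axis j i + m.q
  H := 4 * m.q * (3 * j + 1 + i)
  top := if Even j then m.slits j i else []
  bot := if Even j then [] else m.slits j i

/-- The obstacles of all rings. -/
def holes : List Box :=
  (List.range m.k).flatMap fun j => (List.range 3).flatMap fun i => (m.ring j i).holes m.h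

/-- The abscissa of the turning point between copies `j - 1` and `j`, for slits on the axes. -/
def turn (j : ℕ) : ℝ := 4 * m.q * (3 * j ^ 2 + j)

/-- The outer box of the maze. -/
def outer : Box where
  x0 := -(4 * m.q * (3 * m.k + 1))
  x1 := m.turn m.k + 4 * m.q
  y0 := -(4 * m.q * (3 * m.k + 1))
  y1 := 4 * m.q * (3 * m.k + 1)

/-- The direction, up or down, in which copy `j` is traversed. -/
def sgn (j : ℕ) : ℝ := if Even j then 1 else -1

/-- The starting point, on the lower side of the top wall of the innermost ring. -/
def s : ℝ × ℝ := (0, 4 * m.q - m.h)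

/-- The target, on the outer side of the wall with slits of the outermost ring. -/
def t : ℝ × ℝ := (0, sgn (m.k - 1) * (4 * m.q * (3 * m.k)))

/-- The free space of the maze. -/
def domain : Set (ℝ × ℝ) := boxDomain m.outer m.holes

lemma one_le_k_real : (1 : ℝ) ≤ m.k := by exact_mod_cast m.one_le_k

lemma h_large : 64 ≤ m.h := by rw [m.h_eq]; linarith [m.one_le_k_real]

lemma M_large : 64 ≤ m.M := m.h_large.trans m.h_le

lemma M_le_q : 400 * m.M ≤ m.q := by
  have := m.one_le_k_real
  have := m.M_large
  have := m.le_q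
  nlinarith

lemma q_pos : 0 < m.q := by linarith [m.M_le_q, m.M_large]

lemma sgn_cases (j : ℕ) : sgn j = 1 ∨ sgn j = -1 := by
  unfold sgn; split_ifs <;> simp

lemma sgn_mul_sgn (j : ℕ) : sgn j * sgn j = 1 := by
  rcases sgn_cases j with h | h <;> rw [h] <;> norm_num

lemma abs_sgn (j : ℕ) : |sgn j| = 1 := by
  rcases sgn_cases j with h | h <;> rw [h] <;> norm_num

lemma sgn_succ (j : ℕ) : sgn (j + 1) = -sgn j := by
  unfold sgn
  by_cases h : Even j <;> simp [h, Nat.even_add_one]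

lemma pairwise_vals (i : ℕ) : (m.vals i).Pairwise fun x y => x + 2 * (2 * m.h) < y := by
  unfold vals; split_ifs
  exacts [m.pairwise_B, m.pairwise_A]

lemma abs_vals {i : ℕ} {x : ℝ} (hx : x ∈ m.vals i) : |x| ≤ m.M := by
  unfold vals at hx; split_ifs at hx
  exacts [m.abs_B x hx, m.abs_A x hx]

lemma solid_slits (j i : ℕ) :
    ∀ I ∈ solidIntervals (2 * m.h) ((m.ring j i).l + 1) (m.slits j i) ((m.ring j i).R - 1),
      I.1 < I.2 := by
  have h1 := m.h_large
  have h2 := m.h_le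
  have h3 := m.M_le_q
  have h4 := m.q_pos
  have hax : 6 * m.q ≤ m.axis j i := by
    unfold axis
    have : (0 : ℝ) ≤ 12 * j ^ 2 + 28 * j + 4 * i := by positivity
    nlinarith
  have hl : (m.ring j i).l ≤ 0 := by
    simp only [ring]
    have : 0 ≤ 4 * m.q * (3 * j + 1 + i : ℝ) := by positivity
    linarith
  have hR : (m.ring j i).R = m.axis j i + m.q := rfl
  refine solidIntervals_nondegenerate (by linarith) ?_ ?_
  · exact List.pairwise_map.2 ((m.pairwise_vals i).imp fun h => by linarith)
  · simp only [slits, List.mem_map]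
    rintro _ ⟨x, hx, rfl⟩
    have := abs_le.1 (m.abs_vals hx)
    constructor <;> linarith

lemma solid_nil (j i : ℕ) :
    ∀ I ∈ solidIntervals (2 * m.h) ((m.ring j i).l + 1) [] ((m.ring j i).R - 1), I.1 < I.2 := by
  intro I hI
  rw [List.mem_singleton.1 hI]
  exact (solidIntervals_bounds (by linarith [m.h_large]) (m.solid_slits j i)).1

lemma ring_good (j i : ℕ) : (m.ring j i).Good m.h where
  pos := by linarith [m.h_large]
  height := by
    have := m.h_le
    have := m.M_le_q
    have := m.q_pos
    have h2 : (0 : ℝ) ≤ 3 * j + i := by positivity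
    have := m.h_large
    simp only [ring]
    nlinarith
  top_ok := by
    have h1 := m.solid_slits j i
    have h2 := m.solid_nil j i
    by_cases hj : Even j
    · simpa only [ring, if_pos hj] using h1
    · simpa only [ring, if_neg hj] using h2
  bot_ok := by
    have h1 := m.solid_slits j i
    have h2 := m.solid_nil j i
    by_cases hj : Even j
    · simpa only [ring, if_pos hj] using h2
    · simpa only [ring, if_neg hj] using h1

/-- Consecutive rings are nested at distances of at least `4 * q`. -/
lemma ring_nested {j i j' i' : ℕ} (hlt : j < j' ∨ j = j' ∧ i < i') (hi : i < 3) :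
    (m.ring j' i').l + 4 * m.q ≤ (m.ring j i).l ∧ (m.ring j i).R + 4 * m.q ≤ (m.ring j' i').R ∧
      (m.ring j i).H + 4 * m.q ≤ (m.ring j' i').H := by
  have hq := m.q_pos
  have key : (1 : ℝ) ≤ 3 * j' + i' - (3 * j + i) := by
    have : 3 * j + i + 1 ≤ 3 * j' + i' := by omega
    have : ((3 * j + i + 1 : ℕ) : ℝ) ≤ (3 * j' + i' : ℕ) := by exact_mod_cast this
    push_cast at this; linarith
  have key2 : (4 : ℝ) ≤ 12 * j' ^ 2 + 28 * j' + 4 * i' - (12 * j ^ 2 + 28 * j + 4 * i) := by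
    have hjj : (j : ℝ) ≤ j' := by
      have : j ≤ j' := by omega
      exact_mod_cast this
    have : (0 : ℝ) ≤ j := by positivity
    nlinarith
  simp only [ring, axis]
  refine ⟨?_, ?_, ?_⟩ <;> nlinarith

lemma mem_holes {b : Box} : b ∈ m.holes ↔ ∃ j < m.k, ∃ i < 3, b ∈ (m.ring j i).holes m.h := by
  simp [holes, List.mem_flatMap, -List.mem_cons, List.mem_range]

lemma holes_proper : ∀ b ∈ m.holes, b.Proper := by
  intro b hb
  obtain ⟨j, _, i, _, hb⟩ := m.mem_holes.1 hb
  exact (m.ring_good j i).proper b hb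

lemma outer_proper : m.outer.Proper := by
  have hq := m.q_pos
  have hk := m.one_le_k_real
  have h1 : 0 < 4 * m.q * (3 * m.k + 1 : ℝ) := by positivity
  have h2 : 0 ≤ m.turn m.k := by unfold turn; positivity
  constructor <;> simp only [outer] <;> linarith

/-- All rings lie within these bounds. -/
lemma ring_bounds {j i : ℕ} (hj : j < m.k) (hi : i < 3) :
    -(4 * m.q * (3 * m.k)) ≤ (m.ring j i).l ∧ (m.ring j i).R ≤ m.turn m.k - m.q ∧
      (m.ring j i).H ≤ 4 * m.q * (3 * m.k) := by
  have hq := m.q_pos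
  have key : (3 * j + 1 + i : ℝ) ≤ 3 * m.k := by
    have : 3 * j + 1 + i ≤ 3 * m.k := by omega
    exact_mod_cast this
  have key2 : (12 * j ^ 2 + 28 * j + 4 * i + 8 : ℝ) ≤ 12 * m.k ^ 2 + 4 * m.k := by
    have hjk : (j + 1 : ℝ) ≤ m.k := by exact_mod_cast hj
    have : (i : ℝ) ≤ 2 := by exact_mod_cast (by omega : i ≤ 2)
    have : (0 : ℝ) ≤ j := by positivity
    nlinarith
  simp only [ring, axis, turn]
  refine ⟨?_, ?_, ?_⟩ <;> nlinarith

lemma holes_inside : ∀ b ∈ m.holes, b.closedSet ⊆ m.outer.openSet := by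
  intro b hb p hp
  obtain ⟨j, hj, i, hi, hb⟩ := m.mem_holes.1 hb
  obtain ⟨⟨h1, h2, h3, h4⟩, _⟩ := (m.ring_good j i).position b hb
  obtain ⟨h5, h6, h7⟩ := m.ring_bounds hj hi
  obtain ⟨⟨a1, a2⟩, a3, a4⟩ := hp
  have hq := m.M_le_q
  have hM := m.M_large
  refine ⟨⟨?_, ?_⟩, ?_, ?_⟩ <;> simp only [outer] <;> linarith

lemma holes_pairwise :
    m.holes.Pairwise fun b b' => Disjoint b.closedSet b'.closedSet := by
  have hq := m.M_le_q
  have hM := m.M_large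
  have hh := m.h_le
  have nested : ∀ {j i j' i' : ℕ}, (j < j' ∨ j = j' ∧ i < i') → i < 3 →
      ∀ b ∈ (m.ring j i).holes m.h, ∀ b' ∈ (m.ring j' i').holes m.h,
        Disjoint b.closedSet b'.closedSet := by
    intro j i j' i' hlt hi
    obtain ⟨h1, h2, h3⟩ := m.ring_nested hlt hi
    exact (m.ring_good j i).disjoint_of_nested (m.ring_good j' i') (by linarith) (by linarith)
      (by linarith)
  unfold holes
  rw [List.pairwise_flatMap]
  constructor
  · intro j _
    rw [List.pairwise_flatMap]
    refine ⟨fun i _ => (m.ring_good j i).pairwise_disjoint, ?_⟩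
    refine List.pairwise_lt_range.imp_of_mem fun {i i'} hi _ hlt b hb b' hb' => ?_
    exact nested (Or.inr ⟨rfl, hlt⟩) (List.mem_range.1 hi) b hb b' hb'
  · refine List.pairwise_lt_range.imp_of_mem fun {j j'} _ _ hlt b hb b' hb' => ?_
    obtain ⟨i, hi, hb⟩ := List.mem_flatMap.1 hb
    obtain ⟨i', _, hb'⟩ := List.mem_flatMap.1 hb'
    exact nested (Or.inl hlt) (List.mem_range.1 hi) b hb b' hb'

lemma mem_domain {p : ℝ × ℝ} : p ∈ m.domain ↔
    p ∈ m.outer.closedSet ∧ ∀ j < m.k, ∀ i < 3, (m.ring j i).Avoids m.h p.1 p.2 := by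
  simp only [domain, boxDomain, Set.mem_ofPred_eq, mem_holes]
  refine and_congr_right fun _ => ?_
  constructor
  · intro H j hj i hi
    exact BoxRing.avoids_iff.2 fun b hb => H b ⟨j, hj, i, hi, hb⟩
  · rintro H b ⟨j, hj, i, hi, hb⟩
    exact BoxRing.avoids_iff.1 (H j hj i hi) b hb

/-- The hollow of the innermost ring is free. -/
lemma center_mem_domain {p : ℝ × ℝ} (hx : -(4 * m.q) ≤ p.1 ∧ p.1 ≤ 7 * m.q)
    (hy : |p.2| ≤ 4 * m.q - m.h) : p ∈ m.domain := by
  have hq := m.q_pos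
  have hk := m.one_le_k_real
  have hh := m.h_large
  have hy' := abs_le.1 hy
  have h0 : (m.ring 0 0).l = -(4 * m.q) ∧ (m.ring 0 0).R = 7 * m.q ∧ (m.ring 0 0).H = 4 * m.q := by
    simp only [ring, axis]; refine ⟨?_, ?_, ?_⟩ <;> push_cast <;> ring
  obtain ⟨h1, h2, h3⟩ := h0
  have hb := m.ring_bounds (j := 0) (i := 0) m.one_le_k (by norm_num)
  rw [mem_domain]
  refine ⟨⟨⟨?_, ?_⟩, ?_, ?_⟩, fun j hj i hi => BoxRing.avoids_of_hollow ?_ ?_⟩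
  · simp only [outer]; linarith
  · simp only [outer]; linarith
  · simp only [outer]; linarith
  · simp only [outer]; linarith
  all_goals
    have hn : (m.ring j i).l ≤ -(4 * m.q) ∧ 7 * m.q ≤ (m.ring j i).R ∧
        4 * m.q ≤ (m.ring j i).H := by
      by_cases h : 0 < j ∨ 0 = j ∧ 0 < i
      · obtain ⟨a, b, c⟩ := m.ring_nested (i := 0) h (by norm_num)
        exact ⟨by linarith, by linarith, by linarith⟩
      · obtain ⟨rfl, rfl⟩ : j = 0 ∧ i = 0 := by omega
        exact ⟨h1.le, h2.ge, h3.ge⟩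
  · exact ⟨by linarith, by linarith⟩
  · linarith

/-- The room outside of the outermost ring, beyond its upper and its lower wall, is free. -/
lemma outside_mem_domain {p : ℝ × ℝ}
    (hx : -(4 * m.q * (3 * m.k + 1)) ≤ p.1 ∧ p.1 ≤ m.turn m.k + 4 * m.q)
    (hy : 4 * m.q * (3 * m.k) ≤ |p.2| ∧ |p.2| ≤ 4 * m.q * (3 * m.k + 1)) : p ∈ m.domain := by
  rw [mem_domain]
  refine ⟨⟨hx, abs_le.1 hy.2⟩, fun j hj i hi => BoxRing.avoids_of_outside (m.ring_good j i) ?_⟩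
  exact Or.inr (Or.inr ((m.ring_bounds hj hi).2.2.trans hy.1))

lemma s_mem : m.s ∈ m.domain := by
  have h1 := m.M_le_q
  have h2 := m.M_large
  have h3 := m.h_le
  refine m.center_mem_domain ⟨?_, ?_⟩ ?_ <;> simp only [s]
  · linarith
  · linarith
  · rw [abs_of_nonneg (by linarith)]

lemma abs_t : |m.t.2| = 4 * m.q * (3 * m.k) := by
  have h1 := m.q_pos
  simp only [t]
  rw [abs_mul, abs_sgn, one_mul, abs_of_nonneg (by positivity)]

lemma t_mem : m.t ∈ m.domain := by
  have h1 := m.q_pos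
  have h2 := m.one_le_k_real
  refine m.outside_mem_domain ⟨?_, ?_⟩ ⟨?_, ?_⟩
  · simp only [t]
    have : 0 ≤ 4 * m.q * (3 * m.k + 1 : ℝ) := by positivity
    linarith
  · simp only [t, turn]; positivity
  · rw [abs_t]
  · rw [abs_t]; linarith

/-- The maze as an instance of the link distance problem. -/
def toInstance : RectilinearInstance :=
  boxInstance m.outer m.holes m.s m.t m.outer_proper m.holes_proper m.holes_inside
    m.holes_pairwise m.s_mem m.t_mem

lemma toInstance_dist : m.toInstance.dist = linkDist m.domain m.s m.t := boxInstance_dist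

lemma toInstance_size : m.toInstance.size = 4 * (m.holes.length + 1) := boxInstance_size

lemma toInstance_encode : m.toInstance.encode =
    ((m.outer :: m.holes).map (fun _ => 4),
      [m.s.1, m.s.2, m.t.1, m.t.2] ++ (m.outer :: m.holes).flatMap Box.coords) :=
  boxInstance_encode

lemma length_holes : m.holes.length = m.k * (2 * m.A.length + m.B.length + 12) := by
  have h1 : ∀ j i : ℕ, ((m.ring j i).holes m.h).length = (m.vals i).length + 4 := by
    intro j i
    simp only [BoxRing.holes, wallBoxes, List.length_cons, List.length_append, List.length_map,
      length_solidIntervals, ring]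
    (split_ifs <;> simp [slits]); omega
  have h2 : ∀ j : ℕ, ((List.range 3).flatMap fun i => (m.ring j i).holes m.h).length =
      2 * m.A.length + m.B.length + 12 := by
    intro j
    simp only [List.length_flatMap, List.range_succ, List.range_zero, List.map_append,
      List.map_cons, List.map_nil, List.sum_append, List.sum_cons, List.sum_nil, h1, vals]
    simp; omega
  rw [holes, List.length_flatMap]
  simp only [h2]
  simp

end Maze

/-! ### Lower bounds on the link distance in the maze -/

namespace Maze

variable (m : Maze)

lemma openBox_mono {j i j' i' : ℕ} (hlt : j < j' ∨ j = j' ∧ i < i') (hi : i < 3) :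
    (m.ring j i).openBox ⊆ (m.ring j' i').openBox := by
  obtain ⟨h1, h2, h3⟩ := m.ring_nested hlt hi
  have hq := m.q_pos
  rintro p ⟨⟨a1, a2⟩, a3, a4⟩
  exact ⟨⟨by linarith, by linarith⟩, by linarith, by linarith⟩

lemma openBox_subset_last {j i : ℕ} (hj : j < m.k) (hi : i < 3) :
    (m.ring j i).openBox ⊆ (m.ring (m.k - 1) 2).openBox := by
  by_cases h : j < m.k - 1 ∨ j = m.k - 1 ∧ i < 2
  · exact m.openBox_mono h hi
  · obtain ⟨rfl, rfl⟩ : j = m.k - 1 ∧ i = 2 := by omega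
    exact subset_rfl

lemma mem_slits_bounds {j i : ℕ} {z : ℝ} (hz : z ∈ m.slits j i) : |z - m.axis j i| ≤ m.M := by
  obtain ⟨x, hx, rfl⟩ := List.mem_map.1 hz
  simpa using m.abs_vals hx

/-- An opening of a ring is a leak or one of its slits. -/
lemma gap_cases {j i : ℕ} {e c d : ℝ} (hg : (m.ring j i).Gap m.h e c d) :
    (c = (m.ring j i).l ∧ d = (m.ring j i).l + 1) ∨
    (c = (m.ring j i).R - 1 ∧ d = (m.ring j i).R) ∨
    ∃ z ∈ m.slits j i, c = z - 2 * m.h ∧ d = z + 2 * m.h := by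
  rcases hg with h | h | ⟨z, hz, h⟩
  · exact Or.inl h
  · exact Or.inr (Or.inl h)
  · refine Or.inr (Or.inr ⟨z, ?_, h⟩)
    simp only [ring] at hz
    rcases hz with ⟨_, hz⟩ | ⟨_, hz⟩ <;> split_ifs at hz <;> first | exact hz | simp at hz

/-- Openings lie between the arms of the ring. -/
lemma gap_bounds {j i : ℕ} {e c d : ℝ} (hg : (m.ring j i).Gap m.h e c d) :
    (m.ring j i).l ≤ c ∧ d ≤ (m.ring j i).R := by
  have h1 := m.M_le_q
  have h2 := m.M_large
  have h3 := m.h_le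
  have h4 := (m.ring_good j i).l_lt_R
  rcases m.gap_cases hg with ⟨rfl, rfl⟩ | ⟨rfl, rfl⟩ | ⟨z, hz, rfl, rfl⟩
  · exact ⟨le_rfl, by linarith⟩
  · exact ⟨by linarith, le_rfl⟩
  · have h5 := abs_le.1 (m.mem_slits_bounds hz)
    have h6 : (m.ring j i).R = m.axis j i + m.q := rfl
    have h7 : (m.ring j i).l ≤ 0 := by
      simp only [ring]
      have h8 := m.q_pos
      have : 0 ≤ 4 * m.q * (3 * j + 1 + i : ℝ) := by positivity
      linarith
    have h8 : 6 * m.q ≤ m.axis j i := by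
      unfold axis
      have : (0 : ℝ) ≤ 12 * j ^ 2 + 28 * j + 4 * i := by positivity
      nlinarith [m.q_pos]
    constructor <;> linarith

lemma avoids_on_segment {p p' : ℝ × ℝ} (hseg : segment ℝ p p' ⊆ m.domain) {j i : ℕ}
    (hj : j < m.k) (hi : i < 3) : ∀ τ : ℝ, 0 ≤ τ → τ ≤ 1 →
      (m.ring j i).Avoids m.h (p.1 + τ * (p'.1 - p.1)) (p.2 + τ * (p'.2 - p.2)) := by
  intro τ h0 h1
  have hmem : p + τ • (p' - p) ∈ segment ℝ p p' := by
    rw [segment_eq_image']; exact ⟨τ, ⟨h0, h1⟩, rfl⟩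
  exact (m.mem_domain.1 (hseg hmem)).2 j hj i hi

/-- Some link leaves the box of a ring (see `BoxRing.exists_exit`). -/
lemma exists_exit {p p' : ℝ × ℝ} (hseg : segment ℝ p p' ⊆ m.domain) {j i : ℕ}
    (hj : j < m.k) (hi : i < 3) (hp : p ∈ (m.ring j i).openBox)
    (hp' : p' ∉ (m.ring j i).openBox) :
    ∃ τ e c d, (0 < τ ∧ τ ≤ 1) ∧ (e = 1 ∨ e = -1) ∧ (m.ring j i).Gap m.h e c d ∧
      0 < e * (p'.2 - p.2) ∧ p.2 + τ * (p'.2 - p.2) = e * (m.ring j i).H ∧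
      (c ≤ p.1 + τ * (p'.1 - p.1) ∧ p.1 + τ * (p'.1 - p.1) ≤ d) ∧
      (e * p.2 ≤ (m.ring j i).H - m.h → |p'.1 - p.1| * m.h ≤ (d - c) * (e * (p'.2 - p.2)) ∧
        (e * p.2 = (m.ring j i).H - m.h → c ≤ p.1 ∧ p.1 ≤ d)) := by
  refine BoxRing.exists_exit (m.ring_good j i) (m.avoids_on_segment hseg hj hi) hp ?_
  simpa using hp'

/-- A link that starts inside a ring and leaves a surrounding ring passes through one of the slits
of the latter: a leak would force it to be almost vertical, but the leaks of the two rings are far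
apart horizontally. The wall is thick enough to bound the slope of the link as well. -/
lemma slit_exit {p p' : ℝ × ℝ} (hseg : segment ℝ p p' ⊆ m.domain) {j i j' i' : ℕ}
    (hj' : j' < m.k) (hi : i < 3) (hi' : i' < 3) (hlt : j < j' ∨ j = j' ∧ i < i')
    (hp : p ∈ (m.ring j i).openBox) (hp' : p' ∉ (m.ring j' i').openBox) :
    ∃ τ e, (e = 1 ∨ e = -1) ∧ 0 < e * (p'.2 - p.2) ∧
      p.2 + τ * (p'.2 - p.2) = e * (m.ring j' i').H ∧
      (∃ z ∈ m.slits j' i', |p.1 + τ * (p'.1 - p.1) - z| ≤ 2 * m.h) ∧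
      |p'.1 - p.1| ≤ 4 * (e * (p'.2 - p.2)) := by
  have hj : j < m.k := by omega
  obtain ⟨n1, n2, n3⟩ := m.ring_nested hlt hi
  have hq := m.M_le_q
  have hM := m.M_large
  have hh := m.h_le
  have hh0 := m.h_large
  obtain ⟨τ, e, c, d, hτ, he, hg, hev, hy, hx, -⟩ := m.exists_exit hseg hj hi hp
    fun h => hp' (m.openBox_mono hlt hi h)
  obtain ⟨τ', e', c', d', hτ', he', hg', hev', hy', hx', hfull⟩ := m.exists_exit hseg hj' hi'
    (m.openBox_mono hlt hi hp) hp'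
  have hee : e' = e := by
    rcases he with rfl | rfl <;> rcases he' with rfl | rfl <;> first | rfl | linarith
  subst hee
  have hlow : e' * p.2 ≤ (m.ring j' i').H - m.h := by
    obtain ⟨_, h1, h2⟩ := hp
    rcases he with rfl | rfl <;> linarith
  have hsl := (hfull hlow).1
  obtain ⟨b1, b2⟩ := m.gap_bounds hg
  set u := p'.1 - p.1
  set v := p'.2 - p.2
  have ht : (τ' - τ) * (e' * v) = (m.ring j' i').H - (m.ring j i).H := by
    rcases he with rfl | rfl <;> linarith
  have ht0 : 0 < τ' - τ := by
    by_contra! hneg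
    have := mul_nonpos_of_nonpos_of_nonneg hneg hev.le
    linarith
  -- a link through a leak moves by less than `q` horizontally
  have leak : d' - c' = 1 → |(τ' - τ) * u| ≤ m.q := by
    intro hdc
    rw [hdc, one_mul] at hsl
    have h1 : (τ' - τ) * |u| * m.h ≤ (m.ring j' i').H - (m.ring j i).H := by
      rw [← ht, mul_assoc]; gcongr
    have h2 := (m.ring_bounds hj' hi').2.2
    have h3 : 0 ≤ (m.ring j i).H := by linarith [(m.ring_good j i).height]
    rw [abs_mul, abs_of_pos ht0]
    have h4 := m.h_eq
    have h5 : (τ' - τ) * |u| * m.h ≤ m.q * m.h := by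
      rw [h4] at h1 ⊢
      nlinarith [m.q_pos, m.one_le_k_real]
    exact le_of_mul_le_mul_right h5 (by linarith)
  refine ⟨τ', e', he, hev, hy', ?_, ?_⟩ <;>
    rcases m.gap_cases hg' with ⟨h1, h2⟩ | ⟨h1, h2⟩ | ⟨z, hz, h1, h2⟩
  · have := abs_le.1 (leak (by linarith)); linarith
  · have := abs_le.1 (leak (by linarith)); linarith
  · exact ⟨z, hz, abs_le.2 ⟨by linarith, by linarith⟩⟩
  · have := abs_le.1 (leak (by linarith)); linarith
  · have := abs_le.1 (leak (by linarith)); linarith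
  · have h3 : |u| * m.h ≤ 4 * (e' * v) * m.h := by
      calc |u| * m.h ≤ (d' - c') * (e' * v) := hsl
        _ = 4 * (e' * v) * m.h := by rw [h1, h2]; ring
    exact le_of_mul_le_mul_right h3 (by linarith)

/-- The first link stays within the innermost ring: going up, it would be in the top wall from the
start, where there is no opening, and going down it would need a leak, as the bottom wall of this
ring has no slits. -/
lemma link_from_s {p' : ℝ × ℝ} (hseg : segment ℝ m.s p' ⊆ m.domain) :
    p' ∈ (m.ring 0 0).openBox := by
  by_contra hp'
  have hq := m.M_le_q
  have hM := m.M_large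
  have hh := m.h_le
  have hh0 := m.h_large
  have hl : (m.ring 0 0).l = -(4 * m.q) := by simp [ring]
  have hR : (m.ring 0 0).R = 7 * m.q := by simp [ring, axis]; ring
  have hH : (m.ring 0 0).H = 4 * m.q := by simp [ring]
  have hs : m.s ∈ (m.ring 0 0).openBox := by
    refine ⟨⟨?_, ?_⟩, ?_, ?_⟩ <;> simp only [s, hl, hR, hH] <;> linarith
  obtain ⟨τ, e, c, d, hτ, he, hg, hev, hy, hx, hfull⟩ :=
    m.exists_exit hseg m.one_le_k (by norm_num) hs hp'
  simp only [s, hH] at hev hy hx hfull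
  rcases he with rfl | rfl
  · have h1 := (hfull (by linarith)).2 (by ring)
    rcases m.gap_cases hg with ⟨rfl, rfl⟩ | ⟨rfl, rfl⟩ | ⟨z, hz, rfl, rfl⟩
    · linarith
    · linarith
    · have := abs_le.1 (m.mem_slits_bounds hz)
      have : m.axis 0 0 = 6 * m.q := by simp [axis]; ring
      linarith
  · have h1 := (hfull (by linarith)).1
    have hdc : d - c = 1 := by
      rcases hg with ⟨rfl, rfl⟩ | ⟨rfl, rfl⟩ | ⟨z, hz, _⟩
      · ring
      · ring
      · simp [ring] at hz
        norm_num at hz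
    have h2 : τ * |p'.1 - 0| * m.h ≤ 8 * m.q := by
      rw [hdc, one_mul] at h1
      have := mul_le_mul_of_nonneg_left h1 hτ.1.le
      nlinarith
    have h3 : |τ * (p'.1 - 0)| ≤ m.q := by
      rw [abs_mul, abs_of_pos hτ.1]
      nlinarith [abs_nonneg (p'.1 - 0), mul_nonneg hτ.1.le (abs_nonneg (p'.1 - 0))]
    have := abs_le.1 h3
    rcases m.gap_cases hg with ⟨rfl, rfl⟩ | ⟨rfl, rfl⟩ | ⟨z, hz, rfl, rfl⟩ <;> linarith

/-- If no three slits of a copy are collinear, then no link crosses all of its three rings. -/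
lemma link_within_copy (hno : ∀ a ∈ m.A, ∀ b ∈ m.B, ∀ c ∈ m.A, 8 * m.h < |a + c - 2 * b|)
    {p p' : ℝ × ℝ} (hseg : segment ℝ p p' ⊆ m.domain) {j : ℕ} (hj : j < m.k)
    (hp : p ∈ (m.ring j 0).openBox) : p' ∈ (m.ring j 2).openBox := by
  by_contra hp'
  have hq := m.M_le_q
  have hM := m.M_large
  have hh := m.h_le
  have hh0 := m.h_large
  obtain ⟨τ₀, e₀, c, d, -, he₀, hg, hev₀, hy₀, hx₀, -⟩ := m.exists_exit hseg hj (by norm_num) hp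
    fun h => hp' (m.openBox_mono (Or.inr ⟨rfl, by norm_num⟩) (by norm_num) h)
  obtain ⟨τ₁, e₁, he₁, hev₁, hy₁, ⟨z₁, hz₁, hx₁⟩, -⟩ := m.slit_exit (i := 0) (i' := 1) hseg hj
    (by norm_num) (by norm_num) (Or.inr ⟨rfl, by norm_num⟩) hp
    fun h => hp' (m.openBox_mono (Or.inr ⟨rfl, by norm_num⟩) (by norm_num) h)
  obtain ⟨τ₂, e₂, he₂, hev₂, hy₂, ⟨z₂, hz₂, hx₂⟩, -⟩ := m.slit_exit (i := 0) (i' := 2) hseg hj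
    (by norm_num) (by norm_num) (Or.inr ⟨rfl, by norm_num⟩) hp hp'
  have h10 : e₁ = e₀ := by
    rcases he₁ with rfl | rfl <;> rcases he₀ with rfl | rfl <;> first | rfl | linarith
  have h20 : e₂ = e₀ := by
    rcases he₂ with rfl | rfl <;> rcases he₀ with rfl | rfl <;> first | rfl | linarith
  subst h10 h20
  have hH : (m.ring j 0).H + (m.ring j 2).H = 2 * (m.ring j 1).H := by
    simp only [ring]; push_cast; ring
  -- the three exits are equally spaced on the link
  have hτ : τ₀ + τ₂ = 2 * τ₁ := by
    have hv : p'.2 - p.2 ≠ 0 := fun h => by simp [h] at hev₀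
    have : (τ₀ + τ₂) * (p'.2 - p.2) = 2 * τ₁ * (p'.2 - p.2) := by
      linear_combination hy₀ + hy₂ - 2 * hy₁ + e₂ * hH
    exact mul_right_cancel₀ hv this
  have hx : (p.1 + τ₀ * (p'.1 - p.1)) + (p.1 + τ₂ * (p'.1 - p.1)) =
      2 * (p.1 + τ₁ * (p'.1 - p.1)) := by
    linear_combination (p'.1 - p.1) * hτ
  obtain ⟨b, hb, rfl⟩ := List.mem_map.1 hz₁
  obtain ⟨c', hc', rfl⟩ := List.mem_map.1 hz₂
  have hax : m.axis j 0 + m.axis j 2 = 2 * m.axis j 1 := by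
    simp only [axis]; push_cast; ring
  have bb := abs_le.1 (m.abs_vals hb)
  have bc := abs_le.1 (m.abs_vals hc')
  rw [abs_le] at hx₁ hx₂
  have hR : (m.ring j 0).R = m.axis j 0 + m.q := rfl
  have hl : (m.ring j 0).l ≤ 0 := by
    simp only [ring]
    have h8 := m.q_pos
    have : 0 ≤ 4 * m.q * (3 * j + 1 + (0 : ℕ) : ℝ) := by positivity
    linarith
  have h8 : 6 * m.q ≤ m.axis j 0 := by
    unfold axis
    have : (0 : ℝ) ≤ 12 * j ^ 2 + 28 * j + 4 * (0 : ℕ) := by positivity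
    nlinarith [m.q_pos]
  rcases m.gap_cases hg with ⟨rfl, rfl⟩ | ⟨rfl, rfl⟩ | ⟨z, hz, rfl, rfl⟩
  · linarith
  · linarith
  · obtain ⟨a, ha, rfl⟩ := List.mem_map.1 hz
    simp only [vals] at ha hb hc'
    norm_num at ha hb hc'
    have := hno a ha b hb c' hc'
    -- The link misses the centers of the three slits by at most `2 * h` each.
    refine absurd this (not_lt.2 (abs_le.2 ⟨?_, ?_⟩)) <;> linarith

/-- No link crosses the last ring of one copy and the first ring of the next: the slits of the two
are so far apart horizontally that the link would be too flat for the slits. -/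
lemma link_between_copies {p p' : ℝ × ℝ} (hseg : segment ℝ p p' ⊆ m.domain) {j : ℕ}
    (hj : j + 1 < m.k) (hp : p ∈ (m.ring j 2).openBox) : p' ∈ (m.ring (j + 1) 0).openBox := by
  by_contra hp'
  have hq := m.M_le_q
  have hM := m.M_large
  have hh := m.h_le
  have hlt : j < j + 1 ∨ j = j + 1 ∧ 2 < 0 := Or.inl (Nat.lt_succ_self j)
  obtain ⟨τ, e, c, d, -, he, hg, hev, hy, hx, -⟩ := m.exists_exit hseg (by omega) (by norm_num) hp
    fun h => hp' (m.openBox_mono hlt (by norm_num) h)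
  obtain ⟨τ', e', he', hev', hy', ⟨z, hz, hx'⟩, hsl⟩ := m.slit_exit hseg hj
    (by norm_num) (by norm_num) hlt hp hp'
  have hee : e' = e := by
    rcases he' with rfl | rfl <;> rcases he with rfl | rfl <;> first | rfl | linarith
  subst hee
  have hH : (m.ring (j + 1) 0).H = (m.ring j 2).H + 4 * m.q := by
    simp only [ring]; push_cast; ring
  have ht : (τ' - τ) * (e' * (p'.2 - p.2)) = 4 * m.q := by
    rcases he with rfl | rfl <;> linarith
  have ht0 : 0 < τ' - τ := by
    by_contra! hneg
    have := mul_nonpos_of_nonpos_of_nonneg hneg hev.le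
    linarith
  have h1 : (τ' - τ) * (p'.1 - p.1) ≤ 16 * m.q := by
    have h2 := le_abs_self (p'.1 - p.1)
    have h3 : (τ' - τ) * (p'.1 - p.1) ≤ (τ' - τ) * (4 * (e' * (p'.2 - p.2))) :=
      mul_le_mul_of_nonneg_left (h2.trans hsl) ht0.le
    linarith
  have h4 := (m.gap_bounds hg).2
  have h5 := abs_le.1 (m.mem_slits_bounds hz)
  rw [abs_le] at hx'
  have h6 : (m.ring j 2).R + 18 * m.q ≤ m.axis (j + 1) 0 := by
    simp only [ring, axis]
    push_cast
    have : (0 : ℝ) ≤ j := by positivity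
    nlinarith [m.q_pos]
  linarith

/-- The target is not visible from within the outermost ring. -/
lemma link_to_t {p : ℝ × ℝ} (hseg : segment ℝ p m.t ⊆ m.domain) :
    p ∉ (m.ring (m.k - 1) 2).openBox := by
  intro hp
  have hq := m.M_le_q
  have hM := m.M_large
  have hh := m.h_le
  have hk : m.k - 1 < m.k := by have := m.one_le_k; omega
  have hH : (m.ring (m.k - 1) 2).H = 4 * m.q * (3 * m.k) := by
    have : ((m.k - 1 : ℕ) : ℝ) = m.k - 1 := by rw [Nat.cast_sub m.one_le_k]; simp
    simp only [ring, this]; push_cast; ring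
  have ht : m.t ∉ (m.ring (m.k - 1) 2).openBox := by
    rintro ⟨_, h1, h2⟩
    have := abs_lt.2 ⟨h1, h2⟩
    rw [abs_t, hH] at this
    exact lt_irrefl _ this
  obtain ⟨τ, e, c, d, hτ, he, hg, hev, hy, hx, -⟩ := m.exists_exit hseg hk (by norm_num) hp ht
  obtain ⟨_, h1, h2⟩ := hp
  have habs := m.abs_t
  rw [← hH] at habs
  have hpos : m.h < (m.ring (m.k - 1) 2).H := (m.ring_good _ _).height
  have hh0 := m.h_large
  have hτ1 : τ = 1 := by
    have hv : m.t.2 - p.2 ≠ 0 := fun h => by simp [h] at hev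
    have : τ * (m.t.2 - p.2) = 1 * (m.t.2 - p.2) := by
      rcases abs_eq (by linarith : 0 ≤ (m.ring (m.k - 1) 2).H) |>.1 habs with h | h <;>
        rcases he with rfl | rfl <;> linarith
    exact mul_right_cancel₀ hv this
  subst hτ1
  have hl : (m.ring (m.k - 1) 2).l ≤ -(4 * m.q) := by
    simp only [ring]
    have h8 := m.q_pos
    have : (0 : ℝ) ≤ 3 * (m.k - 1 : ℕ) + (2 : ℕ) := by positivity
    nlinarith
  have h8 : 6 * m.q ≤ m.axis (m.k - 1) 2 := by
    unfold axis
    have : (0 : ℝ) ≤ 12 * (m.k - 1 : ℕ) ^ 2 + 28 * (m.k - 1 : ℕ) + 4 * (2 : ℕ) := by positivity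
    nlinarith [m.q_pos]
  have hR : (m.ring (m.k - 1) 2).R = m.axis (m.k - 1) 2 + m.q := rfl
  have ht0 : m.t.1 = 0 := rfl
  rcases m.gap_cases hg with ⟨rfl, rfl⟩ | ⟨rfl, rfl⟩ | ⟨z, hz, rfl, rfl⟩
  · linarith
  · linarith
  · have := abs_le.1 (m.mem_slits_bounds hz); linarith

lemma s_mem_openBox : m.s ∈ (m.ring 0 0).openBox := by
  refine m.link_from_s ?_
  rw [segment_same]
  exact Set.singleton_subset_iff.2 m.s_mem

/-- If the first `L` links of every path stay within the outermost ring, then the link distance is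
at least `L + 2`. -/
lemma le_of_confined {L n : ℕ} {p : ℕ → ℝ × ℝ} (hn : p n = m.t)
    (hseg : ∀ i < n, segment ℝ (p i) (p (i + 1)) ⊆ m.domain)
    (hin : ∀ i ≤ L, i ≤ n → p i ∈ (m.ring (m.k - 1) 2).openBox) : L + 2 ≤ n := by
  have h1 : L < n := by
    by_contra! h
    refine m.link_to_t (p := m.t) ?_ (hn ▸ hin n h le_rfl)
    rw [segment_same]
    exact Set.singleton_subset_iff.2 m.t_mem
  have h2 : L + 1 ≠ n := by
    intro h
    have := hseg L h1
    rw [h, hn] at this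
    exact m.link_to_t this (hin L le_rfl h1.le)
  omega

/-- After `j` links, a path is still inside copy `j`, since no link passes from one copy into the
next. -/
lemma add_two_le_of_hasLinkPath {n : ℕ} (hp : HasLinkPath m.domain m.s m.t n) : m.k + 2 ≤ n := by
  obtain ⟨p, h0, hn, hseg⟩ := hp
  refine m.le_of_confined hn hseg fun i hi hin => ?_
  have key : ∀ i < m.k, i + 1 ≤ n → p (i + 1) ∈ (m.ring i 2).openBox := by
    intro i
    induction i with
    | zero =>
      intro _ hi
      have := hseg 0 hi
      rw [h0] at this
      exact m.openBox_mono (Or.inr ⟨rfl, by norm_num⟩) (by norm_num) (m.link_from_s this)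
    | succ i ih =>
      intro hk hi
      exact m.openBox_mono (Or.inr ⟨rfl, by norm_num⟩) (by norm_num)
        (m.link_between_copies (hseg (i + 1) hi) hk (ih (by omega) (by omega)))
  rcases i with _ | i
  · rw [h0]; exact m.openBox_subset_last m.one_le_k (by norm_num) m.s_mem_openBox
  · exact m.openBox_subset_last hi (by norm_num) (key i hi hin)

/-- If no link crosses a copy, then a path needs two links for each copy. -/
lemma two_mul_add_two_le_of_hasLinkPath
    (hno : ∀ a ∈ m.A, ∀ b ∈ m.B, ∀ c ∈ m.A, 8 * m.h < |a + c - 2 * b|) {n : ℕ}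
    (hp : HasLinkPath m.domain m.s m.t n) : 2 * m.k + 2 ≤ n := by
  obtain ⟨p, h0, hn, hseg⟩ := hp
  refine m.le_of_confined hn hseg fun i hi hin => ?_
  have key : ∀ i < m.k, (2 * i + 1 ≤ n → p (2 * i + 1) ∈ (m.ring i 0).openBox) ∧
      (2 * i + 2 ≤ n → p (2 * i + 2) ∈ (m.ring i 2).openBox) := by
    intro i
    induction i with
    | zero =>
      intro hk
      have h1 : 1 ≤ n → p 1 ∈ (m.ring 0 0).openBox := by
        intro hi
        have := hseg 0 hi
        rw [h0] at this
        exact m.link_from_s this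
      exact ⟨h1, fun hi => m.link_within_copy hno (hseg 1 hi) hk (h1 (by omega))⟩
    | succ i ih =>
      intro hk
      have h1 : 2 * (i + 1) + 1 ≤ n → p (2 * (i + 1) + 1) ∈ (m.ring (i + 1) 0).openBox := by
        intro hi
        exact m.link_between_copies (hseg (2 * (i + 1)) hi) hk ((ih (by omega)).2 (by omega))
      exact ⟨h1, fun hi => m.link_within_copy hno (hseg (2 * (i + 1) + 1) hi) hk (h1 (by omega))⟩
  rcases i with _ | i
  · rw [h0]; exact m.openBox_subset_last m.one_le_k (by norm_num) m.s_mem_openBox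
  · rcases Nat.even_or_odd' i with ⟨j, rfl | rfl⟩
    · exact m.openBox_subset_last (by omega) (by norm_num) ((key j (by omega)).1 hin)
    · exact m.openBox_subset_last (by omega) (by norm_num) ((key j (by omega)).2 hin)

end Maze

/-! ### Short paths in the maze -/

lemma HasLinkPath.of_segment {D : Set (ℝ × ℝ)} {a b : ℝ × ℝ} (h : segment ℝ a b ⊆ D) :
    HasLinkPath D a b 1 := by
  refine ⟨fun i => if i = 0 then a else b, rfl, rfl, fun i hi => ?_⟩
  obtain rfl : i = 0 := by omega
  simpa using h

lemma HasLinkPath.trans {D : Set (ℝ × ℝ)} {a b c : ℝ × ℝ} {m n : ℕ} (h : HasLinkPath D a b m)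
    (h' : HasLinkPath D b c n) : HasLinkPath D a c (m + n) := by
  obtain ⟨p, hp0, hpm, hp⟩ := h
  obtain ⟨r, hr0, hrn, hr⟩ := h'
  refine ⟨fun i => if i ≤ m then p i else r (i - m), by simpa using hp0, ?_, fun i hi => ?_⟩
  · by_cases hn : n = 0
    · subst hn; simp [hpm, ← hrn, hr0]
    · simp [hn, hrn]
  · rcases lt_trichotomy i m with h | h | h
    · simpa [h.le, Nat.succ_le_of_lt h] using hp i h
    · subst h
      have := hr 0 (by omega)
      simpa [hpm, hr0] using this
    · have := hr (i - m) (by omega)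
      have e : i + 1 - m = i - m + 1 := by omega
      simpa [not_le.2 h, show ¬ i + 1 ≤ m by omega, e] using this

namespace Maze

variable (m : Maze)

/-- In copy `j`, the point at (signed) height `v`, displaced from the axis of the copy by
`α + β * u`, where `u` is the height relative to the second ring of the copy. -/
def pt (j : ℕ) (α β v : ℝ) : ℝ × ℝ :=
  (m.turn j + v + (12 * j * m.q + 2 * m.q) + (α + β * (v - 4 * m.q * (3 * j + 2))), sgn j * v)

lemma turn_mono {j j' : ℕ} (h : j ≤ j') : m.turn j ≤ m.turn j' := by
  have hq := m.q_pos
  have : (j : ℝ) ≤ j' := by exact_mod_cast h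
  have h0 : (0 : ℝ) ≤ j := by positivity
  unfold turn
  have : (3 * j ^ 2 + j : ℝ) ≤ 3 * j' ^ 2 + j' := by nlinarith
  nlinarith

lemma turn_succ (j : ℕ) : m.turn (j + 1) = m.turn j + (24 * j + 16) * m.q := by
  simp only [turn]; push_cast; ring

lemma axis_eq (j i : ℕ) :
    m.axis j i = m.turn j + (m.ring j i).H + (12 * j * m.q + 2 * m.q) := by
  simp only [axis, turn, ring]; ring

/-- A point close to the axis of a copy is free if it is in a slit whenever it is at the height of
a wall of this copy. -/
lemma near_axis_mem_domain {j : ℕ} (hj : j < m.k) {x v : ℝ}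
    (hv : -(12 * j * m.q + 2 * m.q + m.q / 8) ≤ v ∧
      v ≤ 12 * (j + 1) * m.q + 2 * m.q + m.q / 8)
    (hx : |x - (m.turn j + v + (12 * j * m.q + 2 * m.q))| ≤ m.q / 4)
    (hslit : ∀ i < 3, (m.ring j i).H - m.h ≤ v → v ≤ (m.ring j i).H →
      ∃ z ∈ m.slits j i, |x - z| ≤ 2 * m.h) :
    (x, sgn j * v) ∈ m.domain := by
  have hq := m.M_le_q
  have hq0 := m.q_pos
  have hM := m.M_large
  have hh := m.h_le
  have hj0 : (0 : ℝ) ≤ j := by positivity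
  have hjk : (j + 1 : ℝ) ≤ m.k := by exact_mod_cast hj
  rw [abs_le] at hx
  have habs : |sgn j * v| = |v| := by rw [abs_mul, abs_sgn, one_mul]
  have hjq : 0 ≤ j * m.q := by positivity
  have hjkq : (j + 1) * m.q ≤ m.k * m.q := by gcongr
  have ht0 : 0 ≤ m.turn j := by unfold turn; positivity
  have hts := m.turn_succ j
  have habsv : |v| ≤ 12 * (j + 1) * m.q + 2 * m.q + m.q / 8 :=
    abs_le.2 ⟨by linarith, by linarith⟩
  rw [mem_domain]
  refine ⟨⟨⟨?_, ?_⟩, ?_⟩, fun j' hj' i hi => ?_⟩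
  · simp only [outer]; linarith
  · simp only [outer]
    have := m.turn_mono hj
    linarith
  · simp only [outer]
    rw [← abs_le, habs]; linarith
  have hi2 : (i : ℝ) ≤ 2 := by exact_mod_cast (by omega : i ≤ 2)
  have hi0 : (0 : ℝ) ≤ i := by positivity
  have hiq : 0 ≤ i * m.q := by positivity
  have hgood := m.ring_good j' i
  rcases lt_trichotomy j' j with h | h | h
  · -- the ring is to the left
    refine BoxRing.avoids_of_outside hgood (Or.inr (Or.inl ?_))
    have h1 : (j' + 1 : ℝ) ≤ j := by exact_mod_cast h
    have h0 : (0 : ℝ) ≤ j' := by positivity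
    have h2 : (m.ring j' i).R ≤ m.turn j - m.q := by
      simp only [ring, axis, turn]
      have : (12 * j' ^ 2 + 28 * j' + 4 * i + 8 : ℝ) ≤ 12 * j ^ 2 + 4 * j := by nlinarith
      nlinarith
    simp only; linarith
  · subst h
    have hax := m.axis_eq j' i
    have hR : (m.ring j' i).R = m.axis j' i + m.q := rfl
    have hl : (m.ring j' i).l = -(12 * j' * m.q + 4 * m.q + 4 * (i * m.q)) := by
      simp only [ring]; ring
    have hH : (m.ring j' i).H = 12 * j' * m.q + 4 * m.q + 4 * (i * m.q) := by
      simp only [ring]; ring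
    by_cases c1 : (m.ring j' i).H ≤ v
    · refine BoxRing.avoids_of_outside hgood (Or.inr (Or.inr ?_))
      rw [habs]; exact c1.trans (le_abs_self v)
    push Not at c1
    have hlR : (m.ring j' i).l ≤ x ∧ x ≤ (m.ring j' i).R := by
      constructor <;> linarith
    by_cases c2 : v ≤ (m.ring j' i).H - m.h
    · refine BoxRing.avoids_of_hollow hlR ?_
      rw [habs, abs_le]
      exact ⟨by linarith, c2⟩
    push Not at c2
    obtain ⟨z, hz, hxz⟩ := hslit i hi c2.le c1.le
    have hv0 : 0 ≤ v := by linarith [hgood.height]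
    by_cases he : Even j'
    · refine BoxRing.avoids_of_slit_top hgood hlR ?_ (z := z) ?_ hxz
      · simpa [sgn, he] using hv0
      · simpa [ring, he] using hz
    · refine BoxRing.avoids_of_slit_bot hgood hlR ?_ (z := z) ?_ hxz
      · simpa [sgn, he] using hv0
      · simpa [ring, he] using hz
  · -- the ring surrounds the point
    have h1 : (j + 1 : ℝ) ≤ j' := by exact_mod_cast h
    have h2 : (j + 1) * m.q ≤ j' * m.q := by gcongr
    refine BoxRing.avoids_of_hollow ⟨?_, ?_⟩ ?_
    · have : (m.ring j' i).l = -(12 * (j' * m.q) + 4 * m.q + 4 * (i * m.q)) := by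
        simp only [ring]; ring
      simp only; linarith
    · have h3 : m.turn (j + 1) + m.q ≤ (m.ring j' i).R := by
        have h3 := m.turn_mono h
        have h4 : (m.ring j' i).R = m.turn j' + (24 * j' + 7 + 4 * i) * m.q := by
          simp only [ring, axis, turn]; ring
        have : 0 ≤ (24 * j' + 6 + 4 * i) * m.q := by positivity
        linarith
      simp only; linarith
    · have : (m.ring j' i).H = 12 * (j' * m.q) + 4 * m.q + 4 * (i * m.q) := by
        simp only [ring]; ring
      rw [habs]; linarith

lemma segment_affine {a b e v₁ v₂ : ℝ} (h : v₁ ≤ v₂) {p : ℝ × ℝ}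
    (hp : p ∈ segment ℝ (a + b * v₁, e * v₁) (a + b * v₂, e * v₂)) :
    ∃ v, (v₁ ≤ v ∧ v ≤ v₂) ∧ p = (a + b * v, e * v) := by
  rw [segment_eq_image'] at hp
  obtain ⟨θ, ⟨h0, h1⟩, rfl⟩ := hp
  refine ⟨v₁ + θ * (v₂ - v₁), ⟨?_, ?_⟩, ?_⟩
  · nlinarith
  · nlinarith
  · ext <;> simp <;> ring

/-- A link near the axis of copy `j` that meets the walls of this copy in the middle of slits. -/
lemma segment_pt_subset {j : ℕ} (hj : j < m.k) {α β v₁ v₂ : ℝ} (h12 : v₁ ≤ v₂)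
    (hv₁ : -(12 * j * m.q + 2 * m.q + m.q / 8) ≤ v₁)
    (hv₂ : v₂ ≤ 12 * (j + 1) * m.q + 2 * m.q + m.q / 8)
    (hdev : ∀ v, v₁ ≤ v → v ≤ v₂ → |α + β * (v - 4 * m.q * (3 * j + 2))| ≤ m.q / 4)
    (hβ : |β| ≤ 1)
    (hslit : ∀ i < 3, v₁ ≤ (m.ring j i).H → (m.ring j i).H - m.h ≤ v₂ →
      α + β * (4 * m.q * (i - 1)) ∈ m.vals i) :
    segment ℝ (m.pt j α β v₁) (m.pt j α β v₂) ⊆ m.domain := by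
  have hpt : ∀ v, m.pt j α β v = (m.turn j + (12 * j * m.q + 2 * m.q) + α -
      β * (4 * m.q * (3 * j + 2)) + (1 + β) * v, sgn j * v) := by
    intro v; simp only [pt]; congr 1; ring
  intro p hp
  rw [hpt, hpt] at hp
  obtain ⟨v, ⟨h1, h2⟩, rfl⟩ := segment_affine h12 hp
  refine m.near_axis_mem_domain hj ⟨by linarith, by linarith⟩ ?_ fun i hi h3 h4 => ?_
  · have := hdev v h1 h2
    convert this using 2; ring
  · refine ⟨m.axis j i + (α + β * (4 * m.q * (i - 1))), ?_, ?_⟩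
    · exact List.mem_map.2 ⟨_, hslit i hi (by linarith) (by linarith), rfl⟩
    · have hH : (m.ring j i).H = 4 * m.q * (3 * j + 1 + i) := rfl
      have e : m.turn j + (12 * j * m.q + 2 * m.q) + α - β * (4 * m.q * (3 * j + 2)) +
          (1 + β) * v - (m.axis j i + (α + β * (4 * m.q * (i - 1)))) =
          (1 + β) * (v - (m.ring j i).H) := by
        rw [m.axis_eq, hH]; ring
      rw [e, abs_mul]
      rw [abs_le] at hβ
      have hb : |1 + β| ≤ 2 := abs_le.2 ⟨by linarith, by linarith⟩
      have hw : |v - (m.ring j i).H| ≤ m.h := abs_le.2 ⟨by linarith, by linarith [m.h_large]⟩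
      exact mul_le_mul hb hw (abs_nonneg _) (by norm_num)

/-- The lines followed at the end of one copy and at the start of the next meet near the nominal
turning point. -/
lemma exists_bend {α β α' β' : ℝ} (hα : |α| ≤ 7 * m.M) (hβ : |β| * m.q ≤ 2 * m.M)
    (hα' : |α'| ≤ m.M) (hβ' : |β'| * m.q ≤ m.M / 2) {j : ℕ} (hj : j < m.k) :
    ∃ σ, |σ| ≤ m.q / 8 ∧ m.pt j α β (12 * (j + 1) * m.q + 2 * m.q + σ) =
      m.pt (j + 1) α' β' (-(12 * (j + 1) * m.q + 2 * m.q) - σ) := by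
  have hq := m.M_le_q
  have hq0 := m.q_pos
  have hM := m.M_large
  have hjk : (j + 1 : ℝ) ≤ m.k := by exact_mod_cast hj
  have hj0 : (0 : ℝ) ≤ j := by positivity
  have hkM := m.le_q
  have hβ1 : |β| ≤ 1 / 8 := by
    by_contra! h
    nlinarith
  have hβ1' : |β'| ≤ 1 / 8 := by
    by_contra! h
    nlinarith
  have hbq : |β * m.q| ≤ 2 * m.M := by rwa [abs_mul, abs_of_pos hq0]
  have hbq' : |β' * m.q| ≤ m.M / 2 := by rwa [abs_mul, abs_of_pos hq0]
  have hbk' : |β' * m.q * (24 * (j + 1) + 10)| ≤ m.M / 2 * (24 * m.k + 10) := by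
    rw [abs_mul, abs_of_nonneg (show (0 : ℝ) ≤ 24 * (j + 1) + 10 by positivity)]
    gcongr
  rw [abs_le] at hα hα' hβ1 hβ1' hbq hbq' hbk'
  have hden : 0 < 2 + β + β' := by linarith
  have hMk : m.M ≤ m.k * m.M := by nlinarith [m.one_le_k_real]
  -- Equating the abscissas of the two points gives a linear equation for `σ`.
  refine ⟨(α' - β' * m.q * (24 * (j + 1) + 10) - α - 6 * (β * m.q)) / (2 + β + β'), ?_, ?_⟩
  · rw [abs_div, abs_of_pos hden, div_le_iff₀ hden, abs_le]
    constructor <;> nlinarith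
  · set σ := (α' - β' * m.q * (24 * (j + 1) + 10) - α - 6 * (β * m.q)) / (2 + β + β') with hσ
    have h1 : σ * (2 + β + β') = α' - β' * m.q * (24 * (j + 1) + 10) - α - 6 * (β * m.q) := by
      rw [hσ]; field_simp
    have ht := m.turn_succ j
    simp only [pt, sgn_succ]
    ext
    · simp only [ht]; push_cast; linear_combination h1
    · simp only; ring

/-- If every copy can be traversed with `c` links, along given lines at its start and its end,
then there is a path with `k * c + 2` links. -/
lemma hasLinkPath_of_copies {α β α' β' : ℝ} (hα : |α| ≤ 7 * m.M) (hβ : |β| * m.q ≤ 2 * m.M)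
    (hα' : |α'| ≤ m.M) (hβ' : |β'| * m.q ≤ m.M / 2) (c : ℕ)
    (hcopy : ∀ j < m.k, ∀ σ σ', |σ| ≤ m.q / 8 → |σ'| ≤ m.q / 8 → HasLinkPath m.domain
      (m.pt j α' β' (-(12 * j * m.q + 2 * m.q) - σ))
      (m.pt j α β (12 * (j + 1) * m.q + 2 * m.q + σ')) c) :
    HasLinkPath m.domain m.s m.t (m.k * c + 2) := by
  have hq := m.M_le_q
  have hq0 := m.q_pos
  have hM := m.M_large
  have hh := m.h_le
  have hk1 := m.one_le_k_real
  have hbq : |β * m.q| ≤ 2 * m.M := by rwa [abs_mul, abs_of_pos hq0]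
  have hbq' : |β' * m.q| ≤ m.M / 2 := by rwa [abs_mul, abs_of_pos hq0]
  have hβ1 : |β| ≤ 1 / 8 := by
    by_contra! h
    nlinarith
  rw [abs_le] at hbq hbq'
  have bend : ∀ j : ℕ, ∃ σ, |σ| ≤ m.q / 8 ∧ (j < m.k →
      m.pt j α β (12 * (j + 1) * m.q + 2 * m.q + σ) =
      m.pt (j + 1) α' β' (-(12 * (j + 1) * m.q + 2 * m.q) - σ)) := by
    intro j
    by_cases hj : j < m.k
    · obtain ⟨σ, h1, h2⟩ := m.exists_bend hα hβ hα' hβ' hj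
      exact ⟨σ, h1, fun _ => h2⟩
    · exact ⟨0, by rw [abs_zero]; positivity, fun h => absurd h hj⟩
  choose σ hσ hbend using bend
  -- the turning points
  set P : ℕ → ℝ × ℝ := fun j =>
    m.pt j α' β' (-(12 * j * m.q + 2 * m.q) - if j = 0 then 0 else σ (j - 1)) with hP
  have hstep : ∀ j < m.k, HasLinkPath m.domain (P j) (P (j + 1)) c := by
    intro j hj
    have h1 : P (j + 1) = m.pt j α β (12 * (j + 1) * m.q + 2 * m.q + σ j) := by
      rw [hbend j hj, hP]; simp
    rw [h1]
    refine hcopy j hj _ _ ?_ (hσ j)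
    split_ifs
    · rw [abs_zero]; positivity
    · exact hσ _
  have hmid : ∀ j ≤ m.k, HasLinkPath m.domain (P 0) (P j) (j * c) := by
    intro j
    induction j with
    | zero =>
      intro _
      exact ⟨fun _ => P 0, rfl, rfl, fun i hi => by simp at hi⟩
    | succ j ih =>
      intro hj
      rw [Nat.succ_mul]
      exact (ih (by omega)).trans (hstep j hj)
  have hfirst : HasLinkPath m.domain m.s (P 0) 1 := by
    refine HasLinkPath.of_segment ?_
    have hconv : Convex ℝ (Set.Icc (-(4 * m.q)) (7 * m.q) ×ˢ
        Set.Icc (-(4 * m.q - m.h)) (4 * m.q - m.h)) := (convex_Icc _ _).prod (convex_Icc _ _)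
    refine (hconv.segment_subset ?_ ?_).trans fun p hp =>
      m.center_mem_domain hp.1 (abs_le.2 hp.2)
    · refine ⟨⟨?_, ?_⟩, ?_, ?_⟩ <;> simp only [s] <;> linarith
    · have hs : sgn 0 = 1 := by simp [sgn]
      rw [abs_le] at hα'
      simp only [hP, pt, turn, hs]
      push_cast
      refine ⟨⟨?_, ?_⟩, ?_, ?_⟩ <;> simp only <;> linarith
  have hlast : HasLinkPath m.domain (P m.k) m.t 1 := by
    obtain ⟨k, hk⟩ : ∃ k, m.k = k + 1 := ⟨m.k - 1, by have := m.one_le_k; omega⟩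
    have h1 : P m.k = m.pt k α β (12 * m.k * m.q + 2 * m.q + σ k) := by
      have := hbend k (by omega)
      rw [hk]; push_cast
      rw [this, hP]; simp
    have hs : m.k - 1 = k := by omega
    have hkr : (m.k : ℝ) = k + 1 := by rw [hk]; push_cast; ring
    have hts := m.turn_succ k
    rw [← hk] at hts
    have ht0 : 0 ≤ m.turn m.k := by unfold turn; positivity
    have hσk := abs_le.1 (hσ k)
    have hβσ : |β * σ k| ≤ m.q := by
      rw [abs_mul]
      calc |β| * |σ k| ≤ 1 / 8 * (m.q / 8) := by gcongr; exact hσ k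
        _ ≤ m.q := by linarith
    rw [abs_le] at hβσ hα
    rw [h1]
    refine HasLinkPath.of_segment ?_
    have hconv : Convex ℝ (Set.Icc (-(4 * m.q * (3 * m.k + 1))) (m.turn m.k + 4 * m.q) ×ˢ
        {y : ℝ | 4 * m.q * (3 * m.k) ≤ sgn k * y ∧ sgn k * y ≤ 4 * m.q * (3 * m.k + 1)}) := by
      refine (convex_Icc _ _).prod ?_
      exact (convex_Icc (4 * m.q * (3 * m.k)) (4 * m.q * (3 * m.k + 1))).linear_preimage
        ((LinearMap.mulLeft ℝ (sgn k)))
    refine (hconv.segment_subset ?_ ?_).trans fun p hp => m.outside_mem_domain hp.1 ?_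
    · have hkq : 0 ≤ m.k * m.q := by positivity
      refine ⟨⟨?_, ?_⟩, ?_, ?_⟩ <;> simp only [pt]
      · have : m.turn k + (12 * m.k * m.q + 2 * m.q + σ k) + (12 * k * m.q + 2 * m.q) +
            (α + β * (12 * m.k * m.q + 2 * m.q + σ k - 4 * m.q * (3 * k + 2))) =
            m.turn m.k + σ k + α + 6 * (β * m.q) + β * σ k := by
          rw [hts, hkr]; ring
        linarith
      · have : m.turn k + (12 * m.k * m.q + 2 * m.q + σ k) + (12 * k * m.q + 2 * m.q) +
            (α + β * (12 * m.k * m.q + 2 * m.q + σ k - 4 * m.q * (3 * k + 2))) =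
            m.turn m.k + σ k + α + 6 * (β * m.q) + β * σ k := by
          rw [hts, hkr]; ring
        linarith
      · rw [← mul_assoc (sgn k), sgn_mul_sgn]; linarith
      · rw [← mul_assoc (sgn k), sgn_mul_sgn]; linarith
    · have hkq : 0 ≤ m.k * m.q := by positivity
      refine ⟨⟨?_, ?_⟩, ?_, ?_⟩ <;> simp only [t, hs]
      · linarith
      · linarith
      · rw [← mul_assoc (sgn k), sgn_mul_sgn]; linarith
      · rw [← mul_assoc (sgn k), sgn_mul_sgn]; linarith
    · obtain ⟨-, h2, h3⟩ := hp
      have habs : |p.2| = |sgn k * p.2| := by rw [abs_mul, abs_sgn, one_mul]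
      have h0 : 0 ≤ sgn k * p.2 := le_trans (by positivity) h2
      rw [habs, abs_of_nonneg h0]
      exact ⟨h2, h3⟩
  have := (hfirst.trans (hmid m.k le_rfl)).trans hlast
  rwa [show 1 + m.k * c + 1 = m.k * c + 2 by ring] at this

lemma vals_zero : m.vals 0 = m.A := by simp [vals]
lemma vals_one : m.vals 1 = m.B := by simp [vals]
lemma vals_two : m.vals 2 = m.A := by simp [vals]

/-- The deviation from the axis along a line that is used in a whole copy. -/
lemma abs_dev_le {α β : ℝ} (hα : |α| ≤ m.M) (hβ : |β| * m.q ≤ m.M / 2) {j : ℕ} (hj : j < m.k)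
    {v : ℝ} (hv : -(12 * j * m.q + 2 * m.q + m.q / 8) ≤ v ∧
      v ≤ 12 * (j + 1) * m.q + 2 * m.q + m.q / 8) :
    |α + β * (v - 4 * m.q * (3 * j + 2))| ≤ m.q / 4 := by
  have hq0 := m.q_pos
  have hM := m.M_large
  have hjk : (j + 1 : ℝ) ≤ m.k := by exact_mod_cast hj
  have hkM := m.le_q
  have hMk : m.M ≤ m.k * m.M := by nlinarith [m.one_le_k_real]
  have hjkq : (j + 1) * m.q ≤ m.k * m.q := by gcongr
  have hjq : 0 ≤ j * m.q := by positivity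
  have h1 : |v - 4 * m.q * (3 * j + 2)| ≤ 24 * m.k * m.q :=
    abs_le.2 ⟨by linarith, by linarith⟩
  have h2 : |β * (v - 4 * m.q * (3 * j + 2))| ≤ 12 * (m.k * m.M) := by
    rw [abs_mul]
    calc |β| * |v - 4 * m.q * (3 * j + 2)| ≤ |β| * (24 * m.k * m.q) := by gcongr
      _ = (|β| * m.q) * (24 * m.k) := by ring
      _ ≤ m.M / 2 * (24 * m.k) := by gcongr
      _ = 12 * (m.k * m.M) := by ring
  have := abs_add_le α (β * (v - 4 * m.q * (3 * j + 2)))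
  linarith

/-- If some three slits are collinear, then every copy can be traversed with a single link. -/
lemma hasLinkPath_of_collinear {a b c : ℝ} (ha : a ∈ m.A) (hb : b ∈ m.B) (hc : c ∈ m.A)
    (h : a + c = 2 * b) : HasLinkPath m.domain m.s m.t (m.k + 2) := by
  have hq := m.M_le_q
  have hq0 := m.q_pos
  have hM := m.M_large
  have ba := abs_le.1 (m.abs_A a ha)
  have bc := abs_le.1 (m.abs_A c hc)
  set β : ℝ := (c - a) / (8 * m.q) with hβdef
  have hβq : β * m.q = (c - a) / 8 := by rw [hβdef]; field_simp
  have hβ : |β| * m.q ≤ m.M / 2 := by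
    rw [← abs_of_pos hq0, ← abs_mul, hβq, abs_le]
    constructor <;> linarith
  have hβ1 : |β| ≤ 1 := by
    by_contra! h
    nlinarith
  have hbM := m.abs_B b hb
  rw [show m.k + 2 = m.k * 1 + 2 by ring]
  refine m.hasLinkPath_of_copies (α := b) (β := β) (by linarith) (by linarith) hbM hβ 1
    fun j hj σ σ' hσ hσ' => HasLinkPath.of_segment ?_
  rw [abs_le] at hσ hσ'
  have hjq : 0 ≤ j * m.q := by positivity
  refine m.segment_pt_subset hj (by linarith) (by linarith) (by linarith)
    (fun v h1 h2 => m.abs_dev_le hbM hβ hj ⟨by linarith, by linarith⟩) hβ1 fun i hi _ _ => ?_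
  interval_cases i
  · rw [vals_zero]
    convert ha using 1
    push_cast; linarith
  · rw [vals_one]
    convert hb using 1
    push_cast; ring
  · rw [vals_two]
    convert hc using 1
    push_cast; linarith

/-- Every copy can be traversed with two links, which turn between its second and third ring. -/
lemma hasLinkPath_two_mul {a b : ℝ} (ha : a ∈ m.A) (hb : b ∈ m.B) :
    HasLinkPath m.domain m.s m.t (2 * m.k + 2) := by
  have hq := m.M_le_q
  have hq0 := m.q_pos
  have hM := m.M_large
  have hh := m.h_le
  have hh0 := m.h_large
  have haM := m.abs_A a ha
  have hbM := m.abs_B b hb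
  have ba := abs_le.1 haM
  have bb := abs_le.1 hbM
  -- the line through the slits `a` and `b`
  set β : ℝ := (b - a) / (4 * m.q) with hβdef
  have hβq : β * m.q = (b - a) / 4 := by rw [hβdef]; field_simp
  have hβ : |β| * m.q ≤ m.M / 2 := by
    rw [← abs_of_pos hq0, ← abs_mul, hβq, abs_le]
    constructor <;> linarith
  have hβ1 : |β| ≤ 1 := by
    by_contra! h
    nlinarith
  -- the line from a point halfway to the third ring through the slit `a` of that ring
  set γ : ℝ := (a - (b + (b - a) / 2)) / (2 * m.q) with hγdef
  have hγq : γ * m.q = (a - (b + (b - a) / 2)) / 2 := by rw [hγdef]; field_simp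
  have hγ : |γ| * m.q ≤ 2 * m.M := by
    rw [← abs_of_pos hq0, ← abs_mul, hγq, abs_le]
    constructor <;> linarith
  have hγ1 : |γ| ≤ 1 := by
    by_contra! h
    nlinarith
  set δ : ℝ := a - 4 * (γ * m.q) with hδdef
  have hδ : |δ| ≤ 7 * m.M := by
    rw [hδdef, hγq, abs_le]
    constructor <;> linarith
  rw [mul_comm 2]
  refine m.hasLinkPath_of_copies hδ hγ hbM hβ 2 fun j hj σ σ' hσ hσ' => ?_
  rw [abs_le] at hσ hσ'
  have hjq : 0 ≤ j * m.q := by positivity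
  have hH : ∀ i : ℕ, (m.ring j i).H = 12 * (j * m.q) + 4 * m.q + 4 * (i * m.q) := by
    intro i; simp only [ring]; ring
  have hturn : m.pt j b β (12 * j * m.q + 10 * m.q) = m.pt j δ γ (12 * j * m.q + 10 * m.q) := by
    simp only [pt, hδdef]
    ext
    · simp only
      linear_combination 2 * hβq + 2 * hγq
    · rfl
  refine HasLinkPath.trans (m := 1) (n := 1)
    (b := m.pt j b β (12 * j * m.q + 10 * m.q)) (HasLinkPath.of_segment ?_)
    (HasLinkPath.of_segment ?_)
  · refine m.segment_pt_subset hj (by linarith) (by linarith) (by linarith)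
      (fun v h1 h2 => m.abs_dev_le hbM hβ hj ⟨by linarith, by linarith⟩) hβ1 fun i hi _ h2 => ?_
    interval_cases i
    · rw [vals_zero]
      convert ha using 1
      push_cast; linarith
    · rw [vals_one]
      convert hb using 1
      push_cast; ring
    · rw [hH] at h2
      push_cast at h2
      linarith
  · rw [hturn]
    refine m.segment_pt_subset hj (by linarith) (by linarith) (by linarith)
      (fun v h1 h2 => ?_) hγ1 fun i hi h1 _ => ?_
    · have h3 : |v - 4 * m.q * (3 * j + 2)| ≤ 7 * m.q := abs_le.2 ⟨by linarith, by linarith⟩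
      have h4 : |γ * (v - 4 * m.q * (3 * j + 2))| ≤ 14 * m.M := by
        rw [abs_mul]
        calc |γ| * |v - 4 * m.q * (3 * j + 2)| ≤ |γ| * (7 * m.q) := by gcongr
          _ = 7 * (|γ| * m.q) := by ring
          _ ≤ 14 * m.M := by linarith
      have := abs_add_le δ (γ * (v - 4 * m.q * (3 * j + 2)))
      linarith
    · rw [hH] at h1
      interval_cases i
      · push_cast at h1; linarith
      · push_cast at h1; linarith
      · rw [vals_two]
        convert ha using 1
        rw [hδdef]; push_cast; ring

lemma linkDist_eq {D : Set (ℝ × ℝ)} {s t : ℝ × ℝ} {n : ℕ} (h : HasLinkPath D s t n)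
    (hmin : ∀ n', HasLinkPath D s t n' → n ≤ n') : linkDist D s t = n := by
  refine le_antisymm (iInf₂_le n h) (le_iInf₂ fun n' h' => ?_)
  exact_mod_cast hmin n' h'

/-- The link distance is `2 + k` if some three slits are collinear. -/
theorem dist_of_collinear {a b c : ℝ} (ha : a ∈ m.A) (hb : b ∈ m.B) (hc : c ∈ m.A)
    (h : a + c = 2 * b) : m.toInstance.dist = (2 + m.k : ℕ) := by
  rw [toInstance_dist, add_comm]
  exact linkDist_eq (m.hasLinkPath_of_collinear ha hb hc h)
    fun _ => m.add_two_le_of_hasLinkPath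

/-- The link distance is `2 + 2 * k` if no three slits are close to collinear. -/
theorem dist_of_not_collinear {a b : ℝ} (ha : a ∈ m.A) (hb : b ∈ m.B)
    (hno : ∀ a ∈ m.A, ∀ b ∈ m.B, ∀ c ∈ m.A, 8 * m.h < |a + c - 2 * b|) :
    m.toInstance.dist = (2 + 2 * m.k : ℕ) := by
  rw [toInstance_dist, add_comm]
  exact linkDist_eq (m.hasLinkPath_two_mul ha hb)
    fun _ => m.two_mul_add_two_le_of_hasLinkPath hno

end Maze

/-! ### Total correctness of programs with a time bound -/

namespace RealRAM

/-- Started in `σ`, the program halts within `T` steps and without oracle calls in a state that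
satisfies `Q`. -/
def Runs (O : Word → ℝ) (c : Prog) (σ : State) (T : ℕ) (Q : State → Prop) : Prop :=
  ∃ σ' t, Exec O c σ σ' t [] ∧ t ≤ T ∧ Q σ'

/-- Sequential composition of a list of programs. -/
def block : List Prog → Prog
  | [] => .skip
  | c :: cs => .seq c (block cs)

/-- Increment register `c` and repeat `body` as long as register `c` is below register `bd`. -/
def forLoop (c bd : ℕ) (body : Prog) : Prog :=
  .loop (.nle (.add (.reg c) (.const 1)) (.reg bd))
    (.seq body (.nset c (.add (.reg c) (.const 1))))

namespace Runs

variable {O : Word → ℝ} {σ : State} {Q R : State → Prop} {c d : Prog} {cs : List Prog}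
  {T T₁ T₂ : ℕ}

lemma mono_time (h : Runs O c σ T Q) (hT : T ≤ T₁) : Runs O c σ T₁ Q := by
  obtain ⟨σ', t, h1, h2, h3⟩ := h
  exact ⟨σ', t, h1, h2.trans hT, h3⟩

lemma conseq (h : Runs O c σ T R) (hQ : ∀ σ', R σ' → Q σ') : Runs O c σ T Q := by
  obtain ⟨σ', t, h1, h2, h3⟩ := h
  exact ⟨σ', t, h1, h2, hQ _ h3⟩

lemma seq (h : Runs O c σ T₁ R) (h' : ∀ σ', R σ' → Runs O d σ' T₂ Q) :
    Runs O (.seq c d) σ (T₁ + T₂) Q := by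
  obtain ⟨σ', t, h1, h2, h3⟩ := h
  obtain ⟨σ'', t', h1', h2', h3'⟩ := h' _ h3
  exact ⟨σ'', t + t', by simpa using Exec.seq h1 h1', by omega, h3'⟩

lemma skip (h : Q σ) : Runs O .skip σ 1 Q := ⟨σ, 1, .skip σ, le_rfl, h⟩

lemma nset {i : ℕ} {e : NExpr}
    (h : Q { σ with nreg := Function.update σ.nreg i (e.eval σ) }) :
    Runs O (.nset i e) σ 1 Q := ⟨_, 1, .nset σ i e, le_rfl, h⟩

lemma rset {i : ℕ} {e : RExpr}
    (h : Q { σ with rreg := Function.update σ.rreg i (e.eval σ) }) :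
    Runs O (.rset i e) σ 1 Q := ⟨_, 1, .rset σ i e, le_rfl, h⟩

lemma nstore {b : ℕ} {a : NExpr} {e : NExpr}
    (h : Q
      { σ with nmem :=
          Function.update σ.nmem b (Function.update (σ.nmem b) (a.eval σ) (e.eval σ)) }) :
    Runs O (.nstore b a e) σ 1 Q := ⟨_, 1, .nstore σ b a e, le_rfl, h⟩

lemma rstore {b : ℕ} {a : NExpr} {e : RExpr}
    (h : Q
      { σ with rmem :=
          Function.update σ.rmem b (Function.update (σ.rmem b) (a.eval σ) (e.eval σ)) }) :
    Runs O (.rstore b a e) σ 1 Q := ⟨_, 1, .rstore σ b a e, le_rfl, h⟩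

lemma ite {b : BExpr} (h : b.eval σ → Runs O c σ T Q) (h' : ¬ b.eval σ → Runs O d σ T Q) :
    Runs O (.ite b c d) σ (1 + T) Q := by
  by_cases hb : b.eval σ
  · obtain ⟨σ', t, h1, h2, h3⟩ := h hb
    exact ⟨σ', 1 + t, .iteTrue hb h1, by omega, h3⟩
  · obtain ⟨σ', t, h1, h2, h3⟩ := h' hb
    exact ⟨σ', 1 + t, .iteFalse hb h1, by omega, h3⟩

lemma nil (h : Q σ) : Runs O (block []) σ 1 Q := skip h

lemma cons (h : Runs O c σ T₁ R) (h' : ∀ σ', R σ' → Runs O (block cs) σ' T₂ Q) :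
    Runs O (block (c :: cs)) σ (T₁ + T₂) Q := seq h h'

lemma cons_nset {i : ℕ} {e : NExpr}
    (h : Runs O (block cs) { σ with nreg := Function.update σ.nreg i (e.eval σ) } T Q) :
    Runs O (block (.nset i e :: cs)) σ (1 + T) Q :=
  seq (R := fun σ' => σ' = { σ with nreg := Function.update σ.nreg i (e.eval σ) }) (nset rfl)
    fun _ h' => h' ▸ h

lemma cons_rset {i : ℕ} {e : RExpr}
    (h : Runs O (block cs) { σ with rreg := Function.update σ.rreg i (e.eval σ) } T Q) :
    Runs O (block (.rset i e :: cs)) σ (1 + T) Q :=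
  seq (R := fun σ' => σ' = { σ with rreg := Function.update σ.rreg i (e.eval σ) }) (rset rfl)
    fun _ h' => h' ▸ h

lemma cons_nstore {b : ℕ} {a : NExpr} {e : NExpr}
    (h : Runs O (block cs)
      { σ with nmem :=
          Function.update σ.nmem b (Function.update (σ.nmem b) (a.eval σ) (e.eval σ)) } T Q) :
    Runs O (block (.nstore b a e :: cs)) σ (1 + T) Q :=
  seq (R := fun σ' => σ' =
      { σ with nmem :=
          Function.update σ.nmem b (Function.update (σ.nmem b) (a.eval σ) (e.eval σ)) })
    (nstore rfl)
    fun _ h' => h' ▸ h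

lemma cons_rstore {b : ℕ} {a : NExpr} {e : RExpr}
    (h : Runs O (block cs)
      { σ with rmem :=
          Function.update σ.rmem b (Function.update (σ.rmem b) (a.eval σ) (e.eval σ)) } T Q) :
    Runs O (block (.rstore b a e :: cs)) σ (1 + T) Q :=
  seq (R := fun σ' => σ' =
      { σ with rmem :=
          Function.update σ.rmem b (Function.update (σ.rmem b) (a.eval σ) (e.eval σ)) })
    (rstore rfl)
    fun _ h' => h' ▸ h

/-- A loop that runs through the values `m, …, n - 1` of a counter. -/
lemma loop {b : BExpr} {I : ℕ → State → Prop} {n : ℕ}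
    (hb : ∀ m σ, I m σ → (b.eval σ ↔ m < n))
    (hc : ∀ m < n, ∀ σ, I m σ → Runs O c σ T (I (m + 1))) {m : ℕ} (hm : m ≤ n) (h : I m σ) :
    Runs O (.loop b c) σ ((n - m) * (T + 1) + 1) (I n) := by
  obtain ⟨r, rfl⟩ := Nat.exists_eq_add_of_le hm
  induction r generalizing m σ with
  | zero =>
    have : ¬ b.eval σ := by rw [hb m σ h]; omega
    exact ⟨σ, 1, .loopFalse this, by simp, h⟩
  | succ r ih =>
    have hbt : b.eval σ := by rw [hb m σ h]; omega
    obtain ⟨σ₁, t₁, h1, h2, h3⟩ := hc m (by omega) σ h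
    have e : m + 1 + r = m + (r + 1) := by omega
    obtain ⟨σ₂, t₂, h4, h5, h6⟩ := ih (m := m + 1) (σ := σ₁) h3 (by rwa [e]) (by rwa [e])
      (by omega)
    rw [e] at h6
    refine ⟨σ₂, 1 + t₁ + t₂, by simpa using Exec.loopTrue hbt h1 h4, ?_, h6⟩
    have e1 : m + (r + 1) - m = r + 1 := by omega
    have e2 : m + 1 + r - (m + 1) = r := by omega
    rw [e1]
    rw [e2] at h5
    calc 1 + t₁ + t₂ ≤ 1 + T + (r * (T + 1) + 1) := by omega
      _ = (r + 1) * (T + 1) + 1 := by ring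

lemma forLoop {i bd : ℕ} {I : ℕ → State → Prop} {n : ℕ}
    (hI : ∀ m σ, I m σ → σ.nreg i = m ∧ σ.nreg bd = n)
    (hc : ∀ m < n, ∀ σ, I m σ → Runs O c σ T fun σ' =>
      I (m + 1) { σ' with nreg := Function.update σ'.nreg i (σ'.nreg i + 1) })
    {m : ℕ} (hm : m ≤ n) (h : I m σ) :
    Runs O (forLoop i bd c) σ ((n - m) * (T + 2) + 1) (I n) := by
  refine loop (T := T + 1) (fun m σ h => ?_) (fun m hm σ h => ?_) hm h
  · obtain ⟨h1, h2⟩ := hI m σ h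
    show σ.nreg i + 1 ≤ σ.nreg bd ↔ _
    rw [h1, h2]; omega
  · exact seq (hc m hm σ h) fun σ' h' => nset h'

end Runs

/-! ### Sorting with block minima -/

/-! The programs below use the registers and arrays as follows. Registers for naturals: `1` the
number of inputs, `5` the number (and length) of the blocks, `6` its square, `2`, `3`, `4`, `7` loop
counters and block numbers, `9` and `10` the lengths of the output. Registers for reals: `6` the
sentinel, `7` the last element found, `8` a minimum; when the output is written, `1` to `4` the
bounds of a box and `5` the unit of length. Arrays of naturals: `1` the first addresses of the
blocks, `2` output. Arrays of reals: `0` input, `1` block minima, `2` output, `3` and `4` the sorted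
lists of slit positions. -/

/-- Compute in real register `6` a number that exceeds `1` and all inputs in absolute value. -/
def boundProg : Prog := block
  [.rset 6 (.const 1), .nset 2 (.const 0),
   forLoop 2 1 (.rset 6 (.add (.reg 6) (.mul (.mem 0 (.reg 2)) (.mem 0 (.reg 2)))))]

variable {O : Word → ℝ} {n : ℕ} {w : ℕ → ℝ}

lemma runs_boundProg {σ : State} (h1 : σ.nreg 1 = n) (h0 : σ.rmem 0 = w) :
    Runs O boundProg σ (3 * n + 4) fun σ' => σ'.nreg 1 = n ∧ σ'.rmem 0 = w ∧
      1 ≤ σ'.rreg 6 ∧ ∀ i < n, |w i| < σ'.rreg 6 := by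
  apply Runs.mono_time
  · apply Runs.cons_rset
    apply Runs.cons_nset
    apply Runs.cons
    · apply Runs.forLoop (I := fun m σ => (σ.nreg 2 = m ∧ σ.nreg 1 = n) ∧ σ.rmem 0 = w ∧
        1 ≤ σ.rreg 6 ∧ ∀ i < m, |w i| < σ.rreg 6) (fun m σ h => h.1) (T := 1) (m := 0) _
        (Nat.zero_le _)
      · simp [NExpr.eval, RExpr.eval, h1, h0]
      · rintro m hm σ ⟨⟨h2, h1⟩, h0, h6, hlt⟩
        apply Runs.rset
        simp only [RExpr.eval, NExpr.eval, Function.update_self, h0, h2]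
        refine ⟨⟨trivial, by simpa using h1⟩, trivial, by nlinarith, fun i hi => ?_⟩
        rcases Nat.lt_succ_iff_lt_or_eq.1 hi with hi | rfl
        · nlinarith [hlt i hi]
        · nlinarith [sq_nonneg (|w i| - 1 / 2), abs_mul_abs_self (w i)]
    · rintro σ' ⟨⟨-, h1⟩, h0, h6, h⟩
      exact Runs.nil ⟨h1, h0, h6, h⟩
  · omega

/-- Compute in register `5` the least `b` with `n ≤ b ^ 2`. -/
def rootProg : Prog := block
  [.nset 5 (.const 0),
   .loop (.not (.rle (.ofNat (.reg 1)) (.mul (.ofNat (.reg 5)) (.ofNat (.reg 5)))))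
    (.nset 5 (.add (.reg 5) (.const 1)))]

/-- The least `b` with `n ≤ b ^ 2`. -/
def rootUp (n : ℕ) : ℕ := Nat.find (p := fun b => n ≤ b * b) ⟨n, Nat.le_mul_self n⟩

lemma le_rootUp (n : ℕ) : n ≤ rootUp n * rootUp n :=
  Nat.find_spec (p := fun b => n ≤ b * b) ⟨n, Nat.le_mul_self n⟩

lemma lt_rootUp_iff {n b : ℕ} : b < rootUp n ↔ b * b < n := by
  rw [rootUp, Nat.lt_find_iff]
  constructor
  · intro h; simpa using h b le_rfl
  · intro h c hc; have := Nat.mul_le_mul hc hc; omega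

lemma runs_rootProg {σ : State} {N : ℝ} (h1 : σ.nreg 1 = n) (h0 : σ.rmem 0 = w)
    (h6 : σ.rreg 6 = N) :
    Runs O rootProg σ (2 * rootUp n + 3) fun σ' => σ'.nreg 1 = n ∧ σ'.rmem 0 = w ∧
      σ'.rreg 6 = N ∧ σ'.nreg 5 = rootUp n := by
  apply Runs.mono_time
  · apply Runs.cons_nset
    apply Runs.cons
    · apply Runs.loop (I := fun m σ => σ.nreg 1 = n ∧ σ.rmem 0 = w ∧
        σ.rreg 6 = N ∧ σ.nreg 5 = m) (T := 1) (n := rootUp n) (m := 0) _ _ (Nat.zero_le _)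
      · simp [NExpr.eval, h1, h0, h6]
      · rintro m σ ⟨h1, h0, h6, h5⟩
        rw [lt_rootUp_iff]
        simp only [BExpr.eval, RExpr.eval, NExpr.eval, h1, h5, not_le]
        exact_mod_cast Iff.rfl
      · rintro m hm σ ⟨h1, h0, h6, h5⟩
        apply Runs.nset
        simp [NExpr.eval, h1, h0, h6, h5]
    · intro σ' h
      exact Runs.nil h
  · omega

/-- Compute `b * b` in register `6` from `b` in register `5`, and the multiples of `b` in the array
number `1`. -/
def baseProg : Prog := block
  [.nset 6 (.const 0), .nset 3 (.const 0),
   forLoop 3 5 (block [.nstore 1 (.reg 3) (.reg 6), .nset 6 (.add (.reg 6) (.reg 5))])]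

lemma runs_baseProg {σ : State} {N : ℝ} {b : ℕ} (h1 : σ.nreg 1 = n) (h0 : σ.rmem 0 = w)
    (h6 : σ.rreg 6 = N) (h5 : σ.nreg 5 = b) :
    Runs O baseProg σ (5 * b + 4) fun σ' => σ'.nreg 1 = n ∧ σ'.rmem 0 = w ∧
      σ'.rreg 6 = N ∧ σ'.nreg 5 = b ∧ σ'.nreg 6 = b * b ∧ ∀ i < b, σ'.nmem 1 i = i * b := by
  apply Runs.mono_time
  · apply Runs.cons_nset
    apply Runs.cons_nset
    apply Runs.cons
    · apply Runs.forLoop (I := fun m σ => (σ.nreg 3 = m ∧ σ.nreg 5 = b) ∧ σ.nreg 1 = n ∧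
        σ.rmem 0 = w ∧ σ.rreg 6 = N ∧ σ.nreg 6 = m * b ∧ ∀ i < m, σ.nmem 1 i = i * b)
        (fun m σ h => h.1) (T := 3) (m := 0) _ (Nat.zero_le _)
      · simp [NExpr.eval, h1, h0, h6, h5]
      · rintro m hm σ ⟨⟨h3, h5⟩, h1, h0, h6, h6', hb⟩
        apply Runs.mono_time
        · apply Runs.cons_nstore
          apply Runs.cons_nset
          apply Runs.nil
          simp [NExpr.eval, Function.update_apply, h1, h0, h6, h5, h3, h6']
          refine ⟨by ring, fun i hi => ?_⟩
          rcases Nat.le_iff_lt_or_eq.1 hi with hi | rfl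
          · rw [if_neg hi.ne, hb i hi]
          · rw [if_pos rfl]
        · norm_num
    · rintro σ' ⟨⟨-, h5⟩, h1, h0, h6, h6', hb⟩
      exact Runs.nil ⟨h1, h0, h6, h5, h6', hb⟩
  · omega

/-- The input followed by the sentinel `N`. -/
def padded (w : ℕ → ℝ) (n : ℕ) (N : ℝ) (i : ℕ) : ℝ := if i < n then w i else N

/-- Fill the array number `0` with the sentinel up to the address in register `6`. -/
def padProg : Prog := block
  [.nset 2 (.reg 1), forLoop 2 6 (.rstore 0 (.reg 2) (.reg 6))]

/-- The memory contents that stay fixed while sorting `n` numbers `w` in `b` blocks of length `b`,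
with sentinel `N`. -/
structure SortEnv (w : ℕ → ℝ) (n b : ℕ) (N : ℝ) (σ : State) : Prop where
  n1 : σ.nreg 1 = n
  n5 : σ.nreg 5 = b
  r6 : σ.rreg 6 = N
  base : ∀ i < b, σ.nmem 1 i = i * b
  cells : ∀ i < b * b, σ.rmem 0 i = padded w n N i

lemma runs_padProg {σ : State} {N : ℝ} {b : ℕ} (hb : n ≤ b * b) (h1 : σ.nreg 1 = n)
    (h0 : σ.rmem 0 = w)
    (h6 : σ.rreg 6 = N) (h5 : σ.nreg 5 = b) (h6' : σ.nreg 6 = b * b)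
    (hbase : ∀ i < b, σ.nmem 1 i = i * b) :
    Runs O padProg σ (3 * (b * b) + 3) (SortEnv w n b N) := by
  apply Runs.mono_time
  · apply Runs.cons_nset
    apply Runs.cons
    · apply Runs.forLoop (I := fun m σ => (σ.nreg 2 = m ∧ σ.nreg 6 = b * b) ∧ σ.nreg 1 = n ∧
        σ.nreg 5 = b ∧ σ.rreg 6 = N ∧ (∀ i < b, σ.nmem 1 i = i * b) ∧
        (∀ i < m, σ.rmem 0 i = padded w n N i) ∧ n ≤ m)
        (fun m σ h => h.1) (T := 1) (m := n) _ hb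
      · simp only [NExpr.eval, h1, h0, h6, h5, Function.update_of_ne (by decide : (6 : ℕ) ≠ 2),
          Function.update_of_ne (by decide : (1 : ℕ) ≠ 2), h6',
          Function.update_of_ne (by decide : (5 : ℕ) ≠ 2), Function.update_self]
        exact ⟨⟨trivial, trivial⟩, trivial, trivial, trivial, hbase,
          fun i hi => by rw [padded, if_pos hi], le_rfl⟩
      · rintro m hm σ ⟨⟨h2, h6'⟩, h1, h5, h6, hbase, hc, hnm⟩
        apply Runs.rstore
        simp only [NExpr.eval, RExpr.eval, h2, h6, Function.update_self]
        refine ⟨⟨trivial, ?_⟩, ?_, ?_, trivial, hbase, fun i hi => ?_, by omega⟩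
        · simpa using h6'
        · simpa using h1
        · simpa using h5
        rcases Nat.lt_succ_iff_lt_or_eq.1 hi with hi | rfl
        · rw [Function.update_of_ne hi.ne, hc i hi]
        · rw [Function.update_self, padded, if_neg (by omega)]
    · rintro σ' ⟨-, h1, h5, h6, hbase, hc, -⟩
      exact Runs.nil ⟨h1, h5, h6, hbase, hc⟩
  · have : (b * b - n) * (1 + 2) ≤ 3 * (b * b) := by
      rw [mul_comm 3]; exact Nat.mul_le_mul (Nat.sub_le _ _) le_rfl
    omega

end RealRAM

namespace RealRAM

variable {O : Word → ℝ} {n : ℕ} {w : ℕ → ℝ}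

/-- The entries of block `i` that exceed `x`, and the sentinel. -/
def blockAbove (w : ℕ → ℝ) (n b : ℕ) (N : ℝ) (i : ℕ) (x : ℝ) : Set ℝ :=
  insert N {y | (∃ u < b, y = padded w n N (i * b + u)) ∧ x < y}

/-- For the block number `i` in register `7`, store the least entry above real register `7` (the
sentinel if there is none) in cell `i` of the array number `1`. -/
def scanProg : Prog := block
  [.rset 8 (.reg 6), .nset 4 (.const 0),
   forLoop 4 5 (block
    [.rset 9 (.mem 0 (.add (.mem 1 (.reg 7)) (.reg 4))),
     .ite (.and (.not (.rle (.reg 9) (.reg 7))) (.not (.rle (.reg 8) (.reg 9))))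
      (.rset 8 (.reg 9)) .skip]),
   .rstore 1 (.reg 7) (.reg 8)]

lemma block_index_lt {b i u : ℕ} (hi : i < b) (hu : u < b) : i * b + u < b * b := by
  calc i * b + u < i * b + b := by omega
    _ = (i + 1) * b := by ring
    _ ≤ b * b := Nat.mul_le_mul hi le_rfl

lemma runs_scanProg {σ : State} {b i : ℕ} {N x : ℝ} (h : SortEnv w n b N σ)
    (h7 : σ.nreg 7 = i) (hi : i < b) (hx : σ.rreg 7 = x) :
    Runs O scanProg σ (6 * b + 5) fun σ' =>
      SortEnv w n b N σ' ∧ (∀ r, r ≠ 4 → σ'.nreg r = σ.nreg r) ∧ σ'.rreg 7 = x ∧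
      IsLeast (blockAbove w n b N i x) (σ'.rmem 1 i) ∧
      (∀ i', i' ≠ i → σ'.rmem 1 i' = σ.rmem 1 i') ∧
      ∀ r, r ≠ 1 → σ'.rmem r = σ.rmem r := by
  obtain ⟨n1, n5, r6, base, cells⟩ := h
  apply Runs.mono_time
  · apply Runs.cons_rset
    apply Runs.cons_nset
    apply Runs.cons
    · apply Runs.forLoop (I := fun m τ => (τ.nreg 4 = m ∧ τ.nreg 5 = b) ∧
        (∀ r, r ≠ 4 → τ.nreg r = σ.nreg r) ∧ τ.rreg 7 = x ∧ τ.rreg 6 = N ∧ τ.nmem = σ.nmem ∧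
        τ.rmem = σ.rmem ∧
        IsLeast (insert N {y | (∃ u < m, y = padded w n N (i * b + u)) ∧ x < y}) (τ.rreg 8))
        (fun m σ h => h.1) (T := 4) (m := 0) (n := b) _ (Nat.zero_le _)
      · refine ⟨⟨rfl, by simpa using n5⟩, fun r hr => Function.update_of_ne hr _ _,
          by simpa using hx, by simpa using r6, rfl, rfl, ?_⟩
        simp [RExpr.eval, r6]
      · rintro m hm τ ⟨⟨h4, h5⟩, hn, hr7, hr6, hnm, hrm, hleast⟩
        have hcell : τ.rmem 0 (τ.nmem 1 (τ.nreg 7) + τ.nreg 4) = padded w n N (i * b + m) := by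
          rw [hrm, hnm, hn 7 (by norm_num), h7, base i hi, h4]
          exact cells _ (block_index_lt hi hm)
        set y := padded w n N (i * b + m) with hy
        have hset : insert N {z | (∃ u < m + 1, z = padded w n N (i * b + u)) ∧ x < z} =
            (insert N {z | (∃ u < m, z = padded w n N (i * b + u)) ∧ x < z}) ∪
              {z | z = y ∧ x < z} := by
          ext z
          simp only [Set.mem_insert_iff, Set.mem_ofPred_eq, Set.mem_union]
          constructor
          · rintro (h | ⟨⟨u, hu, rfl⟩, h⟩)
            · exact Or.inl (Or.inl h)
            · rcases Nat.lt_succ_iff_lt_or_eq.1 hu with hu | rfl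
              · exact Or.inl (Or.inr ⟨⟨u, hu, rfl⟩, h⟩)
              · exact Or.inr ⟨rfl, h⟩
          · rintro ((h | ⟨⟨u, hu, rfl⟩, h⟩) | ⟨rfl, h⟩)
            · exact Or.inl h
            · exact Or.inr ⟨⟨u, by omega, rfl⟩, h⟩
            · exact Or.inr ⟨⟨m, by omega, rfl⟩, h⟩
        have key : ∀ τ' : State, τ'.nreg = τ.nreg → τ'.rreg 7 = x → τ'.rreg 6 = N →
            τ'.nmem = τ.nmem → τ'.rmem = τ.rmem →
            (τ'.rreg 8 = if x < y ∧ y < τ.rreg 8 then y else τ.rreg 8) →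
            (fun m τ => (τ.nreg 4 = m ∧ τ.nreg 5 = b) ∧
              (∀ r, r ≠ 4 → τ.nreg r = σ.nreg r) ∧ τ.rreg 7 = x ∧ τ.rreg 6 = N ∧
              τ.nmem = σ.nmem ∧ τ.rmem = σ.rmem ∧
              IsLeast (insert N {y | (∃ u < m, y = padded w n N (i * b + u)) ∧ x < y})
                (τ.rreg 8)) (m + 1)
              { τ' with nreg := Function.update τ'.nreg 4 (τ'.nreg 4 + 1) } := by
          intro τ' e1 e2 e3 e4 e5 e6
          refine ⟨⟨by simp [e1, h4], by simp [e1, h5]⟩, fun r hr => ?_, e2, e3, by simp [e4, hnm],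
            by simp [e5, hrm], ?_⟩
          · simp only [Function.update_of_ne hr, e1, hn r hr]
          · simp only
            rw [hset, e6]
            split_ifs with hc
            · refine ⟨Or.inr ⟨rfl, hc.1⟩, ?_⟩
              rintro z (hz | ⟨rfl, hz⟩)
              · exact hc.2.le.trans (hleast.2 hz)
              · exact le_rfl
            · refine ⟨Or.inl hleast.1, ?_⟩
              rintro z (hz | ⟨rfl, hz⟩)
              · exact hleast.2 hz
              · by_contra! hlt
                exact hc ⟨hz, hlt⟩
        apply Runs.mono_time
        · apply Runs.cons_rset
          apply Runs.cons (T₁ := 1 + 1) (R := fun τ' => τ'.nreg = τ.nreg ∧ τ'.rreg 7 = x ∧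
            τ'.rreg 6 = N ∧ τ'.nmem = τ.nmem ∧ τ'.rmem = τ.rmem ∧
            τ'.rreg 8 = if x < y ∧ y < τ.rreg 8 then y else τ.rreg 8)
          · apply Runs.ite
            · intro hb
              simp [BExpr.eval, RExpr.eval, NExpr.eval, hcell, hr7] at hb
              apply Runs.rset
              refine ⟨rfl, by simpa using hr7, by simpa using hr6, rfl, rfl, ?_⟩
              rw [if_pos hb]
              simp [RExpr.eval, NExpr.eval, hcell]
            · intro hb
              simp [BExpr.eval, RExpr.eval, NExpr.eval, hcell, hr7] at hb
              apply Runs.skip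
              refine ⟨rfl, by simpa using hr7, by simpa using hr6, rfl, rfl, ?_⟩
              rw [if_neg (by simpa using hb)]
              simp
          · rintro τ' ⟨e1, e2, e3, e4, e5, e6⟩
            exact Runs.nil (key τ' e1 e2 e3 e4 e5 e6)
        · norm_num
    · rintro τ ⟨-, hn, hr7, hr6, hnm, hrm, hleast⟩
      have h7' : τ.nreg 7 = i := by rw [hn 7 (by norm_num), h7]
      apply Runs.cons_rstore
      apply Runs.nil
      simp only [NExpr.eval, RExpr.eval, h7']
      refine ⟨⟨?_, ?_, hr6, ?_, ?_⟩, hn, hr7, ?_, ?_, ?_⟩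
      · simp only; rw [hn 1 (by norm_num), n1]
      · simp only; rw [hn 5 (by norm_num), n5]
      · simpa only [hnm] using base
      · intro u hu
        simp only [Function.update_of_ne (by decide : (0 : ℕ) ≠ 1), hrm]
        exact cells u hu
      · simpa only [Function.update_self, blockAbove] using hleast
      · intro i' hi'
        simp only [Function.update_self, Function.update_of_ne hi', hrm]
      · intro r hr
        simp only [Function.update_of_ne hr, hrm]
  · omega

end RealRAM

namespace RealRAM

variable {O : Word → ℝ} {n : ℕ} {w : ℕ → ℝ}

/-- Compute in register `7` the number of a block whose stored minimum is least, and in real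
register `8` this minimum. -/
def minProg : Prog := block
  [.rset 8 (.reg 6), .nset 7 (.const 0), .nset 3 (.const 0),
   forLoop 3 5 (.ite (.not (.rle (.reg 8) (.mem 1 (.reg 3))))
    (block [.rset 8 (.mem 1 (.reg 3)), .nset 7 (.reg 3)]) .skip)]

lemma runs_minProg {σ : State} {b : ℕ} {N : ℝ} (hb : 0 < b) (h : SortEnv w n b N σ) :
    Runs O minProg σ (6 * b + 5) fun σ' =>
      SortEnv w n b N σ' ∧ σ'.nreg 2 = σ.nreg 2 ∧ σ'.rreg 7 = σ.rreg 7 ∧ σ'.rmem = σ.rmem ∧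
      σ'.nreg 7 < b ∧ (∀ i < b, σ'.rreg 8 ≤ σ.rmem 1 i) ∧
      (σ'.rreg 8 = N ∨ σ'.rreg 8 = σ.rmem 1 (σ'.nreg 7)) := by
  obtain ⟨n1, n5, r6, base, cells⟩ := h
  apply Runs.mono_time
  · apply Runs.cons_rset
    apply Runs.cons_nset
    apply Runs.cons_nset
    apply Runs.cons
    · apply Runs.forLoop (I := fun m τ => (τ.nreg 3 = m ∧ τ.nreg 5 = b) ∧
        (τ.nreg 1 = n ∧ τ.nreg 2 = σ.nreg 2 ∧ τ.rreg 6 = N ∧ τ.rreg 7 = σ.rreg 7 ∧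
          τ.nmem = σ.nmem ∧ τ.rmem = σ.rmem) ∧ τ.nreg 7 < b ∧
        (∀ i < m, τ.rreg 8 ≤ σ.rmem 1 i) ∧ (τ.rreg 8 = N ∨ τ.rreg 8 = σ.rmem 1 (τ.nreg 7)))
        (fun m σ h => h.1) (T := 1 + (1 + (1 + 1))) (m := 0) (n := b) _ (Nat.zero_le _)
      · simp [NExpr.eval, RExpr.eval, n1, n5, r6, hb]
      · rintro m hm τ ⟨⟨h3, h5⟩, ⟨h1, h2, h6, h7, hnm, hrm⟩, hlt, hle, hor⟩
        apply Runs.ite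
        · intro hc
          simp only [BExpr.eval, RExpr.eval, NExpr.eval, h3, hrm, not_le] at hc
          apply Runs.cons_rset
          apply Runs.cons_nset
          apply Runs.nil
          simp only [RExpr.eval, NExpr.eval, h3, hrm]
          refine ⟨⟨by simp [h3], by simp [h5]⟩, ⟨by simp [h1], by simp [h2], by simp [h6],
            by simp [h7], by simp [hnm], trivial⟩, by simpa using hm, fun i hi => ?_, ?_⟩
          · simp only [Function.update_self]
            rcases Nat.lt_succ_iff_lt_or_eq.1 hi with hi | rfl
            · exact hc.le.trans (hle i hi)
            · exact le_rfl
          · right; simp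
        · intro hc
          simp only [BExpr.eval, RExpr.eval, NExpr.eval, h3, hrm, not_le, not_lt] at hc
          apply Runs.mono_time
          · apply Runs.skip
            refine ⟨⟨by simp [h3], by simp [h5]⟩, ⟨by simp [h1], by simp [h2], h6, h7, hnm, hrm⟩,
              by simpa using hlt, fun i hi => ?_, by simpa using hor⟩
            rcases Nat.lt_succ_iff_lt_or_eq.1 hi with hi | rfl
            · exact hle i hi
            · exact hc
          · norm_num
    · rintro τ ⟨⟨h3, h5⟩, ⟨h1, h2, h6, h7, hnm, hrm⟩, hlt, hle, hor⟩
      exact Runs.nil ⟨⟨h1, h5, h6, by simpa only [hnm] using base, by simpa only [hrm] using cells⟩,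
        h2, h7, hrm, hlt, hle, hor⟩
  · omega

/-- The state of the sorting loop after `i` rounds: the list `zs` of the `i` least elements of `L`
in increasing order has been found, with last element in real register `7`. The array number `3`
holds their multiples by `E`, in the same order, and the array number `4` their multiples by `-F`,
in reverse order at the end of an array of the length of `L`. -/
structure Selecting (L : List ℝ) (b : ℕ) (N : ℝ) (E F : ℤ) (i : ℕ) (zs : List ℝ) (σ : State) :
    Prop where
  env : SortEnv (fun t => L.getD t 0) L.length b N σ
  n2 : σ.nreg 2 = i
  length : zs.length = i
  sorted : zs.Pairwise (· < ·)
  subset : zs ⊆ L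
  le_last : ∀ z ∈ zs, z ≤ σ.rreg 7
  complete : ∀ x ∈ L, x ≤ σ.rreg 7 → x ∈ zs
  blocks : ∀ j < b,
    IsLeast (blockAbove (fun t => L.getD t 0) L.length b N j (σ.rreg 7)) (σ.rmem 1 j)
  outA : ∀ t < i, σ.rmem 3 t = E * zs.getD t 0
  outB : ∀ t < i, σ.rmem 4 (L.length - 1 - t) = -F * zs.getD t 0

/-- One round of the sorting loop. -/
def selectProg (E F : ℤ) : Prog := block
  [minProg, .rstore 3 (.reg 2) (.mul (.const E) (.reg 8)),
   .rstore 4 (.sub (.sub (.reg 1) (.const 1)) (.reg 2)) (.mul (.const (-F)) (.reg 8)),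
   .rset 7 (.reg 8), scanProg]

lemma runs_selectProg {L : List ℝ} (hL : L.Nodup) {b : ℕ} {N : ℝ} (hlen : L.length ≤ b * b)
    (hN : ∀ x ∈ L, x < N) {E F : ℤ} {i : ℕ} (hi : i < L.length) {zs : List ℝ} {σ : State}
    (h : Selecting L b N E F i zs σ) :
    Runs O (selectProg E F) σ (12 * b + 14) fun σ' => ∃ zs', Selecting L b N E F (i + 1) zs'
      { σ' with nreg := Function.update σ'.nreg 2 (σ'.nreg 2 + 1) } := by
  have hb : 0 < b := by
    rcases Nat.eq_zero_or_pos b with rfl | h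
    · omega
    · exact h
  set w : ℕ → ℝ := fun t => L.getD t 0 with hw
  have hwL : ∀ t < L.length, w t ∈ L := by
    intro t ht
    simp only [hw, List.getD_eq_getElem _ _ ht]
    exact List.getElem_mem ht
  -- every entry of a block is an element of `L` or the sentinel
  have hcell : ∀ j < b, ∀ x y, y ∈ blockAbove w L.length b N j x → y < N →
      x < y ∧ ∃ u < b, j * b + u < L.length ∧ y = w (j * b + u) := by
    rintro j hj x y (rfl | ⟨⟨u, hu, rfl⟩, hxy⟩) hlt
    · exact absurd hlt (lt_irrefl _)
    · refine ⟨hxy, u, hu, ?_⟩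
      unfold padded at hlt ⊢
      split_ifs at hlt ⊢ with hc
      · exact ⟨hc, rfl⟩
      · exact absurd hlt (lt_irrefl _)
  apply Runs.mono_time
  · apply Runs.cons (runs_minProg hb h.env)
    rintro τ ⟨henv, h2, h7, hrm, hlt, hle, hor⟩
    set m := τ.rreg 8 with hm
    -- `m` is the least element of `L` above the last one found
    have hleast : ∀ x ∈ L, σ.rreg 7 < x → m ≤ x := by
      intro x hx hlast
      obtain ⟨t, ht, rfl⟩ := List.mem_iff_getElem.1 hx
      have htb : t < b * b := ht.trans_le hlen
      have hj : t / b < b := Nat.div_lt_of_lt_mul htb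
      refine (hle _ hj).trans ((h.blocks _ hj).2 (Or.inr ⟨⟨t % b, Nat.mod_lt _ hb, ?_⟩, hlast⟩))
      rw [Nat.div_add_mod', padded, if_pos ht]
      simp [List.getElem?_eq_getElem ht]
    obtain ⟨x, hx, hxz⟩ : ∃ x ∈ L, x ∉ zs := by
      by_contra! hall
      have := (hL.subperm hall).length_le
      rw [h.length] at this
      omega
    have hxlast : σ.rreg 7 < x := by
      by_contra! hc
      exact hxz (h.complete x hx hc)
    have hmN : m < N := (hleast x hx hxlast).trans_lt (hN x hx)
    have hmb : m = σ.rmem 1 (τ.nreg 7) := hor.resolve_left hmN.ne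
    have hmblock := (h.blocks _ hlt).1
    rw [← hmb] at hmblock
    obtain ⟨hmlast, u, hu, hidx, hmw⟩ := hcell _ hlt _ _ hmblock hmN
    have hmL : m ∈ L := hmw ▸ hwL _ hidx
    apply Runs.cons_rstore
    apply Runs.cons_rstore
    apply Runs.cons_rset
    apply Runs.cons
    · refine runs_scanProg (w := w) (n := L.length) (b := b) (i := τ.nreg 7) (N := N) (x := m)
        ⟨henv.n1, henv.n5, by simpa using henv.r6, henv.base, ?_⟩ rfl hlt (by simp [RExpr.eval, hm])
      intro t ht
      exact henv.cells t ht
    · rintro τ' ⟨henv', hn', hr7, hscan, hother, hrm'⟩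
      apply Runs.nil
      refine ⟨zs ++ [m], ?_⟩
      have hn2 : τ'.nreg 2 = i := by rw [hn' 2 (by norm_num)]; exact h2.trans h.n2
      refine ⟨⟨by simpa using henv'.n1, by simpa using henv'.n5, henv'.r6, henv'.base,
        henv'.cells⟩, by simp [hn2], by simp [h.length], ?_, ?_, ?_, ?_, ?_, ?_, ?_⟩
      · rw [List.pairwise_append]
        refine ⟨h.sorted, List.pairwise_singleton _ _, fun z hz y hy => ?_⟩
        rw [List.mem_singleton.1 hy]
        exact (h.le_last z hz).trans_lt hmlast
      · intro z hz
        rcases List.mem_append.1 hz with hz | hz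
        · exact h.subset hz
        · rw [List.mem_singleton.1 hz]; exact hmL
      · intro z hz
        simp only [hr7]
        rcases List.mem_append.1 hz with hz | hz
        · exact (h.le_last z hz).trans hmlast.le
        · rw [List.mem_singleton.1 hz]
      · intro y hy hym
        simp only [hr7] at hym
        rcases le_or_gt y (σ.rreg 7) with hc | hc
        · exact List.mem_append_left _ (h.complete y hy hc)
        · rw [le_antisymm hym (hleast y hy hc)]
          simp
      · intro j hj
        simp only [hr7]
        by_cases hjb : j = τ.nreg 7
        · rw [hjb]; exact hscan
        · -- the minimum of another block is not `m`, since `L` has no repetitions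
          have he : τ'.rmem 1 j = σ.rmem 1 j := by
            rw [hother j hjb]; simp [hrm]
          obtain ⟨hmem, hlow⟩ := h.blocks j hj
          rw [he]
          refine ⟨?_, ?_⟩
          · rcases hmem with hmem | ⟨hmem, hgt⟩
            · exact Or.inl hmem
            · refine Or.inr ⟨hmem, lt_of_le_of_ne (hle j hj) fun heq => hjb ?_⟩
              obtain ⟨-, u', hu', hidx', hmw'⟩ := hcell j hj _ _ (Or.inr ⟨hmem, hgt⟩)
                (heq ▸ hmN)
              have heq' : w (j * b + u') = w (τ.nreg 7 * b + u) := by rw [← hmw', ← heq, hmw]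
              simp only [hw, List.getD_eq_getElem _ _ hidx, List.getD_eq_getElem _ _ hidx'] at heq'
              have hind := (hL.getElem_inj_iff).1 heq'
              have hdiv : ∀ i v : ℕ, v < b → (i * b + v) / b = i := by
                intro i v hv
                rw [Nat.mul_comm, Nat.mul_add_div hb, Nat.div_eq_of_lt hv, add_zero]
              rw [← hdiv j u' hu', hind, hdiv _ u hu]
          · rintro y (rfl | ⟨hy, hym⟩)
            · exact hlow (Or.inl rfl)
            · exact hlow (Or.inr ⟨hy, hmlast.trans hym⟩)
      · intro t ht
        have he : τ'.rmem 3 t = Function.update (σ.rmem 3) i (E * m) t := by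
          rw [hrm' 3 (by norm_num)]
          simp [hrm, NExpr.eval, RExpr.eval, h2, h.n2, hm]
        simp only [he]
        rcases Nat.lt_succ_iff_lt_or_eq.1 ht with ht | rfl
        · rw [Function.update_of_ne ht.ne, h.outA t ht]
          have : t < zs.length := by rw [h.length]; exact ht
          simp [List.getElem?_append_left this]
        · rw [Function.update_self]
          simp [← h.length]
      · intro t ht
        have he : ∀ r, τ'.rmem 4 r = Function.update (σ.rmem 4) (L.length - 1 - i) (-F * m) r := by
          intro r
          rw [hrm' 4 (by norm_num)]
          simp [hrm, NExpr.eval, RExpr.eval, h2, h.n2, hm, henv.n1]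
        simp only [he]
        rcases Nat.lt_succ_iff_lt_or_eq.1 ht with ht | rfl
        · rw [Function.update_of_ne (by omega), h.outB t ht]
          have : t < zs.length := by rw [h.length]; exact ht
          simp [List.getElem?_append_left this]
        · rw [Function.update_self]
          simp [← h.length]
  · omega

/-- Sort the inputs, scanning only the block of the element found in each round, into the arrays
number `3` and `4`, multiplied by `E` and by `-F`. -/
def sortProg (E F : ℤ) : Prog := block
  [boundProg, rootProg, baseProg, padProg,
   .rset 7 (.sub (.const 0) (.reg 6)), .nset 7 (.const 0), forLoop 7 5 scanProg,
   .nset 2 (.const 0), forLoop 2 1 (selectProg E F)]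

lemma runs_sortProg {L : List ℝ} (hL : L.Nodup) (E F : ℤ) {σ : State}
    (h1 : σ.nreg 1 = L.length) (h0 : σ.rmem 0 = fun t => L.getD t 0) :
    Runs O (sortProg E F) σ
      ((9 * rootUp L.length + 15) * (rootUp L.length + 1) +
        (L.length + 1) * (12 * rootUp L.length + 19)) fun σ' =>
      ∃ zs : List ℝ, zs.Perm L ∧ zs.Pairwise (· < ·) ∧ σ'.nreg 1 = L.length ∧
        1 ≤ σ'.rreg 6 ∧ (∀ x ∈ L, |x| < σ'.rreg 6) ∧
        (∀ t < L.length, σ'.rmem 3 t = E * zs.getD t 0) ∧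
        (∀ t < L.length, σ'.rmem 4 (L.length - 1 - t) = -F * zs.getD t 0) := by
  set b := rootUp L.length with hb
  apply Runs.mono_time
  · apply Runs.cons (runs_boundProg h1 h0)
    rintro σ₁ ⟨h1, h0, hN1, hN⟩
    have hNL : ∀ x ∈ L, |x| < σ₁.rreg 6 := by
      intro x hx
      obtain ⟨t, ht, rfl⟩ := List.mem_iff_getElem.1 hx
      have := hN t ht
      rwa [List.getD_eq_getElem _ _ ht] at this
    set N := σ₁.rreg 6 with hNdef
    apply Runs.cons (runs_rootProg h1 h0 hNdef.symm)
    rintro σ₂ ⟨h1, h0, h6, h5⟩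
    apply Runs.cons (runs_baseProg h1 h0 h6 h5)
    rintro σ₃ ⟨h1, h0, h6, h5, h6', hbase⟩
    apply Runs.cons (runs_padProg (le_rootUp _) h1 h0 h6 h5 h6' hbase)
    intro σ₄ henv
    apply Runs.cons_rset
    apply Runs.cons_nset
    apply Runs.cons
    · apply Runs.forLoop (I := fun m τ => (τ.nreg 7 = m ∧ τ.nreg 5 = b) ∧
        SortEnv (fun t => L.getD t 0) L.length b N τ ∧ τ.rreg 7 = -N ∧
        ∀ j < m, IsLeast (blockAbove (fun t => L.getD t 0) L.length b N j (-N)) (τ.rmem 1 j))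
        (fun m σ h => h.1) (T := 6 * b + 5) (m := 0) (n := b) _ (Nat.zero_le _)
      · obtain ⟨a1, a2, a3, a4, a5⟩ := henv
        refine ⟨⟨by simp [NExpr.eval], by simpa using a2⟩, ⟨by simpa using a1, by simpa using a2,
          by simpa using a3, a4, a5⟩, by simp [RExpr.eval, a3], by simp⟩
      · rintro m hm τ ⟨⟨h7, h5⟩, henv, hr7, hblocks⟩
        refine (runs_scanProg henv h7 hm hr7).conseq ?_
        rintro τ' ⟨⟨a1, a2, a3, a4, a5⟩, hn, hr7', hleast, hother, -⟩
        refine ⟨⟨by simp [hn 7, h7], by simpa using a2⟩, ⟨by simpa using a1, by simpa using a2,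
          a3, a4, a5⟩, hr7', fun j hj => ?_⟩
        rcases Nat.lt_succ_iff_lt_or_eq.1 hj with hj | rfl
        · simp only [hother j hj.ne]; exact hblocks j hj
        · exact hleast
    rintro σ₅ ⟨-, ⟨a1, a2, a3, a4, a5⟩, hr7, hblocks⟩
    apply Runs.cons_nset
    apply Runs.cons
    · apply Runs.forLoop (I := fun m τ => (τ.nreg 2 = m ∧ τ.nreg 1 = L.length) ∧
        ∃ zs, Selecting L b N E F m zs τ) (fun m σ h => h.1) (T := 12 * b + 14) (m := 0)
        (n := L.length) _ (Nat.zero_le _)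
      · refine ⟨⟨by simp [NExpr.eval], by simpa using a1⟩, [], ⟨by simpa using a1,
          by simpa using a2, a3, a4, a5⟩, by simp [NExpr.eval], rfl, List.Pairwise.nil, by simp,
          by simp, ?_, ?_, by simp, by simp⟩
        · intro x hx hle
          simp only [hr7] at hle
          linarith [(abs_lt.1 (hNL x hx)).1]
        · simpa only [hr7] using hblocks
      · rintro m hm τ ⟨-, zs, hsel⟩
        refine (runs_selectProg hL (le_rootUp _)
          (fun x hx => (le_abs_self x).trans_lt (hNL x hx)) hm hsel).conseq ?_
        rintro τ' ⟨zs', h⟩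
        exact ⟨⟨h.n2, h.env.n1⟩, zs', h⟩
    rintro σ₆ ⟨-, zs, h⟩
    apply Runs.nil
    have hnd : zs.Nodup := h.sorted.imp fun hlt => ne_of_lt hlt
    refine ⟨zs, (hnd.subperm h.subset).perm_of_length_le h.length.ge, h.sorted, h.env.n1, ?_, ?_,
      h.outA, h.outB⟩
    · rw [h.env.r6]; exact hN1
    · rw [h.env.r6]; exact hNL
  · rw [Nat.sub_zero, Nat.sub_zero]
    ring_nf
    nlinarith [Nat.zero_le (b * L.length), Nat.zero_le b, Nat.zero_le L.length]

end RealRAM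

/-! ### Writing down the maze -/

namespace RealRAM

variable {O : Word → ℝ}

/-- The linear form `a * q + b` in the unit of length `q`, which is kept in real register `5`. -/
def lin (a b : ℤ) : RExpr := .add (.mul (.const a) (.reg 5)) (.const b)

/-- Append the value of `e` to the output array of reals. -/
def pushProg (e : RExpr) : Prog :=
  .seq (.rstore 2 (.reg 10) e) (.nset 10 (.add (.reg 10) (.const 1)))

/-- Append to the output the box whose bounds are in the real registers `1` to `4`. -/
def emitProg : Prog := block
  [.nstore 2 (.reg 9) (.const 4), .nset 9 (.add (.reg 9) (.const 1)),
   pushProg (.reg 1), pushProg (.reg 3), pushProg (.reg 2), pushProg (.reg 3),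
   pushProg (.reg 2), pushProg (.reg 4), pushProg (.reg 1), pushProg (.reg 4)]

/-- The memory while the output is written: besides the sizes and the slit positions, it holds the
encoding of the boxes `bs`, preceded by the coordinates `hd` of the two terminals. -/
structure Emitted (n : ℕ) (q : ℝ) (A B : List ℝ) (hd : List ℝ) (bs : List Box) (σ : State) :
    Prop where
  n1 : σ.nreg 1 = n
  r5 : σ.rreg 5 = q
  memA : ∀ t < n, σ.rmem 3 t = A.getD t 0
  memB : ∀ t < n, σ.rmem 4 t = B.getD t 0
  outN : (List.range (σ.nreg 9)).map (σ.nmem 2) = bs.map fun _ => 4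
  outR : (List.range (σ.nreg 10)).map (σ.rmem 2) = hd ++ bs.flatMap Box.coords

variable {n : ℕ} {q : ℝ} {A B hd : List ℝ} {bs : List Box}

lemma map_range_update {α : Type*} (f : ℕ → α) (m : ℕ) (v : α) :
    (List.range (m + 1)).map (Function.update f m v) = (List.range m).map f ++ [v] := by
  rw [List.range_succ, List.map_append]
  congr 1
  · refine List.map_congr_left fun i hi => ?_
    rw [Function.update_of_ne (List.mem_range.1 hi).ne]
  · simp

/-- The effect of appending a number to the output array. -/
lemma runs_pushProg {σ : State} {e : RExpr} {Q : State → Prop}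
    (h : ∀ σ' : State, (∀ r, r ≠ 10 → σ'.nreg r = σ.nreg r) → σ'.rreg = σ.rreg →
      σ'.nmem = σ.nmem → (∀ r, r ≠ 2 → σ'.rmem r = σ.rmem r) →
      (List.range (σ'.nreg 10)).map (σ'.rmem 2) =
        (List.range (σ.nreg 10)).map (σ.rmem 2) ++ [e.eval σ] → Q σ') :
    Runs O (pushProg e) σ 2 Q := by
  refine Runs.seq (T₁ := 1) (T₂ := 1)
    (R := fun τ => τ =
      { σ with rmem :=
          Function.update σ.rmem 2 (Function.update (σ.rmem 2) (σ.nreg 10) (e.eval σ)) })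
    (Runs.rstore rfl) ?_
  rintro _ rfl
  refine Runs.nset (h _ ?_ rfl rfl ?_ ?_)
  · intro r hr; simp [hr]
  · intro r hr; simp [hr]
  · simp [NExpr.eval, map_range_update]

lemma runs_emitProg {σ : State} {b : Box} (h : Emitted n q A B hd bs σ)
    (h1 : σ.rreg 1 = b.x0) (h2 : σ.rreg 2 = b.x1) (h3 : σ.rreg 3 = b.y0) (h4 : σ.rreg 4 = b.y1) :
    Runs O emitProg σ 19 fun σ' => Emitted n q A B hd (bs ++ [b]) σ' ∧ σ'.rreg = σ.rreg ∧
      ∀ r, r < 9 → σ'.nreg r = σ.nreg r := by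
  obtain ⟨n1, r5, memA, memB, outN, outR⟩ := h
  apply Runs.mono_time
  · apply Runs.cons_nstore
    apply Runs.cons (T₁ := 1) (R := fun σ₀ => (∀ r, r ≠ 9 → σ₀.nreg r = σ.nreg r) ∧
      (List.range (σ₀.nreg 9)).map (σ₀.nmem 2) =
        (List.range (σ.nreg 9)).map (σ.nmem 2) ++ [4] ∧ σ₀.rreg = σ.rreg ∧ σ₀.rmem = σ.rmem)
    · exact Runs.nset
        ⟨fun r hr => by simp [hr], by simp [NExpr.eval, map_range_update], rfl, rfl⟩
    rintro σ₀ ⟨e0, f0, g0, k0⟩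
    have l0 : σ₀.nreg 10 = σ.nreg 10 := e0 10 (by norm_num)
    apply Runs.cons
    · apply runs_pushProg (Q := fun τ => (∀ r, r < 10 → τ.nreg r = σ₀.nreg r) ∧
        τ.rreg = σ.rreg ∧ τ.nmem = σ₀.nmem ∧ (∀ r, r ≠ 2 → τ.rmem r = σ.rmem r) ∧
        (List.range (τ.nreg 10)).map (τ.rmem 2) =
          (List.range (σ.nreg 10)).map (σ.rmem 2) ++ [b.x0])
      intro τ a1 a2 a3 a4 a5
      refine ⟨fun r hr => a1 r (by omega), a2.trans g0, a3, fun r hr => by rw [a4 r hr, k0], ?_⟩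
      rw [a5, l0, k0]
      simp [RExpr.eval, g0, h1]
    -- all the facts about the state after another number has been appended
    have step : ∀ (τ : State) (e : RExpr) (xs : List ℝ) (x : ℝ) (cs : List Prog) (T : ℕ)
        (Q : State → Prop), e.eval τ = x →
        ((∀ r, r < 10 → τ.nreg r = σ₀.nreg r) ∧ τ.rreg = σ.rreg ∧ τ.nmem = σ₀.nmem ∧
          (∀ r, r ≠ 2 → τ.rmem r = σ.rmem r) ∧ (List.range (τ.nreg 10)).map (τ.rmem 2) =
            (List.range (σ.nreg 10)).map (σ.rmem 2) ++ xs) →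
        (∀ τ' : State, ((∀ r, r < 10 → τ'.nreg r = σ₀.nreg r) ∧ τ'.rreg = σ.rreg ∧
          τ'.nmem = σ₀.nmem ∧ (∀ r, r ≠ 2 → τ'.rmem r = σ.rmem r) ∧
          (List.range (τ'.nreg 10)).map (τ'.rmem 2) =
            (List.range (σ.nreg 10)).map (σ.rmem 2) ++ (xs ++ [x])) →
          Runs O (block cs) τ' T Q) → Runs O (block (pushProg e :: cs)) τ (2 + T) Q := by
      rintro τ e xs x cs T Q he ⟨b1, b2, b3, b4, b5⟩ hcs
      refine Runs.cons (R := fun τ' => _) (runs_pushProg fun τ' a1 a2 a3 a4 a5 => ?_) hcs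
      refine ⟨fun r hr => (a1 r (by omega)).trans (b1 r hr), a2.trans b2, a3.trans b3,
        fun r hr => (a4 r hr).trans (b4 r hr), ?_⟩
      rw [a5, b5, he, List.append_assoc]
    intro τ₁ H₁
    refine step τ₁ _ _ b.y0 _ 13 _ (by simp [RExpr.eval, H₁.2.1, h3]) H₁ fun τ₂ H₂ => ?_
    refine step τ₂ _ _ b.x1 _ 11 _ (by simp [RExpr.eval, H₂.2.1, h2]) H₂ fun τ₃ H₃ => ?_
    refine step τ₃ _ _ b.y0 _ 9 _ (by simp [RExpr.eval, H₃.2.1, h3]) H₃ fun τ₄ H₄ => ?_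
    refine step τ₄ _ _ b.x1 _ 7 _ (by simp [RExpr.eval, H₄.2.1, h2]) H₄ fun τ₅ H₅ => ?_
    refine step τ₅ _ _ b.y1 _ 5 _ (by simp [RExpr.eval, H₅.2.1, h4]) H₅ fun τ₆ H₆ => ?_
    refine step τ₆ _ _ b.x0 _ 3 _ (by simp [RExpr.eval, H₆.2.1, h1]) H₆ fun τ₇ H₇ => ?_
    refine step τ₇ _ _ b.y1 _ 1 _ (by simp [RExpr.eval, H₇.2.1, h4]) H₇ fun τ₈ H₈ => ?_
    obtain ⟨b1, b2, b3, b4, b5⟩ := H₈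
    refine Runs.nil ⟨⟨?_, ?_, ?_, ?_, ?_, ?_⟩, b2, fun r hr => ?_⟩
    · rw [b1 1 (by norm_num), e0 1 (by norm_num), n1]
    · rw [b2, r5]
    · rw [b4 3 (by norm_num)]; exact memA
    · rw [b4 4 (by norm_num)]; exact memB
    · rw [b1 9 (by norm_num), b3, f0, outN]; simp
    · rw [b5, outR]; simp [Box.coords]
    · rw [b1 r (by omega), e0 r (by omega)]
  · norm_num

/-- Append a box with given bounds to the output. -/
def boxProg (a₁ b₁ a₂ b₂ a₃ b₃ a₄ b₄ : ℤ) : Prog := block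
  [.rset 1 (lin a₁ b₁), .rset 2 (lin a₂ b₂), .rset 3 (lin a₃ b₃), .rset 4 (lin a₄ b₄), emitProg]

lemma Emitted.rset {σ : State} (h : Emitted n q A B hd bs σ) {r : ℕ} (hr : r ≠ 5) (v : ℝ) :
    Emitted n q A B hd bs { σ with rreg := Function.update σ.rreg r v } :=
  ⟨h.n1, by simpa [Function.update_of_ne hr.symm] using h.r5, h.memA, h.memB, h.outN, h.outR⟩

lemma Emitted.nset {σ : State} (h : Emitted n q A B hd bs σ) {r : ℕ} (h1 : r ≠ 1) (h9 : r ≠ 9)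
    (h10 : r ≠ 10) (v : ℕ) :
    Emitted n q A B hd bs { σ with nreg := Function.update σ.nreg r v } :=
  ⟨by simpa [Function.update_of_ne h1.symm] using h.n1, h.r5, h.memA, h.memB,
    by simpa [Function.update_of_ne h9.symm] using h.outN,
    by simpa [Function.update_of_ne h10.symm] using h.outR⟩

lemma runs_boxProg {σ : State} (h : Emitted n q A B hd bs σ) (a₁ b₁ a₂ b₂ a₃ b₃ a₄ b₄ : ℤ) :
    Runs O (boxProg a₁ b₁ a₂ b₂ a₃ b₃ a₄ b₄) σ 24
      (Emitted n q A B hd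
        (bs ++ [⟨a₁ * q + b₁, a₂ * q + b₂, a₃ * q + b₃, a₄ * q + b₄⟩])) := by
  have h5 := h.r5
  apply Runs.mono_time
  · apply Runs.cons_rset
    apply Runs.cons_rset
    apply Runs.cons_rset
    apply Runs.cons_rset
    apply Runs.cons
    · refine runs_emitProg (b := ⟨a₁ * q + b₁, a₂ * q + b₂, a₃ * q + b₃, a₄ * q + b₄⟩)
        ((((h.rset (r := 1) (by norm_num) _).rset (r := 2) (by norm_num) _).rset (r := 3)
          (by norm_num) _).rset (r := 4) (by norm_num) _) ?_ ?_ ?_ ?_ <;>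
        simp [lin, RExpr.eval, h5]
    · intro τ hτ
      exact Runs.nil hτ.1
  · norm_num

/-- Append to the output the boxes of a wall from `l * q + 1` to `R * q - 1`. If a bank is given,
then it holds the positions of the slits relative to `c * q`. -/
def wallProg (h : ℕ) (bank : Option ℕ) (c l R a₃ b₃ a₄ b₄ : ℤ) : Prog := block
  [.rset 1 (lin l 1), .rset 3 (lin a₃ b₃), .rset 4 (lin a₄ b₄),
   bank.elim .skip fun k => .seq (.nset 2 (.const 0)) (forLoop 2 1 (block
    [.rset 2 (.add (.mem k (.reg 2)) (lin c (-(2 * h)))), emitProg,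
     .rset 1 (.add (.mem k (.reg 2)) (lin c (2 * h)))])),
   .rset 2 (lin R (-1)), emitProg]

lemma runs_wallProg {σ : State} {h : ℕ} (hE : Emitted n q A B hd bs σ) (bank : Option ℕ)
    (c l R a₃ b₃ a₄ b₄ : ℤ) (zs : List ℝ)
    (hzs : (bank = none ∧ zs = []) ∨
      (bank = some 3 ∧ A.length = n ∧ zs = A.map (c * q + ·)) ∨
      (bank = some 4 ∧ B.length = n ∧ zs = B.map (c * q + ·))) :
    Runs O (wallProg h bank c l R a₃ b₃ a₄ b₄) σ (24 * n + 27)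
      (Emitted n q A B hd (bs ++ wallBoxes (2 * h) (a₃ * q + b₃) (a₄ * q + b₄) (l * q + 1) zs
        (R * q - 1))) := by
  have h5 := hE.r5
  generalize hg : bs ++ wallBoxes (2 * h) (a₃ * q + b₃) (a₄ * q + b₄) (l * q + 1) zs
    (R * q - 1) = goal
  apply Runs.mono_time
  · apply Runs.cons_rset
    apply Runs.cons_rset
    apply Runs.cons (T₁ := 1) (R := fun τ => Emitted n q A B hd bs τ ∧
      τ.rreg 1 = l * q + 1 ∧ τ.rreg 3 = a₃ * q + b₃ ∧ τ.rreg 4 = a₄ * q + b₄)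
    · exact Runs.rset ⟨((hE.rset (r := 1) (by norm_num) _).rset (r := 3) (by norm_num) _).rset
        (r := 4) (by norm_num) _, by simp [lin, RExpr.eval, h5], by simp [lin, RExpr.eval, h5],
        by simp [lin, RExpr.eval, h5]⟩
    rintro σ₀ ⟨hE0, r1, r3, r4⟩
    apply Runs.cons (T₁ := 24 * n + 2) (R := fun τ => τ.rreg 3 = a₃ * q + b₃ ∧
      τ.rreg 4 = a₄ * q + b₄ ∧ ∃ bs', Emitted n q A B hd bs' τ ∧
        bs' ++ wallBoxes (2 * h) (a₃ * q + b₃) (a₄ * q + b₄) (τ.rreg 1) [] (R * q - 1) = goal)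
    · have hloop : ∀ k, zs.length = n →
          (∀ bs' τ, Emitted n q A B hd bs' τ → ∀ t (ht : t < zs.length),
            τ.rmem k t + c * q = zs[t]) →
          Runs O (.seq (.nset 2 (.const 0)) (forLoop 2 1 (block
            [.rset 2 (.add (.mem k (.reg 2)) (lin c (-(2 * h)))), emitProg,
             .rset 1 (.add (.mem k (.reg 2)) (lin c (2 * h)))]))) σ₀ (24 * n + 2)
            fun τ => τ.rreg 3 = a₃ * q + b₃ ∧ τ.rreg 4 = a₄ * q + b₄ ∧
              ∃ bs', Emitted n q A B hd bs' τ ∧ bs' ++ wallBoxes (2 * h) (a₃ * q + b₃)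
                (a₄ * q + b₄) (τ.rreg 1) [] (R * q - 1) = goal := by
        intro k hlen hmem
        apply Runs.mono_time
        · apply Runs.seq (T₁ := 1)
          · exact Runs.nset rfl
          rintro _ rfl
          apply Runs.conseq
          · apply Runs.forLoop (I := fun m τ => (τ.nreg 2 = m ∧ τ.nreg 1 = n) ∧
              τ.rreg 3 = a₃ * q + b₃ ∧ τ.rreg 4 = a₄ * q + b₄ ∧
              ∃ bs', Emitted n q A B hd bs' τ ∧ bs' ++ wallBoxes (2 * h) (a₃ * q + b₃)
                (a₄ * q + b₄) (τ.rreg 1) (zs.drop m) (R * q - 1) = goal)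
              (fun m τ h => h.1) (T := 22) (m := 0) (n := n) _ (Nat.zero_le _)
            · exact ⟨⟨rfl, (hE0.nset (r := 2) (by norm_num) (by norm_num) (by norm_num) _).n1⟩,
                r3, r4, bs, hE0.nset (by norm_num) (by norm_num) (by norm_num) _,
                by rw [← hg, List.drop_zero, ← r1]⟩
            · rintro m hm τ ⟨⟨n2, n1⟩, r3, r4, bs', hE', hg'⟩
              have hm' : m < zs.length := by omega
              have hz := hmem _ _ hE' m hm'
              have h5' := hE'.r5
              apply Runs.mono_time
              · apply Runs.cons_rset
                apply Runs.cons
                · refine runs_emitProg (b := ⟨τ.rreg 1, zs[m] - 2 * h, a₃ * q + b₃, a₄ * q + b₄⟩)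
                    (hE'.rset (r := 2) (by norm_num) _) ?_ ?_ ?_ ?_
                  · simp
                  · simp only [lin, RExpr.eval, NExpr.eval, n2, h5', Function.update_self, ← hz]
                    push_cast; ring
                  · simp [r3]
                  · simp [r4]
                · rintro τ' ⟨hE'', hr, hn⟩
                  have h5'' := hE''.r5
                  have hz' := hmem _ _ hE'' m hm'
                  have n2' : τ'.nreg 2 = m := by rw [hn 2 (by norm_num)]; exact n2
                  apply Runs.cons_rset
                  refine Runs.nil ⟨⟨by simp [n2'], ?_⟩, ?_, ?_, _,
                    (hE''.rset (r := 1) (by norm_num) _).nset (by norm_num) (by norm_num)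
                      (by norm_num) _, ?_⟩
                  · simpa using hE''.n1
                  · simp [hr, r3]
                  · simp [hr, r4]
                  · rw [← hg', List.drop_eq_getElem_cons hm']
                    simp only [wallBoxes, solidIntervals, List.map_cons, List.append_assoc,
                      List.singleton_append, Function.update_self, lin, RExpr.eval, NExpr.eval,
                      n2', h5'', ← hz']
                    push_cast
                    simp only [add_assoc]
              · norm_num
          · rintro τ ⟨-, r3, r4, bs', hE', hg'⟩
            rw [List.drop_eq_nil_of_le (by omega)] at hg'
            exact ⟨r3, r4, bs', hE', hg'⟩
        · omega
      rcases hzs with ⟨rfl, rfl⟩ | ⟨rfl, hlen, rfl⟩ | ⟨rfl, hlen, rfl⟩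
      · exact (Runs.skip ⟨r3, r4, bs, hE0, by rw [r1, hg]⟩).mono_time (by omega)
      · refine hloop 3 (by simpa using hlen) fun bs' τ h t ht => ?_
        rw [List.length_map] at ht
        rw [h.memA t (by omega), List.getElem_map, List.getD_eq_getElem _ _ ht, add_comm]
      · refine hloop 4 (by simpa using hlen) fun bs' τ h t ht => ?_
        rw [List.length_map] at ht
        rw [h.memB t (by omega), List.getElem_map, List.getD_eq_getElem _ _ ht, add_comm]
    · rintro τ ⟨r3, r4, bs', hE', hg⟩
      have h5' := hE'.r5
      apply Runs.cons_rset
      apply Runs.cons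
      · refine runs_emitProg (b := ⟨τ.rreg 1, R * q - 1, a₃ * q + b₃, a₄ * q + b₄⟩)
          (hE'.rset (r := 2) (by norm_num) _) ?_ ?_ ?_ ?_
        · simp
        · simp [lin, RExpr.eval, h5']; ring
        · simp [r3]
        · simp [r4]
      · intro τ' hτ'
        refine Runs.nil ?_
        rw [← hg]
        exact hτ'.1
  · omega

end RealRAM

namespace RealRAM

variable {O : Word → ℝ} {n : ℕ} {q : ℝ} {A B hd : List ℝ} {bs : List Box}

lemma runs_pushProg_lin {σ : State} (h : Emitted n q A B hd [] σ) (a b : ℤ) :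
    Runs O (pushProg (lin a b)) σ 2 (Emitted n q A B (hd ++ [a * q + b]) []) := by
  obtain ⟨n1, r5, memA, memB, outN, outR⟩ := h
  refine runs_pushProg fun τ a1 a2 a3 a4 a5 => ⟨?_, ?_, ?_, ?_, ?_, ?_⟩
  · rw [a1 1 (by norm_num), n1]
  · rw [a2, r5]
  · rw [a4 3 (by norm_num)]; exact memA
  · rw [a4 4 (by norm_num)]; exact memB
  · rw [a1 9 (by norm_num), a3, outN]
  · rw [a5, outR]; simp [lin, RExpr.eval, r5]

lemma runs_block_flatMap {α : Type*} {p : α → Prog} {g : α → List Box} {T : ℕ}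
    (hp : ∀ x bs σ, Emitted n q A B hd bs σ →
      Runs O (p x) σ T (Emitted n q A B hd (bs ++ g x))) (xs : List α) {σ : State}
    (h : Emitted n q A B hd bs σ) :
    Runs O (block (xs.map p)) σ (xs.length * T + 1) (Emitted n q A B hd (bs ++ xs.flatMap g)) := by
  induction xs generalizing bs σ with
  | nil => exact (Runs.nil (by simpa using h)).mono_time (by simp)
  | cons x xs ih =>
    refine (Runs.cons (hp x bs σ h) fun τ hτ => (ih hτ).conseq fun τ' hτ' => ?_).mono_time
      (T := T + (xs.length * T + 1)) ?_
    · simpa using hτ'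
    · rw [List.length_cons]; linarith

/-- Append the obstacles of the ring number `i` of copy `j` to the output. -/
def ringProg (h j i : ℕ) : Prog := block
  [boxProg (-(4 * (3 * j + 1 + i))) (-1) (-(4 * (3 * j + 1 + i))) 0
    (-(4 * (3 * j + 1 + i))) 0 (4 * (3 * j + 1 + i)) 0,
   boxProg (12 * j ^ 2 + 28 * j + 7 + 4 * i) 0 (12 * j ^ 2 + 28 * j + 7 + 4 * i) 1
    (-(4 * (3 * j + 1 + i))) 0 (4 * (3 * j + 1 + i)) 0,
   wallProg h (if Even j then some (if i = 1 then 4 else 3) else none)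
    (12 * j ^ 2 + 28 * j + 6 + 4 * i) (-(4 * (3 * j + 1 + i)))
    (12 * j ^ 2 + 28 * j + 7 + 4 * i) (4 * (3 * j + 1 + i)) (-h) (4 * (3 * j + 1 + i)) 0,
   wallProg h (if Even j then none else some (if i = 1 then 4 else 3))
    (12 * j ^ 2 + 28 * j + 6 + 4 * i) (-(4 * (3 * j + 1 + i)))
    (12 * j ^ 2 + 28 * j + 7 + 4 * i) (-(4 * (3 * j + 1 + i))) 0 (-(4 * (3 * j + 1 + i))) h]

lemma runs_ringProg {m : Maze} {h : ℕ} (hh : m.h = h) (hA : m.A.length = n) (hB : m.B.length = n)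
    {σ : State} (hE : Emitted n m.q m.A m.B hd bs σ) (j i : ℕ) :
    Runs O (ringProg h j i) σ (48 * n + 103)
      (Emitted n m.q m.A m.B hd (bs ++ (m.ring j i).holes m.h)) := by
  have slits : (some (if i = 1 then 4 else 3) = some 3 ∧ m.A.length = n ∧ m.slits j i =
        m.A.map (((12 * j ^ 2 + 28 * j + 6 + 4 * i : ℤ) : ℝ) * m.q + ·)) ∨
      (some (if i = 1 then 4 else 3) = some 4 ∧ m.B.length = n ∧ m.slits j i =
        m.B.map (((12 * j ^ 2 + 28 * j + 6 + 4 * i : ℤ) : ℝ) * m.q + ·)) := by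
    have e : m.axis j i = ((12 * j ^ 2 + 28 * j + 6 + 4 * i : ℤ) : ℝ) * m.q := by
      simp only [Maze.axis]; push_cast; ring
    by_cases hi : i = 1
    · right; simp only [Maze.slits, Maze.vals, e, if_pos hi, hB, true_and]
    · left; simp only [Maze.slits, Maze.vals, e, if_neg hi, hA, true_and]
  refine (Runs.cons (T₁ := 24) (T₂ := 48 * n + 79) (runs_boxProg hE _ _ _ _ _ _ _ _)
    fun σ₁ h₁ => ?_).mono_time (by omega)
  refine (Runs.cons (T₁ := 24) (T₂ := 48 * n + 55) (runs_boxProg h₁ _ _ _ _ _ _ _ _)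
    fun σ₂ h₂ => ?_).mono_time (by omega)
  refine (Runs.cons (T₁ := 24 * n + 27) (T₂ := 24 * n + 28)
    (runs_wallProg h₂ _ _ _ _ _ _ _ _ (m.ring j i).top ?_) fun σ₃ h₃ => ?_).mono_time (by omega)
  · by_cases hj : Even j
    · simpa only [Maze.ring, if_pos hj] using Or.inr slits
    · exact Or.inl ⟨if_neg hj, if_neg hj⟩
  refine (Runs.cons (T₁ := 24 * n + 27) (T₂ := 1)
    (runs_wallProg h₃ _ _ _ _ _ _ _ _ (m.ring j i).bot ?_) fun σ₄ h₄ => ?_).mono_time (by omega)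
  · by_cases hj : Even j
    · exact Or.inl ⟨if_pos hj, if_pos hj⟩
    · simpa only [Maze.ring, if_neg hj] using Or.inr slits
  refine Runs.nil ?_
  convert h₄ using 1
  simp only [BoxRing.holes, Maze.ring, Maze.axis, List.append_assoc, List.cons_append,
    List.nil_append, hh]
  push_cast
  congr 1
  congr 1
  · congr 1 <;> ring
  congr 1
  · congr 1 <;> ring
  congr 1 <;> congr 1 <;> ring

/-- Write down the maze whose unit of length is `K` times real register `6`. -/
def mazeProg (k h : ℕ) (K : ℤ) : Prog := block
  [.nset 9 (.const 0), .nset 10 (.const 0), .rset 5 (.mul (.const K) (.reg 6)),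
   pushProg (lin 0 0), pushProg (lin 4 (-h)), pushProg (lin 0 0),
   pushProg (lin ((if Even (k - 1) then 1 else -1) * (12 * k)) 0),
   boxProg (-(4 * (3 * k + 1))) 0 (4 * (3 * k ^ 2 + k) + 4) 0
    (-(4 * (3 * k + 1))) 0 (4 * (3 * k + 1)) 0,
   block ((List.range k).map fun j => block ((List.range 3).map fun i => ringProg h j i))]

/-- The time that `mazeProg` takes. -/
def mazeTime (k n : ℕ) : ℕ := k * (144 * n + 310) + 37

lemma runs_mazeProg (m : Maze) {h : ℕ} (hh : m.h = h) (hA : m.A.length = n) (hB : m.B.length = n)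
    {σ : State} {K : ℤ} (hK : K * σ.rreg 6 = m.q) (h1 : σ.nreg 1 = n)
    (hmA : ∀ t < n, σ.rmem 3 t = m.A.getD t 0) (hmB : ∀ t < n, σ.rmem 4 t = m.B.getD t 0) :
    Runs O (mazeProg m.k h K) σ (mazeTime m.k n) fun σ' =>
      σ'.query 2 (σ'.nreg 9) 2 (σ'.nreg 10) = m.toInstance.encode := by
  apply Runs.mono_time
  · apply Runs.cons_nset
    apply Runs.cons_nset
    apply Runs.cons (T₁ := 1) (R := Emitted n m.q m.A m.B [] [])
    · exact Runs.rset ⟨by simpa using h1, by simp [RExpr.eval, hK], hmA, hmB,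
        by simp [NExpr.eval], by simp [NExpr.eval]⟩
    intro σ₁ h₁
    apply Runs.cons (runs_pushProg_lin h₁ _ _)
    intro σ₂ h₂
    apply Runs.cons (runs_pushProg_lin h₂ _ _)
    intro σ₃ h₃
    apply Runs.cons (runs_pushProg_lin h₃ _ _)
    intro σ₄ h₄
    apply Runs.cons (runs_pushProg_lin h₄ _ _)
    intro σ₅ h₅
    apply Runs.cons (runs_boxProg h₅ _ _ _ _ _ _ _ _)
    intro σ₆ h₆
    apply Runs.cons (runs_block_flatMap (fun j bs σ hσ =>
      runs_block_flatMap (fun i bs σ hσ => runs_ringProg hh hA hB hσ j i) (List.range 3) hσ)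
      (List.range m.k) h₆)
    intro σ₇ h₇
    apply Runs.nil
    rw [State.query, h₇.outN, h₇.outR, Maze.toInstance_encode]
    have e : ([⟨_, _, _, _⟩] : List Box) = [m.outer] := congrArg (fun b => [b]) <| by
      show Box.mk (((-(4 * (3 * m.k + 1)) : ℤ) : ℝ) * m.q + ((0 : ℤ) : ℝ))
        (((4 * (3 * m.k ^ 2 + m.k) + 4 : ℤ) : ℝ) * m.q + ((0 : ℤ) : ℝ))
        (((-(4 * (3 * m.k + 1)) : ℤ) : ℝ) * m.q + ((0 : ℤ) : ℝ))
        (((4 * (3 * m.k + 1) : ℤ) : ℝ) * m.q + ((0 : ℤ) : ℝ)) = m.outer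
      simp only [Maze.outer, Maze.turn]
      push_cast
      congr 1 <;> ring
    rw [List.nil_append, e]
    refine Prod.ext rfl ?_
    show _ ++ _ = _ ++ _
    congr 1
    simp only [Maze.s, Maze.t, Maze.sgn, List.nil_append, List.cons_append]
    push_cast
    congr 1
    · ring
    congr 1
    · rw [hh]; ring
    congr 1
    · ring
    congr 1
    split_ifs <;> ring
  · simp only [List.length_range, mazeTime]
    ring_nf
    omega

end RealRAM

/-! ### The maze of an instance of 3SUM -/

namespace Maze

/-- The maze of a sorted list `zs` of integers, bounded by `N`. A link through the slits of three
consecutive rings, at heights in arithmetic progression, needs the middle offset to be the mean of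
the outer two; with the numbers `x` and `z` encoded by `16 * h * x` and `16 * h * z` in the outer
rings and `y` by `-(8 * h * y)` in the middle ring, this says `x + y + z = 0`. -/
def ofList (k : ℕ) (hk : 1 ≤ k) (zs : List ℝ) (N : ℝ) (hN : 1 ≤ N)
    (hzs : zs.Pairwise fun x y => x + 1 ≤ y) (hb : ∀ x ∈ zs, |x| ≤ N) : Maze where
  k := k
  h := 16 * (3 * k + 1)
  M := 16 * (16 * (3 * k + 1)) * N
  q := 400 * k * (16 * (16 * (3 * k + 1)) * N)
  A := zs.map fun x : ℝ => 16 * (16 * (3 * k + 1)) * x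
  B := (zs.map fun x : ℝ => -(8 * (16 * (3 * (k : ℝ) + 1))) * x).reverse
  one_le_k := hk
  h_eq := rfl
  h_le := by
    have : (0 : ℝ) ≤ k := by positivity
    nlinarith
  le_q := le_rfl
  pairwise_A := by
    refine List.pairwise_map.2 (hzs.imp fun {x y} h => ?_)
    have : (0 : ℝ) < 16 * (3 * k + 1) := by positivity
    nlinarith
  pairwise_B := by
    refine List.pairwise_reverse.2 (List.pairwise_map.2 (hzs.imp fun {x y} h => ?_))
    have : (0 : ℝ) < 16 * (3 * k + 1) := by positivity
    nlinarith
  abs_A := by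
    simp only [List.mem_map]
    rintro _ ⟨x, hx, rfl⟩
    rw [abs_mul, abs_of_nonneg (by positivity)]
    exact mul_le_mul_of_nonneg_left (hb x hx) (by positivity)
  abs_B := by
    simp only [List.mem_reverse, List.mem_map]
    rintro _ ⟨x, hx, rfl⟩
    have h0 : (0 : ℝ) ≤ 16 * (3 * k + 1) := by positivity
    rw [abs_mul, abs_neg, abs_of_nonneg (by positivity)]
    exact mul_le_mul (by linarith) (hb x hx) (abs_nonneg _) (by positivity)

variable {k : ℕ} {hk : 1 ≤ k} {zs : List ℝ} {N : ℝ} {hN : 1 ≤ N}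
  {hzs : zs.Pairwise fun x y => x + 1 ≤ y} {hb : ∀ x ∈ zs, |x| ≤ N}

lemma ofList_dist_of_sum_eq_zero {x y z : ℝ} (hx : x ∈ zs) (hy : y ∈ zs) (hz : z ∈ zs)
    (h : x + y + z = 0) : (ofList k hk zs N hN hzs hb).toInstance.dist = (2 + k : ℕ) := by
  refine (ofList k hk zs N hN hzs hb).dist_of_collinear (a := 16 * (16 * (3 * k + 1)) * x)
    (b := -(8 * (16 * (3 * k + 1))) * y) (c := 16 * (16 * (3 * k + 1)) * z)
    (List.mem_map.2 ⟨x, hx, rfl⟩) (List.mem_reverse.2 (List.mem_map.2 ⟨y, hy, rfl⟩))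
    (List.mem_map.2 ⟨z, hz, rfl⟩) ?_
  linear_combination 16 * (16 * (3 * k + 1)) * h

lemma ofList_dist_of_sum_ne_zero (hne : zs ≠ [])
    (h : ∀ x ∈ zs, ∀ y ∈ zs, ∀ z ∈ zs, 1 ≤ |x + y + z|) :
    (ofList k hk zs N hN hzs hb).toInstance.dist = (2 + 2 * k : ℕ) := by
  obtain ⟨x, hx⟩ := List.exists_mem_of_ne_nil _ hne
  refine (ofList k hk zs N hN hzs hb).dist_of_not_collinear
    (List.mem_map.2 ⟨x, hx, rfl⟩) (List.mem_reverse.2 (List.mem_map.2 ⟨x, hx, rfl⟩)) ?_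
  intro a ha b hb c hc
  obtain ⟨x, hx, rfl⟩ := List.mem_map.1 ha
  obtain ⟨y, hy, rfl⟩ := List.mem_map.1 (List.mem_reverse.1 hb)
  obtain ⟨z, hz, rfl⟩ := List.mem_map.1 hc
  have h0 : (0 : ℝ) < 16 * (3 * k + 1) := by positivity
  have e : 16 * (16 * (3 * k + 1)) * x + 16 * (16 * (3 * k + 1)) * z -
      2 * (-(8 * (16 * (3 * k + 1))) * y) = 16 * (16 * (3 * k + 1)) * (x + y + z) := by ring
  rw [e, abs_mul, abs_of_pos (by positivity : (0 : ℝ) < 16 * (16 * (3 * k + 1)))]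
  show 8 * (16 * (3 * (k : ℝ) + 1)) < _
  nlinarith [h x hx y hy z hz]

end Maze

namespace RealRAM

variable {O : Word → ℝ}

/-- Sort the input and write down its maze. -/
def buildProg (k : ℕ) : Prog :=
  .seq (sortProg (16 * (16 * (3 * k + 1))) (8 * (16 * (3 * k + 1))))
    (mazeProg k (16 * (3 * k + 1)) (400 * k * (16 * (16 * (3 * k + 1)))))

/-- The time that `buildProg` takes. -/
def buildTime (k n : ℕ) : ℕ :=
  (9 * rootUp n + 15) * (rootUp n + 1) + (n + 1) * (12 * rootUp n + 19) + mazeTime k n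

lemma runs_buildProg {k : ℕ} (hk : 1 ≤ k) {L : List ℤ} (hL : L.Nodup) {σ : State}
    (h1 : σ.nreg 1 = L.length)
    (h0 : σ.rmem 0 = fun t => (L.map (fun z : ℤ => (z : ℝ))).getD t 0) :
    Runs O (buildProg k) σ (buildTime k L.length) fun σ' =>
      ∃ (zs : List ℝ) (N : ℝ) (hN : 1 ≤ N) (hzs : zs.Pairwise fun x y => x + 1 ≤ y)
        (hb : ∀ x ∈ zs, |x| ≤ N), zs.Perm (L.map (fun z : ℤ => (z : ℝ))) ∧
        σ'.query 2 (σ'.nreg 9) 2 (σ'.nreg 10) =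
          (Maze.ofList k hk zs N hN hzs hb).toInstance.encode := by
  have hlen : (L.map (fun z : ℤ => (z : ℝ))).length = L.length := List.length_map ..
  refine Runs.seq (R := fun τ => ∃ zs : List ℝ, zs.Perm (L.map (fun z : ℤ => (z : ℝ))) ∧
      zs.Pairwise (· < ·) ∧ τ.nreg 1 = L.length ∧ 1 ≤ τ.rreg 6 ∧
      (∀ x ∈ L.map (fun z : ℤ => (z : ℝ)), |x| < τ.rreg 6) ∧
      (∀ t < L.length, τ.rmem 3 t = (16 * (16 * (3 * k + 1)) : ℤ) * zs.getD t 0) ∧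
      (∀ t < L.length, τ.rmem 4 (L.length - 1 - t) =
        -((8 * (16 * (3 * k + 1)) : ℤ) : ℝ) * zs.getD t 0))
    (T₁ := (9 * rootUp L.length + 15) * (rootUp L.length + 1) +
      (L.length + 1) * (12 * rootUp L.length + 19)) (T₂ := mazeTime k L.length) ?_ ?_
  · have := runs_sortProg (O := O) (hL.map Int.cast_injective (β := ℝ))
      (16 * (16 * (3 * k + 1))) (8 * (16 * (3 * k + 1))) (σ := σ) (by rw [hlen, h1]) h0
    rw [hlen] at this
    exact this
  · rintro τ ⟨zs, hperm, hsorted, t1, hN, hNL, memA, memB⟩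
    have hzlen : zs.length = L.length := hperm.length_eq.trans hlen
    have hint : ∀ x ∈ zs, ∃ z : ℤ, (z : ℝ) = x := fun x hx => by
      obtain ⟨z, _, hz⟩ := List.mem_map.1 (hperm.mem_iff.1 hx)
      exact ⟨z, hz⟩
    have hzs : zs.Pairwise fun x y => x + 1 ≤ y := by
      refine hsorted.imp_of_mem fun {x y} hx hy hlt => ?_
      obtain ⟨a, rfl⟩ := hint x hx
      obtain ⟨b, rfl⟩ := hint y hy
      exact_mod_cast Int.cast_lt.1 hlt
    have hb : ∀ x ∈ zs, |x| ≤ τ.rreg 6 := fun x hx => (hNL x (hperm.mem_iff.1 hx)).le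
    have hrun := runs_mazeProg (O := O) (n := L.length) (σ := τ)
      (K := 400 * k * (16 * (16 * (3 * k + 1)))) (Maze.ofList k hk zs (τ.rreg 6) hN hzs hb)
      (h := 16 * (3 * k + 1)) ?_ ?_ ?_ ?_ t1 ?_ ?_
    · exact hrun.conseq fun σ' h => ⟨zs, τ.rreg 6, hN, hzs, hb, hperm, h⟩
    · simp [Maze.ofList]
    · simp [Maze.ofList, hzlen]
    · simp [Maze.ofList, hzlen]
    · simp only [Maze.ofList]; push_cast; ring
    · intro t ht
      have ht' : t < zs.length := by omega
      rw [memA t ht, List.getD_eq_getElem _ _ ht', List.getD_eq_getElem _ _ (by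
        simpa [Maze.ofList] using ht')]
      simp [Maze.ofList]
    · intro t ht
      have ht' : zs.length - 1 - t < zs.length := by omega
      have := memB (L.length - 1 - t) (by omega)
      rw [show L.length - 1 - (L.length - 1 - t) = t by omega, ← hzlen,
        List.getD_eq_getElem _ _ ht'] at this
      rw [this, List.getD_eq_getElem _ _ (by simpa [Maze.ofList] using hzlen ▸ ht)]
      simp [Maze.ofList]

end RealRAM

/-! ### The reduction -/

lemma rootUp_le_sqrt_add_one (n : ℕ) : (RealRAM.rootUp n : ℝ) ≤ √n + 1 := by
  rcases Nat.eq_zero_or_pos (RealRAM.rootUp n) with h | h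
  · rw [h]; push_cast; positivity
  · obtain ⟨b, hb⟩ := Nat.exists_eq_succ_of_ne_zero h.ne'
    have h1 : b * b < n := RealRAM.lt_rootUp_iff.1 (by omega)
    have h2 : (b : ℝ) ≤ √n := Real.le_sqrt_of_sq_le (by rw [sq]; exact_mod_cast h1.le)
    rw [hb]; push_cast; linarith

/-- With `s = √(n + 1)`, all terms of the running time are bounded by multiples of `s ^ 3`. -/
lemma buildTime_le (k n : ℕ) :
    (RealRAM.buildTime k n : ℝ) ≤ (200 + 310 * k) * ((n : ℝ) + 1) ^ (2 - 1 / 2 : ℝ) := by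
  set s := √((n : ℝ) + 1) with hs
  have hss : s * s = n + 1 := Real.mul_self_sqrt (by positivity)
  have hs1 : 1 ≤ s := Real.one_le_sqrt.2 (by simp)
  have hpow : ((n : ℝ) + 1) ^ (2 - 1 / 2 : ℝ) = s * s * s := by
    rw [show (2 - 1 / 2 : ℝ) = 1 + 1 / 2 by norm_num, Real.rpow_add (by positivity), Real.rpow_one,
      ← Real.sqrt_eq_rpow, hss]
  have hr : (RealRAM.rootUp n : ℝ) ≤ 2 * s := by
    have h1 := rootUp_le_sqrt_add_one n
    have h2 : √(n : ℝ) ≤ s := Real.sqrt_le_sqrt (by linarith)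
    linarith
  have hn : (n : ℝ) = s * s - 1 := by linarith
  have hk : (0 : ℝ) ≤ k := by positivity
  have hs2 : s * s ≤ s * s * s := by nlinarith
  have hs3 : 1 ≤ s * s * s := by nlinarith
  rw [hpow, RealRAM.buildTime, RealRAM.mazeTime]
  push_cast
  set r : ℝ := (RealRAM.rootUp n : ℝ) with hrdef
  have hr0 : 0 ≤ r := by positivity
  have t1 : (9 * r + 15) * (r + 1) ≤ (33 * s) * (3 * s) :=
    mul_le_mul (by linarith) (by linarith) (by linarith) (by linarith)
  have t2 : ((n : ℝ) + 1) * (12 * r + 19) ≤ (s * s) * (43 * s) :=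
    mul_le_mul hss.ge (by linarith) (by linarith) (by positivity)
  have t3 : (k : ℝ) * (144 * n + 310) ≤ k * (310 * (s * s * s)) :=
    mul_le_mul_of_nonneg_left (by rw [hn]; linarith) hk
  linarith

open RealRAM in
/-- A problem is 3SUM-hard if its solvers tell the link distance `2 + k` from the link distance
`2 + 2 * k`, up to a program `fin` of constant running time that interprets the answer. -/
theorem threeSumHard_of_gap {Q : Problem} {k : ℕ} (hk : 1 ≤ k) (fin : Prog) (T : ℕ)
    (hQ : ∀ I : RectilinearInstance, I.dist = (2 + k : ℕ) ∨ I.dist = (2 + 2 * k : ℕ) →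
      ∃ y : Q.Inst, Q.encode y = I.encode ∧ Q.size y = I.size ∧
        ∀ O σ, Q.Answer y (σ.rreg 0) → Runs O fin σ T fun σ' =>
          (I.dist = (2 + k : ℕ) → σ'.rreg 0 = 1) ∧ (I.dist = (2 + 2 * k : ℕ) → σ'.rreg 0 = 0)) :
    ThreeSumHard Q := by
  refine ⟨1 / 2, by norm_num, .ite (.nle (.reg 1) (.const 0)) (.rset 0 (.const 0))
    (.seq (buildProg k) (.seq (.call 0 2 (.reg 9) 2 (.reg 10)) fin)), 202 + 310 * k + T, ?_⟩
  rintro O hO ⟨L, hL⟩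
  set σ₀ := init (threeSum.encode ⟨L, hL⟩) with hσ₀
  have h1 : σ₀.nreg 1 = L.length := by simp [hσ₀, init, threeSum]
  have h0 : σ₀.rmem 0 = fun t => (L.map (fun z : ℤ => (z : ℝ))).getD t 0 := by
    simp [hσ₀, init, threeSum]
  have hpow : (1 : ℝ) ≤ ((L.length : ℝ) + 1) ^ (2 - 1 / 2 : ℝ) :=
    Real.one_le_rpow (by linarith [Nat.cast_nonneg (α := ℝ) L.length]) (by norm_num)
  -- The empty list has no slits, so its maze has no path; it is answered without a query.
  by_cases hne : L = []
  · refine ⟨_, _, _, .iteTrue ?_ (.rset _ _ _), ?_, by simp, by simp, ?_⟩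
    · simp [BExpr.eval, NExpr.eval, h1, hne]
    · show ((1 + 1 : ℕ) : ℝ) ≤ ((202 + 310 * k + T : ℕ) : ℝ) * ((L.length : ℝ) + 1) ^ _
      push_cast
      have : (0 : ℝ) ≤ 310 * k + T := by positivity
      nlinarith
    · simp [threeSum, hne, RExpr.eval]
  obtain ⟨σ₁, t₁, hex, ht₁, zs, N, hN, hzs, hb, hperm, hquery⟩ :=
    runs_buildProg (O := O) hk hL h1 h0
  set I := (Maze.ofList k hk zs N hN hzs hb).toInstance with hI
  have hzlen : zs.length = L.length := hperm.length_eq.trans (List.length_map ..)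
  have hmem : ∀ {x : ℝ}, x ∈ zs ↔ ∃ a ∈ L, (a : ℝ) = x := fun {x} => by
    rw [hperm.mem_iff, List.mem_map]
  have hyes : (∃ a ∈ L, ∃ b ∈ L, ∃ c ∈ L, a + b + c = 0) → I.dist = (2 + k : ℕ) := by
    rintro ⟨a, ha, b, hb', c, hc, habc⟩
    exact Maze.ofList_dist_of_sum_eq_zero (hmem.2 ⟨a, ha, rfl⟩) (hmem.2 ⟨b, hb', rfl⟩)
      (hmem.2 ⟨c, hc, rfl⟩) (by exact_mod_cast habc)
  have hno : (¬∃ a ∈ L, ∃ b ∈ L, ∃ c ∈ L, a + b + c = 0) → I.dist = (2 + 2 * k : ℕ) := by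
    intro h
    refine Maze.ofList_dist_of_sum_ne_zero ?_ ?_
    · rintro rfl
      exact hne (List.length_eq_zero_iff.1 hzlen.symm)
    · intro x hx y hy z hz
      obtain ⟨a, ha, rfl⟩ := hmem.1 hx
      obtain ⟨b, hb', rfl⟩ := hmem.1 hy
      obtain ⟨c, hc, rfl⟩ := hmem.1 hz
      have : a + b + c ≠ 0 := fun h0 => h ⟨a, ha, b, hb', c, hc, h0⟩
      exact_mod_cast Int.one_le_abs this
  obtain ⟨y, hy, hsize, hfin⟩ := hQ I ((em _).imp hyes hno)
  have hans := hO y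
  obtain ⟨σ₂, t₂, hex₂, ht₂, hout⟩ := hfin O
    { σ₁ with rreg := Function.update σ₁.rreg 0 (O (Q.encode y)) } (by simpa using hans)
  have hcall := Exec.call (O := O) σ₁ 0 2 (.reg 9) 2 (.reg 10)
  simp only [NExpr.eval, hquery, ← hy] at hcall
  refine ⟨σ₂, _, _, .iteFalse ?_ (hex.seq (hcall.seq hex₂)), ?_, by simp; omega, ?_, ?_⟩
  · have := List.length_pos_iff.2 hne
    simp only [BExpr.eval, NExpr.eval, h1]
    omega
  · have h2 := buildTime_le k L.length
    have h3 : ((1 + (t₁ + (1 + t₂)) : ℕ) : ℝ) ≤ buildTime k L.length + 2 + T := by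
      exact_mod_cast (by omega : 1 + (t₁ + (1 + t₂)) ≤ buildTime k L.length + 2 + T)
    refine h3.trans ?_
    show _ ≤ ((202 + 310 * k + T : ℕ) : ℝ) * ((L.length : ℝ) + 1) ^ _
    push_cast
    have hT : (2 + T : ℝ) ≤ (2 + T) * ((L.length : ℝ) + 1) ^ (2 - 1 / 2 : ℝ) :=
      le_mul_of_one_le_right (by positivity) hpow
    linarith
  · simp only [List.append_nil, List.nil_append, List.mem_singleton, forall_eq]
    refine ⟨y, rfl, ?_⟩
    rw [hsize, hI, Maze.toInstance_size, Maze.length_holes]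
    simp only [Maze.ofList, List.length_map, List.length_reverse, hzlen]
    show _ ≤ (202 + 310 * k + T) * (L.length + 1)
    nlinarith [Nat.zero_le (k * L.length), Nat.zero_le (T * L.length), Nat.zero_le T]
  · show σ₂.rreg 0 = if ∃ a ∈ L, ∃ b ∈ L, ∃ c ∈ L, a + b + c = 0 then 1 else 0
    split_ifs with h
    · exact hout.1 (hyes h)
    · exact hout.2 (hno h)

open RealRAM in
/-- Compare the answer of an approximate solver with `2 + 2 * k`. -/
lemma threeSumHard_of_separation {Q : Problem} {k : ℕ} (hk : 1 ≤ k)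
    (hQ : ∀ I : RectilinearInstance, ∃ y : Q.Inst, Q.encode y = I.encode ∧ Q.size y = I.size ∧
      ∀ d, Q.Answer y d → (I.dist = (2 + k : ℕ) → d < 2 + 2 * k) ∧
        (I.dist = (2 + 2 * k : ℕ) → 2 + 2 * k ≤ d)) : ThreeSumHard Q := by
  refine threeSumHard_of_gap hk
    (.ite (.rle (.const (2 + 2 * k)) (.reg 0)) (.rset 0 (.const 0)) (.rset 0 (.const 1))) 2
    fun I _ => ?_
  obtain ⟨y, hy, hs, hd⟩ := hQ I
  refine ⟨y, hy, hs, fun O σ hσ => ?_⟩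
  obtain ⟨h1, h2⟩ := hd _ hσ
  refine Runs.ite (T := 1) (fun hb => ?_) fun hb => ?_
  · simp only [BExpr.eval, RExpr.eval] at hb
    push_cast at hb
    refine Runs.rset ⟨fun h => absurd (h1 h) (not_lt.2 hb), fun _ => by simp [RExpr.eval]⟩
  · simp only [BExpr.eval, RExpr.eval] at hb
    push_cast at hb
    refine Runs.rset ⟨fun _ => by simp [RExpr.eval], fun h => absurd (h2 h) hb⟩

theorem mainTheorem4 :
    (∀ ε : ℝ, 0 < ε → ThreeSumHard (linkMulApprox (2 - ε))) ∧
    (∀ c : ℝ, 0 ≤ c → ThreeSumHard (linkAddApprox c)) ∧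
    (∀ k : ℕ, 1 ≤ k → ThreeSumHard (linkGap k)) := by
  refine ⟨fun ε hε => ?_, fun c _ => ?_, fun k hk => ?_⟩
  -- The factor `2 - ε` is below `(2 + 2 * k) / (2 + k)` once `2 < ε * (2 + k)`.
  · obtain ⟨k₀, hk₀⟩ := exists_nat_gt (2 / ε)
    have hk : 2 / ε < ((k₀ + 1 : ℕ) : ℝ) := by push_cast; linarith
    rw [div_lt_iff₀ hε] at hk
    refine threeSumHard_of_separation (k := k₀ + 1) (by omega)
      fun I => ⟨I, rfl, rfl, fun d hd => ⟨fun h => ?_, fun h => ?_⟩⟩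
    · have := (hd _ h).2
      push_cast at this hk ⊢
      nlinarith
    · have := (hd _ h).1
      push_cast at this ⊢
      linarith
  · obtain ⟨k₀, hk₀⟩ := exists_nat_gt c
    refine threeSumHard_of_separation (k := k₀ + 1) (by omega)
      fun I => ⟨I, rfl, rfl, fun d hd => ⟨fun h => ?_, fun h => ?_⟩⟩
    · have := (hd _ h).2
      push_cast at this ⊢
      linarith
    · have := (hd _ h).1
      push_cast at this ⊢
      linarith
  · refine threeSumHard_of_gap hk .skip 1
      fun I hI => ⟨⟨I, hI⟩, rfl, rfl, fun O σ hσ => RealRAM.Runs.skip ⟨fun h => ?_, fun h => ?_⟩⟩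
    · exact hσ.trans (if_pos h)
    · refine hσ.trans (if_neg ?_)
      show ¬ I.dist = _
      rw [h, Nat.cast_inj]
      omega
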